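/- **Setting.** Let $\mathcal O$ be a complete local Noetherian domain whose residue field is algebraically closed of prime characteristic $p$ (a field is allowed), with maximal ideal $\mathfrak m$, and let $S$ be a finite $p$-group. An interior $S$-algebra is an $\mathcal O$-algebra $A$ with a group homomorphism $S\to A^\times$; then $S\times S$ acts on $A$ by $(s_1,s_2)\odot a=s_1as_2^{-1}$. An $(S,S)$-invariant $\mathcal O$-basis is an $\mathcal O$-basis $Y$ of $A$ with $SY=Y=YS$; it is *unital* if $Y\subseteq A^\times$. For $U\le S\times S$ let $A(U)=A^U\big/\bigl(\mathfrak m A^U+\sum_{V<U}\mathrm{tr}_V^U(A^V)\bigr)$ be the Brauer quotient and $\mathrm{br}_U:A^U\to A(U)$ the projection. For $P\le S$ and an injective homomorphism $\varphi:P\to S$ put $\Delta(\varphi,P)=\{(\varphi(x),x):x\in P\}$, ${}^\varphi A^P=A^{\Delta(\varphi,P)}$, $A(\varphi)=A(\Delta(\varphi,P))$; for the inclusion $\varphi$ write $A^P$, $A(P)$, $\mathrm{br}_P$. Multiplication of $A$ induces products $A(\psi)\times A(\varphi)\to A(\psi\varphi)$ for composable isomorphisms $\varphi,\psi$ between subgroups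 of $S$. *Fusion.* Let $\mathfrak F_S(A)$ have the subgroups of $S$ as objects and the injective homomorphisms $\varphi:P\to Q$ with $A(\varphi)\ne0$ as morphisms; $\mathrm{Iso}_{\mathfrak F_S(A)}(P,Q)$ denotes the set of group isomorphisms $\varphi:P\to Q$ with $A(\varphi)\neq 0$. $A$ is *divisible* if it has an $(S,S)$-invariant $\mathcal O$-basis, the left and the right action of $S$ on every such basis are free, and $\mathfrak F_S(A)$ is a category that contains all inclusions and in which every morphism is an isomorphism of $\mathfrak F_S(A)$ followed by an inclusion. (For divisible $A$ the set $\mathrm{Iso}_{\mathfrak F_S(A)}(P,Q)$ consists of the isomorphisms of this category.) *Local points.* A local point $\gamma$ of $A^P$ is an $(A^P)^\times$-conjugacy class of primitive idempotents of $A^P$ with $\mathrm{br}_P(\gamma)\ne0$; one writes $P_\gamma=(P,\gamma)$. For an idempotent $e\in A^P$, the multiplicity $m(\gamma,e)$ is the number of elements of $\gamma$ in a primitive idempotent decomposition of $e$ in $A^P$, and $m(P_\gamma)=m(\gamma,1)$. For local points $\gamma$ of $A^P$ and $\delta$ of $A^Q$, an $A^\times$-fusion $P_\gamma\to Q_\delta$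 is an injective homomorphism $\varphi:P\to Q$ such that for some $i\in\gamma$, $j\in\delta$, $u\in A^\times$, the element $i'=uiu^{-1}$ satisfies $i'\in A^{\varphi(P)}$, $i'=ji'j$ and $u(xi)u^{-1}=\varphi(x)i'$ for all $x\in P$. An $A^\times$-isofusion $P_\gamma\to Q_\delta$ is a group isomorphism $\varphi:P\to Q$ such that $\varphi$ is an $A^\times$-fusion $P_\gamma\to Q_\delta$ and $\varphi^{-1}$ is an $A^\times$-fusion $Q_\delta\to P_\gamma$. *Intrinsic balance.* $A$ is *intrinsically balanced* if (1) for every $\varphi\in\mathrm{Iso}_{\mathfrak F_S(A)}(P,Q)$ and every local point $\gamma$ of $A^P$ there is a local point $\delta$ of $A^Q$ such that $\varphi$ is an $A^\times$-isofusion $P_\gamma\to Q_\delta$; and (2) $m(P_\gamma)=m(Q_\delta)$ whenever there is an $A^\times$-isofusion $P_\gamma\to Q_\delta$. *Balance.* Let $\widehat A$ be a divisible $S$-algebra with a unital $(S,S)$-invariant $\mathcal O$-basis, $\ell\in\widehat A^S$ an idempotent, and $A=\ell\widehat A\ell$ (an interior $S$-algebra with identity $\ell$, via $s\mapsto \ell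 s\ell$). For $\varphi\in\mathrm{Iso}_{\mathfrak F_S(\widehat A)}(P,Q)$, a twisted unit is a $u\in\widehat A(\varphi)$ for which there is $u^\dagger\in\widehat A(\varphi^{-1})$ with $u^\dagger u=1_{\widehat A(P)}$. For a local point $\gamma$ of $\widehat A^P$, $\theta_\varphi(\gamma)$ is the local point $\delta$ of $\widehat A^Q$ such that, for $i\in\gamma$, $j\in\delta$ and a twisted unit $u\in\widehat A(\varphi)$, the elements $u\,\mathrm{br}_P(i)\,u^\dagger$ and $\mathrm{br}_Q(j)$ are conjugate under $\widehat A(Q)^\times$. $A$ is *balanced in $\widehat A$* if $m(\gamma,\ell)=m(\theta_\varphi(\gamma),\ell)$ for all $P,Q\le S$, all $\varphi\in\mathrm{Iso}_{\mathfrak F_S(A)}(P,Q)$ and all local points $\gamma$ of $\widehat A^P$. **Theorem.** Let $\widehat A$ be a divisible $S$-algebra, free of finite rank over $\mathcal O$, that possesses a unital $(S,S)$-invariant $\mathcal O$-basis, let $\ell\in\widehat A^S$ be an idempotent, and let $A=\ell\widehat A\ell$. Then the following are equivalent: 1. $A$ possesses a unital $(S,S)$-invariant $\mathcal O$-basis;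 2. $A$ is balanced in $\widehat A$; 3. $A$ is intrinsically balanced. -/

import Mathlib

namespace InteriorAlg

/-! An interior `S`-algebra over `O` is an `O`-algebra `A` with a group map `S → Aˣ`. As `S` is a
group, such a map is the same thing as a monoid homomorphism `σ : S →* A`. -/

section Basic

variable {O S A : Type*} [CommRing O] [Group S] [Ring A] [Algebra O A]

/-- A set `Y ⊆ A` that is an `(S,S)`-invariant `O`-basis of `A`. -/
structure IsInvariantBasis (O : Type*) {S A : Type*} [CommRing O] [Group S] [Ring A] [Algebra O A]
    (σ : S →* A) (Y : Set A) : Prop where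
  linearIndep : LinearIndepOn O id Y
  span_eq_top : Submodule.span O Y = ⊤
  left_mem : ∀ s : S, ∀ y ∈ Y, σ s * y ∈ Y
  right_mem : ∀ s : S, ∀ y ∈ Y, y * σ s ∈ Y

/-- `A` possesses a unital `(S,S)`-invariant `O`-basis, i.e. one that consists of units. -/
def HasUnitalInvariantBasis (O : Type*) {S A : Type*} [CommRing O] [Group S] [Ring A] [Algebra O A]
    (σ : S →* A) : Prop :=
  ∃ Y : Set A, IsInvariantBasis O σ Y ∧ ∀ y ∈ Y, IsUnit y

/-- `A` is a bifree `S`-algebra: it has an `(S,S)`-invariant `O`-basis, and both one-sided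
actions of `S` on any such basis are free. -/
def IsBifree (O : Type*) {S A : Type*} [CommRing O] [Group S] [Ring A] [Algebra O A]
    (σ : S →* A) : Prop :=
  (∃ Y : Set A, IsInvariantBasis O σ Y) ∧
    ∀ Y : Set A, IsInvariantBasis O σ Y → ∀ y ∈ Y, ∀ s : S,
      (σ s * y = y → s = 1) ∧ (y * σ s = y → s = 1)

/-- The action of `S × S` on `A`: `(s₁, s₂) ⊙ a = s₁ · a · s₂⁻¹`. -/
def biact (σ : S →* A) (s : S × S) (a : A) : A := σ s.1 * a * σ s.2⁻¹

/-- The submodule `A ^ U` of points fixed by a subgroup `U ≤ S × S`. -/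
def fixedSubmodule (O : Type*) {S A : Type*} [CommRing O] [Group S] [Ring A] [Algebra O A]
    (σ : S →* A) (U : Subgroup (S × S)) : Submodule O A where
  carrier := {a | ∀ s ∈ U, biact σ s a = a}
  add_mem' := by
    intro a b ha hb s hs
    have h1 := ha s hs
    have h2 := hb s hs
    simp only [biact] at h1 h2 ⊢
    rw [mul_add, add_mul, h1, h2]
  zero_mem' := by
    intro s _
    simp [biact]
  smul_mem' := by
    intro c a ha s hs
    have h1 := ha s hs
    simp only [biact] at h1 ⊢
    rw [mul_smul_comm, smul_mul_assoc, h1]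

/-- The relative trace `a ↦ ∑ u ⊙ a`, with `u` running over representatives of `U / V`. It is
only applied to `V ≤ U` and `a ∈ A ^ V`, where the choice of representatives is immaterial. -/
noncomputable def relTrace (σ : S →* A) (V U : Subgroup (S × S)) (a : A) : A :=
  ∑ᶠ c : U ⧸ V.subgroupOf U, biact σ ((Quotient.out c : U) : S × S) a

/-- The kernel `𝔪 A ^ U + ∑_{V < U} tr_V^U (A ^ V)` of the Brauer homomorphism `br_U`. -/
noncomputable def brauerKernel (O : Type*) {S A : Type*} [CommRing O] [IsLocalRing O] [Group S]
    [Ring A] [Algebra O A] (σ : S →* A) (U : Subgroup (S × S)) : Submodule O A :=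
  (IsLocalRing.maximalIdeal O) • fixedSubmodule O σ U ⊔
    Submodule.span O {x : A | ∃ V : Subgroup (S × S), V < U ∧
      ∃ a ∈ fixedSubmodule O σ V, x = relTrace σ V U a}

/-- The Brauer quotient `A(U)`. -/
abbrev BrauerQuotient (O : Type*) {S A : Type*} [CommRing O] [IsLocalRing O] [Group S]
    [Ring A] [Algebra O A] (σ : S →* A) (U : Subgroup (S × S)) : Type _ :=
  ↥(fixedSubmodule O σ U) ⧸ (brauerKernel O σ U).submoduleOf (fixedSubmodule O σ U)

/-- The twisted diagonal subgroup `Δ(φ, P) = {(φ p, p)}` of `S × S`. -/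
def twistedDiag {P : Subgroup S} (φ : P →* S) : Subgroup (S × S) := (φ.prod P.subtype).range

/-- `φ : P → Q` is a morphism of the fixed-point fusion presystem of `A`: it is injective and
the twisted Brauer quotient `A(φ)` is nonzero. -/
def IsFixedPointFusion (O : Type*) {S A : Type*} [CommRing O] [IsLocalRing O] [Group S]
    [Ring A] [Algebra O A] (σ : S →* A) {P Q : Subgroup S} (φ : P →* Q) : Prop :=
  Function.Injective φ ∧ Nontrivial (BrauerQuotient O σ (twistedDiag (Q.subtype.comp φ)))

/-- `A` is a divisible `S`-algebra: it is bifree, and its fixed-point fusion presystem is a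
category that contains all inclusions and in which every morphism is an isomorphism (of that
category) followed by an inclusion. -/
structure IsDivisible (O : Type*) {S A : Type*} [CommRing O] [IsLocalRing O] [Group S]
    [Ring A] [Algebra O A] (σ : S →* A) : Prop where
  bifree : IsBifree O σ
  inclusion : ∀ (P Q : Subgroup S) (h : P ≤ Q), IsFixedPointFusion O σ (Subgroup.inclusion h)
  comp : ∀ (P Q R : Subgroup S) (φ : P →* Q) (ψ : Q →* R), IsFixedPointFusion O σ φ →
    IsFixedPointFusion O σ ψ → IsFixedPointFusion O σ (ψ.comp φ)
  factor : ∀ (P Q : Subgroup S) (φ : P →* Q), IsFixedPointFusion O σ φ →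
    ∃ (R : Subgroup S) (h : R ≤ Q) (ψ : P ≃* R), IsFixedPointFusion O σ ψ.toMonoidHom ∧
      IsFixedPointFusion O σ ψ.symm.toMonoidHom ∧ φ = (Subgroup.inclusion h).comp ψ.toMonoidHom

/-- In a divisible algebra, a group isomorphism that is a morphism of the fixed-point fusion
presystem is an isomorphism of it. -/
theorem IsDivisible.symm [IsLocalRing O] {σ : S →* A} (h : IsDivisible O σ) {P Q : Subgroup S}
    (φ : P ≃* Q) (hφ : IsFixedPointFusion O σ φ.toMonoidHom) :
    IsFixedPointFusion O σ φ.symm.toMonoidHom := by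
  obtain ⟨R, hR, ψ, -, h2, h3⟩ := h.factor P Q φ.toMonoidHom hφ
  have hval : ∀ p : P, ((φ p : Q) : S) = ((ψ p : R) : S) := fun p => by
    have := DFunLike.congr_fun h3 p
    exact congrArg Subtype.val this
  have hRQ : R = Q := by
    refine le_antisymm hR fun x hx => ?_
    obtain ⟨p, hp⟩ := φ.surjective ⟨x, hx⟩
    have := hval p
    rw [hp] at this
    change x = _ at this
    rw [this]
    exact (ψ p).2
  subst hRQ
  have : φ = ψ := by
    ext p
    exact hval p
  rw [this]
  exact h2

/-- The fixed-point subalgebra `A ^ P` for the conjugation action of `P ≤ S`. -/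
def fixedAlgebra (O : Type*) {S A : Type*} [CommRing O] [Group S] [Ring A] [Algebra O A]
    (σ : S →* A) (P : Subgroup S) : Subalgebra O A :=
  Subalgebra.centralizer O (σ '' (P : Set S))

/-- A primitive idempotent of a ring. -/
def IsPrimitiveIdem {R : Type*} [Ring R] (e : R) : Prop :=
  IsIdempotentElem e ∧ e ≠ 0 ∧ ∀ f g : R, IsIdempotentElem f → IsIdempotentElem g →
    f * g = 0 → g * f = 0 → e = f + g → f = 0 ∨ g = 0

/-- A point of a ring: a conjugacy class (under the unit group) of primitive idempotents. -/
def IsPoint {R : Type*} [Ring R] (γ : Set R) : Prop :=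
  ∃ e : R, IsPrimitiveIdem e ∧ γ = {f | ∃ u : Rˣ, f = u * e * (u⁻¹ : Rˣ)}

/-- A primitive idempotent decomposition of `e` in a ring. -/
def IsPrimitiveDecomposition {R : Type*} [Ring R] (I : Finset R) (e : R) : Prop :=
  (∀ i ∈ I, IsPrimitiveIdem i) ∧ (∀ i ∈ I, ∀ j ∈ I, i ≠ j → i * j = 0) ∧ ∑ i ∈ I, i = e

/-- The multiplicity of the point `γ` in the idempotent `e`: the number of elements of `γ` in a
primitive idempotent decomposition of `e`. (The number is the same for all decompositions in the
rings considered here.) -/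
noncomputable def pointMultiplicity {R : Type*} [Ring R] (γ : Set R) (e : R) : ℕ :=
  sInf {n | ∃ I : Finset R, IsPrimitiveDecomposition I e ∧ n = {i | i ∈ I ∧ i ∈ γ}.ncard}

/-- `γ` is a local point of `A ^ P`: a point with `br_P(γ) ≠ 0`. -/
def IsLocalPoint (O : Type*) {S A : Type*} [CommRing O] [IsLocalRing O] [Group S]
    [Ring A] [Algebra O A] (σ : S →* A) (P : Subgroup S) (γ : Set (fixedAlgebra O σ P)) : Prop :=
  IsPoint γ ∧ ∃ i ∈ γ, (i : A) ∉ brauerKernel O σ (twistedDiag P.subtype)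

/-- `φ : P → Q` is an `Aˣ`-fusion `P_γ → Q_δ`, i.e. a morphism of the local unital Puig
category of `A`: it is injective and there are `i ∈ γ`, `j ∈ δ` and a unit `u` with
`ᵘi ∈ A ^ φ(P)`, `ᵘi ≤ j`, and `ᵘ(p · i) = φ(p) · ᵘi` for all `p ∈ P`. -/
def IsUnitFusion {σ : S →* A} {P Q : Subgroup S} (γ : Set (fixedAlgebra O σ P))
    (δ : Set (fixedAlgebra O σ Q)) (φ : P →* Q) : Prop :=
  Function.Injective φ ∧ ∃ i ∈ γ, ∃ j ∈ δ, ∃ u : Aˣ,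
    (u * i * (u⁻¹ : Aˣ) : A) ∈ fixedAlgebra O σ (Q.subtype.comp φ).range ∧
    (u * i * (u⁻¹ : Aˣ) : A) = j * (u * i * (u⁻¹ : Aˣ)) * j ∧
    ∀ p : P, (u * (σ p * i) * (u⁻¹ : Aˣ) : A) = σ (φ p) * (u * i * (u⁻¹ : Aˣ))

/-- `φ : P ≃ Q` is an isomorphism `P_γ → Q_δ` of the local unital Puig category of `A`. -/
def IsUnitIsofusion {σ : S →* A} {P Q : Subgroup S} (γ : Set (fixedAlgebra O σ P))
    (δ : Set (fixedAlgebra O σ Q)) (φ : P ≃* Q) : Prop :=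
  IsUnitFusion γ δ φ.toMonoidHom ∧ IsUnitFusion δ γ φ.symm.toMonoidHom

/-- `A` is intrinsically balanced.
Here and in `IsBalanced`, `φ` runs over the group isomorphisms `P ≃ Q` with `A(φ) ≠ 0`; if `A` is
divisible these are exactly the isomorphisms of its fixed-point fusion presystem. -/
def IsIntrinsicallyBalanced (O : Type*) {S A : Type*} [CommRing O] [IsLocalRing O] [Group S]
    [Ring A] [Algebra O A] (σ : S →* A) : Prop :=
  (∀ (P Q : Subgroup S) (φ : P ≃* Q), IsFixedPointFusion O σ φ.toMonoidHom →
    ∀ γ : Set (fixedAlgebra O σ P), IsLocalPoint O σ P γ →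
      ∃ δ : Set (fixedAlgebra O σ Q), IsLocalPoint O σ Q δ ∧ IsUnitIsofusion γ δ φ) ∧
  ∀ (P Q : Subgroup S) (γ : Set (fixedAlgebra O σ P)) (δ : Set (fixedAlgebra O σ Q)),
    IsLocalPoint O σ P γ → IsLocalPoint O σ Q δ → (∃ φ : P ≃* Q, IsUnitIsofusion γ δ φ) →
      pointMultiplicity γ 1 = pointMultiplicity δ 1

/-- `a ∈ A ^ Δ(φ, P)` and `b ∈ A ^ Δ(φ⁻¹, Q)` represent a twisted unit `br(a) ∈ A(φ)` and its
twisted inverse `br(b) ∈ A(φ⁻¹)`, i.e. `br(b) · br(a) = br_P(b * a)` is the identity of `A(P)`. -/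
def RepresentsTwistedUnit (O : Type*) {S A : Type*} [CommRing O] [IsLocalRing O] [Group S]
    [Ring A] [Algebra O A] (σ : S →* A) {P Q : Subgroup S} (φ : P ≃* Q) (a b : A) : Prop :=
  a ∈ fixedSubmodule O σ (twistedDiag (Q.subtype.comp φ.toMonoidHom)) ∧
  b ∈ fixedSubmodule O σ (twistedDiag (P.subtype.comp φ.symm.toMonoidHom)) ∧
  b * a - 1 ∈ brauerKernel O σ (twistedDiag P.subtype)

/-- For `x, y ∈ A ^ P`, the elements `br_P(x)` and `br_P(y)` of the algebra `A(P)` are conjugate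
under the unit group of `A(P)`; `c` and `d` represent the conjugating unit and its inverse. -/
def BrauerConj (O : Type*) {S A : Type*} [CommRing O] [IsLocalRing O] [Group S]
    [Ring A] [Algebra O A] (σ : S →* A) (P : Subgroup S) (x y : A) : Prop :=
  ∃ c ∈ fixedAlgebra O σ P, ∃ d ∈ fixedAlgebra O σ P,
    c * d - 1 ∈ brauerKernel O σ (twistedDiag P.subtype) ∧
    d * c - 1 ∈ brauerKernel O σ (twistedDiag P.subtype) ∧
    c * x * d - y ∈ brauerKernel O σ (twistedDiag P.subtype)

/-- The relation `θ_φ(γ) = δ` on local points: for a twisted unit `u ∈ A(φ)` with twisted inverse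
`u†`, represented by `a` and `b`, the element `u · br_P(i) · u† = br_Q(a * i * b)` with `i ∈ γ`
lies in the point of `A(Q)` that is the image of `δ`. -/
def TwistedTransport (O : Type*) {S A : Type*} [CommRing O] [IsLocalRing O] [Group S]
    [Ring A] [Algebra O A] (σ : S →* A) {P Q : Subgroup S} (φ : P ≃* Q)
    (γ : Set (fixedAlgebra O σ P)) (δ : Set (fixedAlgebra O σ Q)) : Prop :=
  ∃ a b : A, RepresentsTwistedUnit O σ φ a b ∧
    ∃ i ∈ γ, ∃ j ∈ δ, BrauerConj O σ Q (a * i * b) j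

end Basic

section Corner

variable {O S A : Type*} [CommRing O] [Group S] [Ring A] [Algebra O A] {l : A}

/-- The corner `l A l`, with identity `l`, is an `O`-algebra with the scalar action of `A`. -/
instance cornerAlgebra (hl : IsIdempotentElem l) : Algebra O hl.Corner where
  smul c x := ⟨c • x.1, by
    obtain ⟨y, hy⟩ := x.2
    refine ⟨c • y, ?_⟩
    simp only at hy ⊢
    rw [mul_smul_comm, smul_mul_assoc, hy]⟩
  algebraMap :=
    { toFun := fun c => ⟨c • l, ⟨c • (1 : A), by
        simp only
        rw [mul_smul_comm, smul_mul_assoc, mul_one, hl.eq]⟩⟩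
      map_one' := Subtype.ext (one_smul O l)
      map_mul' := fun c d => Subtype.ext (by
        change (c * d) • l = (c • l) * (d • l)
        rw [smul_mul_assoc, mul_smul_comm, hl.eq, mul_smul])
      map_zero' := Subtype.ext (zero_smul O l)
      map_add' := fun c d => Subtype.ext (add_smul c d l) }
  commutes' := fun c x => Subtype.ext (by
    have h := (Subsemigroup.mem_corner_iff hl).mp x.2
    change (c • l) * x.1 = x.1 * (c • l)
    rw [smul_mul_assoc, mul_smul_comm, h.1, h.2])
  smul_def' := fun c x => Subtype.ext (by
    have h := (Subsemigroup.mem_corner_iff hl).mp x.2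
    change c • x.1 = (c • l) * x.1
    rw [smul_mul_assoc, h.1])

/-- The interior `S`-algebra structure `s ↦ l · s · l` of the corner `l A l`, for `l ∈ A ^ S`. -/
def cornerHom (σ : S →* A) (hl : IsIdempotentElem l) (hS : l ∈ fixedAlgebra O σ ⊤) :
    S →* hl.Corner where
  toFun s := ⟨l * σ s * l, ⟨σ s, rfl⟩⟩
  map_one' := Subtype.ext (by
    change l * σ 1 * l = l
    rw [map_one, mul_one, hl.eq])
  map_mul' := fun s t => Subtype.ext (by
    have h : σ t * l = l * σ t :=
      (Subalgebra.mem_centralizer_iff O).mp hS (σ t) ⟨t, trivial, rfl⟩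
    change l * σ (s * t) * l = (l * σ s * l) * (l * σ t * l)
    rw [map_mul]
    calc l * (σ s * σ t) * l = l * σ s * (σ t * l) := by simp only [mul_assoc]
      _ = l * σ s * (l * σ t) := by rw [h]
      _ = l * σ s * (l * l * σ t) := by rw [hl.eq]
      _ = l * σ s * l * (l * σ t) := by simp only [mul_assoc]
      _ = l * σ s * l * (l * (σ t * l)) := by rw [h, ← mul_assoc l l, hl.eq]
      _ = (l * σ s * l) * (l * σ t * l) := by simp only [mul_assoc])

/-- An element of `A ^ S`, viewed in `A ^ P`. -/
def restrictFixed {σ : S →* A} (hS : l ∈ fixedAlgebra O σ ⊤) (P : Subgroup S) :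
    fixedAlgebra O σ P :=
  ⟨l, Subalgebra.centralizer_le O _ _ (Set.image_mono fun _ _ => trivial) hS⟩

/-- The corner `l A l` is balanced in `A`: for every isomorphism `φ : P ≃ Q` of the fixed-point
fusion presystem of the corner and every local point `γ` of `A ^ P`, the relative multiplicities
of `γ` and of `θ_φ(γ)` in `l` agree. -/
def IsBalanced [IsLocalRing O] (σ : S →* A) (hl : IsIdempotentElem l)
    (hS : l ∈ fixedAlgebra O σ ⊤) : Prop :=
  ∀ (P Q : Subgroup S) (φ : P ≃* Q), IsFixedPointFusion O (cornerHom σ hl hS) φ.toMonoidHom →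
    ∀ γ : Set (fixedAlgebra O σ P), IsLocalPoint O σ P γ →
      ∃ δ : Set (fixedAlgebra O σ Q), IsLocalPoint O σ Q δ ∧ TwistedTransport O σ φ γ δ ∧
        pointMultiplicity γ (restrictFixed hS P) = pointMultiplicity δ (restrictFixed hS Q)

end Corner

end InteriorAlg

/-! Write `Â` for the big algebra and `A = l Â l`. All three conditions are equivalent to a fourth
one, `HasFusionUnits` for the corner: each isomorphism `φ : P ≃ Q` with `A(φ) ≠ 0` is induced by a
unit `u` of `A`, in the sense that `φ(x) u = u x` for all `x` in `P`.

Unital bases. The Brauer quotient at `U` is nonzero exactly when `U` fixes an element of an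
invariant basis (`IsInvariantBasis.nontrivial_brauerQuotient_iff`), so a unital basis yields fusion
units. For the converse, `A` has some invariant basis, because direct summands of permutation
modules of `p`-groups are permutation modules (`exists_basis_range_of_isIdempotentElem`). By
bifreeness of `Â` the stabilizer of a basis element is a twisted diagonal, so it fixes a unit of
`A`. Choose these units equivariantly as `f(y)`. For a generic scalar `r` the elements `r⁻¹ y -
f(y)` are again an invariant basis, and they are units (`IsInvariantBasis.hasUnitalInvariantBasis`).
This uses that the residue field is infinite.

Balance. Since `Â` has a unital basis, each `φ` that occurs in `A` is induced by a unit `v` of `Â`.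
Conjugation by `v` maps `Â^P` onto `Â^Q`, and both kinds of balance amount to `IsUnitBalanced`: this
conjugation preserves the multiplicities of local points in `l`. Twisted units enter only modulo the
Brauer kernel, where lifting through a local idempotent shows that they transport points as `v` does
(`TwistedTransport.exists_idemEquiv`). For intrinsic balance, points of `A^P` are identified with
the points of `Â^P` that have nonzero multiplicity in `l`.

The decisive step is `IsUnitBalanced.hasFusionUnits`. The idempotents `l` and `v⁻¹ l v` of `Â^P`
have the same multiplicities at the local points of all subgroups of `P`. By
`idemEquiv_of_sameMultiplicities` they are then equivalent in `Â^P`, and composing the equivalence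
with `v` gives a unit of `A` that induces `φ`. That lemma is a form of Green's theory of vertices: a
primitive idempotent whose vertex has maximal order is detected by a local point at that vertex
(`idemEquiv_of_mul_notMem`), so it can be matched and cancelled. The Krull-Schmidt theorem
`idemCount_eq`, available because finite algebras over `O` are semiperfect, underlies all of these
counts. -/

namespace InteriorAlg

/-! ### Equivalence of idempotents and local corners. -/

section Idempotents

variable {R : Type*} [Ring R]

/-- Equivalence (association) of idempotents. -/
def IdemEquiv (e f : R) : Prop := ∃ a b : R, a * b = e ∧ b * a = f

/-- `y` is invertible relative to the idempotent `i`. -/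
def IsCornerUnit (i y : R) : Prop := ∃ z : R, z * y = i ∧ y * z = i

/-- An idempotent whose corner ring is local. -/
def IsLocalIdem (i : R) : Prop :=
  IsIdempotentElem i ∧ i ≠ 0 ∧ ∀ y : R, IsCornerUnit i (i * y * i) ∨ IsCornerUnit i (i * (1 - y) * i)

theorem IdemEquiv.refl {e : R} (he : IsIdempotentElem e) : IdemEquiv e e := ⟨e, e, he, he⟩

theorem IdemEquiv.symm {e f : R} (h : IdemEquiv e f) : IdemEquiv f e := by
  obtain ⟨a, b, h1, h2⟩ := h
  exact ⟨b, a, h2, h1⟩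

/-- Compressing the given pair to `e a f` and `f b e` does not change the products. The equations
for one-sided identities are what later makes cross terms vanish. -/
theorem IdemEquiv.exists_normalized {e f : R} (h : IdemEquiv e f) (he : IsIdempotentElem e)
    (hf : IsIdempotentElem f) : ∃ a b : R, a * b = e ∧ b * a = f ∧ e * a = a ∧ a * f = a ∧
      f * b = b ∧ b * e = b := by
  obtain ⟨a, b, h1, h2⟩ := h
  have he' : e * e = e := he
  have hf' : f * f = f := hf
  refine ⟨e * a * f, f * b * e, ?_, ?_, ?_, ?_, ?_, ?_⟩
  · calc e * a * f * (f * b * e) = e * a * (f * f) * b * e := by noncomm_ring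
      _ = e * a * (b * a) * b * e := by rw [hf', h2]
      _ = e * (a * b) * (a * b) * e := by noncomm_ring
      _ = e := by rw [h1]; simp only [he']
  · calc f * b * e * (e * a * f) = f * b * (e * e) * a * f := by noncomm_ring
      _ = f * b * (a * b) * a * f := by rw [he', h1]
      _ = f * (b * a) * (b * a) * f := by noncomm_ring
      _ = f := by rw [h2]; simp only [hf']
  · simp only [← mul_assoc, he']
  · simp only [mul_assoc, hf']
  · simp only [← mul_assoc, hf']
  · simp only [mul_assoc, he']

theorem IdemEquiv.trans {e f g : R} (h : IdemEquiv e f) (h' : IdemEquiv f g)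
    (he : IsIdempotentElem e) (hf : IsIdempotentElem f) (hg : IsIdempotentElem g) :
    IdemEquiv e g := by
  obtain ⟨a, b, h1, h2, h3, h4, h5, h6⟩ := h.exists_normalized he hf
  obtain ⟨c, d, k1, k2, k3, k4, k5, k6⟩ := h'.exists_normalized hf hg
  refine ⟨a * c, d * b, ?_, ?_⟩
  · rw [mul_assoc, ← mul_assoc c, k1, h5, h1]
  · rw [mul_assoc, ← mul_assoc b, h2, k3, k2]

theorem IdemEquiv.add {e f e' f' : R} (h : IdemEquiv e f) (h' : IdemEquiv e' f')
    (he : IsIdempotentElem e) (hf : IsIdempotentElem f) (he' : IsIdempotentElem e')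
    (hf' : IsIdempotentElem f') (h1 : e * e' = 0) (h2 : e' * e = 0) (h3 : f * f' = 0)
    (h4 : f' * f = 0) : IdemEquiv (e + e') (f + f') := by
  obtain ⟨a, b, a1, a2, a3, a4, a5, a6⟩ := h.exists_normalized he hf
  obtain ⟨c, d, c1, c2, c3, c4, c5, c6⟩ := h'.exists_normalized he' hf'
  refine ⟨a + c, b + d, ?_, ?_⟩
  · have e1 : a * d = 0 := by rw [← a4, ← c5, mul_assoc, ← mul_assoc f, h3, zero_mul, mul_zero]
    have e2 : c * b = 0 := by rw [← c4, ← a5, mul_assoc, ← mul_assoc f', h4, zero_mul, mul_zero]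
    rw [add_mul, mul_add, mul_add, a1, c1, e1, e2]; simp
  · have e1 : b * c = 0 := by rw [← a6, ← c3, mul_assoc, ← mul_assoc e, h1, zero_mul, mul_zero]
    have e2 : d * a = 0 := by rw [← c6, ← a3, mul_assoc, ← mul_assoc e', h2, zero_mul, mul_zero]
    rw [add_mul, mul_add, mul_add, a2, c2, e1, e2]; simp

/-- Cancellation by a Schur complement. -/
theorem IdemEquiv.sub_of_cornerUnit {e f i j a b c : R} (he : IsIdempotentElem e)
    (hf : IsIdempotentElem f)
    (hei : e * i = i) (hie : i * e = i) (hfj : f * j = j) (hjf : j * f = j)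
    (hi : IsIdempotentElem i) (hj : IsIdempotentElem j)
    (hab : a * b = e) (hba : b * a = f) (hea : e * a = a) (haf : a * f = a)
    (hjc : j * c = c) (hci : c * i = c)
    (h1 : i * a * c = i) (h2 : c * a * j = j) : IdemEquiv (e - i) (f - j) := by
  have hi' : i * i = i := hi
  have hj' : j * j = j := hj
  have he' : e * e = e := he
  have hf' : f * f = f := hf
  have key1 : (a - a * c * a) * j = 0 := by
    rw [sub_mul, mul_assoc (a * c), mul_assoc a c, ← mul_assoc c, h2, sub_self]
  have key2 : i * (a - a * c * a) = 0 := by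
    rw [mul_sub, ← mul_assoc, ← mul_assoc, h1, sub_self]
  have hcE : c * (e - i) = 0 := by
    rw [mul_sub, hci, ← hci, mul_assoc, hie, sub_self]
  have hFc : (f - j) * c = 0 := by
    rw [sub_mul, hjc, ← hjc, ← mul_assoc, hfj, sub_self]
  have hc1 : c * e = c := by rw [← hci, mul_assoc, hie]
  have hc2 : f * c = c := by rw [← hjc, ← mul_assoc, hfj]
  have hEE : (e - i) * (e - i) = e - i := by
    rw [sub_mul, mul_sub, mul_sub, he', hei, hie, hi']; simp
  have hFF : (f - j) * (f - j) = f - j := by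
    rw [sub_mul, mul_sub, mul_sub, hf', hfj, hjf, hj']; simp
  have hm : (a - a * c * a) * (f - j) = a - a * c * a := by
    rw [mul_sub, key1, sub_zero, sub_mul, haf, mul_assoc, haf]
  have hm' : (e - i) * (a - a * c * a) = a - a * c * a := by
    rw [sub_mul, key2, sub_zero, mul_sub, hea, ← mul_assoc, ← mul_assoc, hea]
  -- `a - a c a` is the Schur complement of the invertible block `i a j` of `a`: it is killed by `i`
  -- on the left and by `j` on the right, and the compression of `b` inverts it.
  refine ⟨a - a * c * a, (f - j) * b * (e - i), ?_, ?_⟩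
  · calc (a - a * c * a) * ((f - j) * b * (e - i))
        = ((a - a * c * a) * (f - j)) * b * (e - i) := by noncomm_ring
      _ = (a - a * c * a) * b * (e - i) := by rw [hm]
      _ = (a * b - a * c * (a * b)) * (e - i) := by noncomm_ring
      _ = e * (e - i) - a * (c * e) * (e - i) := by rw [hab]; noncomm_ring
      _ = (e - i) - a * (c * (e - i)) := by rw [hc1, mul_sub, he', hei, mul_assoc]
      _ = e - i := by rw [hcE, mul_zero, sub_zero]
  · calc (f - j) * b * (e - i) * (a - a * c * a)
        = (f - j) * b * ((e - i) * (a - a * c * a)) := by noncomm_ring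
      _ = (f - j) * ((b * a) - (b * a) * c * a) := by rw [hm']; noncomm_ring
      _ = (f - j) * f - (f - j) * (f * c) * a := by rw [hba]; noncomm_ring
      _ = f - j := by rw [hc2, hFc, zero_mul, sub_zero, sub_mul, hf', hjf]

/-- In a local ring a sum of nonunits is a nonunit. With `z` inverse to `i (x + y) i`, locality is
applied to `z i x`, whose complement in the corner is `z i y`. As `z` gives a unit of the corner, it
can be divided out again, which is `main`. -/
theorem IsLocalIdem.isCornerUnit_add {i x y : R} (hi : IsLocalIdem i)
    (h : IsCornerUnit i (i * (x + y) * i)) :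
    IsCornerUnit i (i * x * i) ∨ IsCornerUnit i (i * y * i) := by
  obtain ⟨hii, hi0, hloc⟩ := hi
  have hii' : i * i = i := hii
  obtain ⟨z, hz1, hz2⟩ := h
  have main : ∀ x y z : R, z * (i * (x + y) * i) = i → (i * (x + y) * i) * z = i →
      IsCornerUnit i (i * (z * (i * x)) * i) → IsCornerUnit i (i * x * i) := by
    intro x y z hz1 hz2 hw
    obtain ⟨w, hw1, hw2⟩ := hw
    have e1 : i * z * i * x * i = i * (z * (i * x)) * i := by noncomm_ring
    refine ⟨w * i * z * i, ?_, ?_⟩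
    · calc w * i * z * i * (i * x * i) = w * (i * (z * ((i * i) * x)) * i) := by noncomm_ring
        _ = i := by rw [hii', hw1]
    · have e2 : i * (x + y) * i * (i * z * i) = i := by
        calc i * (x + y) * i * (i * z * i) = (i * (x + y) * (i * i) * z) * i := by noncomm_ring
          _ = i := by rw [hii', hz2, hii']
      calc (i * x * i) * (w * i * z * i)
          = i * (i * x * i) * (w * i * z * i) := by rw [← mul_assoc i, ← mul_assoc i, hii']
        _ = (i * (x + y) * i * (i * z * i)) * (i * x * i) * (w * i * z * i) := by rw [e2]
        _ = (i * (x + y) * i) * ((i * (z * ((i * i) * x)) * i) * w) * (i * z * i) := by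
            noncomm_ring
        _ = (i * (x + y) * i) * i * (i * z * i) := by rw [hii', hw2]
        _ = (i * (x + y) * (i * i)) * (i * z * i) := by noncomm_ring
        _ = i := by rw [hii', e2]
  rcases hloc (z * (i * x)) with h | h
  · exact Or.inl (main x y z hz1 hz2 h)
  · refine Or.inr (main y x z (by rwa [add_comm]) (by rwa [add_comm]) ?_)
    have : i * (z * (i * y)) * i = i * (1 - z * (i * x)) * i := by
      have : i * (z * (i * (x + y) * i)) = i := by rw [hz1, hii']
      calc i * (z * (i * y)) * i = i * (z * (i * (x + y) * i)) - i * (z * (i * x)) * i := by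
            noncomm_ring
        _ = i * i - i * (z * (i * x)) * i := by rw [this, hii']
        _ = _ := by noncomm_ring
    rwa [this]

theorem IsLocalIdem.not_isCornerUnit_zero {i : R} (hi : IsLocalIdem i) : ¬ IsCornerUnit i 0 := by
  rintro ⟨z, hz, -⟩
  exact hi.2.1 (by rw [← hz, mul_zero])

theorem IsLocalIdem.exists_isCornerUnit_of_sum {i : R} (hi : IsLocalIdem i) {ι : Type*}
    (s : Finset ι) (f : ι → R) (h : IsCornerUnit i (i * (∑ k ∈ s, f k) * i)) :
    ∃ k ∈ s, IsCornerUnit i (i * f k * i) := by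
  classical
  induction s using Finset.induction_on with
  | empty =>
    rw [Finset.sum_empty, mul_zero, zero_mul] at h
    exact absurd h hi.not_isCornerUnit_zero
  | insert a s ha ih =>
    rw [Finset.sum_insert ha] at h
    rcases hi.isCornerUnit_add h with h | h
    · exact ⟨a, Finset.mem_insert_self _ _, h⟩
    · obtain ⟨k, hk, h⟩ := ih h
      exact ⟨k, Finset.mem_insert_of_mem hk, h⟩

/-- If the composite `i → j → i` is invertible at a nonzero idempotent `i`, then it identifies
`i` with the primitive idempotent `j`. -/
theorem IsPrimitiveIdem.exists_inverse_of_isCornerUnit {i j a b : R} (hi : IsIdempotentElem i)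
    (hi0 : i ≠ 0) (hj : IsPrimitiveIdem j) (ha1 : i * a = a) (ha2 : a * j = a) (hb1 : j * b = b)
    (h : IsCornerUnit i (a * b)) :
    ∃ c : R, j * c = c ∧ c * i = c ∧ a * c = i ∧ c * a = j := by
  have hi' : i * i = i := hi
  obtain ⟨hjj, hj0, hprim⟩ := hj
  have hj' : j * j = j := hjj
  obtain ⟨z, hz1, hz2⟩ := h
  have hac : a * (b * z * i) = i := by
    rw [← mul_assoc, ← mul_assoc, hz2, hi']
  -- `c = b z i` is a right inverse of `a`, so `c a` is an idempotent below `j`. Primitivity leaves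
  -- `0` and `j`, and `c a = 0` would force `i = 0`.
  have hid : IsIdempotentElem (b * z * i * a) := by
    change b * z * i * a * (b * z * i * a) = _
    rw [mul_assoc (b * z * i), ← mul_assoc a, hac, ha1]
  have hjc : j * (b * z * i) = b * z * i := by rw [← mul_assoc, ← mul_assoc, hb1]
  have hjid : j * (b * z * i * a) = b * z * i * a := by rw [← mul_assoc, hjc]
  have hidj : b * z * i * a * j = b * z * i * a := by rw [mul_assoc, ha2]
  have hid' := hid.eq
  refine ⟨b * z * i, hjc, by rw [mul_assoc, hi'], hac, ?_⟩
  have hg : IsIdempotentElem (j - b * z * i * a) := by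
    change _ * _ = _
    rw [sub_mul, mul_sub, mul_sub, hj', hjid, hidj, hid']; simp
  rcases hprim (b * z * i * a) (j - b * z * i * a) hid hg (by rw [mul_sub, hidj, hid', sub_self])
    (by rw [sub_mul, hjid, hid', sub_self]) (by abel) with h | h
  · exfalso
    apply hi0
    calc i = a * (b * z * i) * (a * (b * z * i)) := by rw [hac, hi']
      _ = a * (b * z * i * a) * (b * z * i) := by noncomm_ring
      _ = 0 := by rw [h]; simp
  · exact (sub_eq_zero.mp h).symm

theorem IsPrimitiveIdem.idemEquiv_of_isCornerUnit {i j a b : R} (hi : IsIdempotentElem i)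
    (hi0 : i ≠ 0) (hj : IsPrimitiveIdem j) (h : IsCornerUnit i (i * (a * j * b) * i)) :
    IdemEquiv i j := by
  have hi' : i * i = i := hi
  have hj' : j * j = j := hj.1
  obtain ⟨c, -, -, h1, h2⟩ := IsPrimitiveIdem.exists_inverse_of_isCornerUnit (a := i * a * j)
    (b := j * b * i) hi hi0 hj (by simp only [← mul_assoc, hi']) (by simp only [mul_assoc, hj'])
    (by simp only [← mul_assoc, hj'])
    (by
      have : i * a * j * (j * b * i) = i * (a * j * b) * i := by
        calc i * a * j * (j * b * i) = i * a * (j * j) * b * i := by noncomm_ring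
          _ = _ := by rw [hj']; noncomm_ring
      rwa [this])
  exact ⟨_, _, h1, h2⟩

end Idempotents

/-! ### The Krull-Schmidt theorem, points and multiplicities. -/

section KrullSchmidt

variable {R : Type*} [Ring R]

/-- A ring in which idempotents decompose into primitive ones, and primitive idempotents have
local corners. -/
class IsSemiperfectRing (R : Type*) [Ring R] : Prop where
  isLocalIdem : ∀ i : R, IsPrimitiveIdem i → IsLocalIdem i
  exists_decomposition : ∀ e : R, IsIdempotentElem e → ∃ I : Finset R, IsPrimitiveDecomposition I e

open Classical in
/-- The number of members of `I` that are equivalent to `x`. -/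
noncomputable def idemCount (I : Finset R) (x : R) : ℕ := (I.filter (IdemEquiv x)).card

namespace IsPrimitiveDecomposition

variable {I J : Finset R} {e f i : R}

theorem mul_left (h : IsPrimitiveDecomposition I e) (hi : i ∈ I) : e * i = i := by
  rw [← h.2.2, Finset.sum_mul, Finset.sum_eq_single i]
  · exact (h.1 i hi).1
  · intro j hj hji
    exact h.2.1 j hj i hi hji
  · exact fun h => absurd hi h

theorem mul_right (h : IsPrimitiveDecomposition I e) (hi : i ∈ I) : i * e = i := by
  rw [← h.2.2, Finset.mul_sum, Finset.sum_eq_single i]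
  · exact (h.1 i hi).1
  · intro j hj hji
    exact h.2.1 i hi j hj hji.symm
  · exact fun h => absurd hi h

theorem isIdempotentElem (h : IsPrimitiveDecomposition I e) : IsIdempotentElem e := by
  change e * e = e
  nth_rw 2 [← h.2.2]
  rw [Finset.mul_sum, ← h.2.2]
  exact Finset.sum_congr rfl fun i hi => by rw [h.2.2, h.mul_left hi]

theorem erase [DecidableEq R] (h : IsPrimitiveDecomposition I e) (hi : i ∈ I) :
    IsPrimitiveDecomposition (I.erase i) (e - i) := by
  refine ⟨fun j hj => h.1 j (Finset.mem_of_mem_erase hj), fun j hj k hk =>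
    h.2.1 j (Finset.mem_of_mem_erase hj) k (Finset.mem_of_mem_erase hk), ?_⟩
  rw [eq_sub_iff_add_eq, Finset.sum_erase_add _ _ hi, h.2.2]

theorem disjoint (hI : IsPrimitiveDecomposition I e) (hJ : IsPrimitiveDecomposition J f)
    (hef : e * f = 0) : Disjoint I J := by
  rw [Finset.disjoint_left]
  intro i hi hj
  refine (hI.1 i hi).2.1 ?_
  calc i = i * i := ((hI.1 i hi).1).symm
    _ = i * e * (f * i) := by rw [hI.mul_right hi, hJ.mul_left hj]
    _ = i * (e * f) * i := by noncomm_ring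
    _ = 0 := by rw [hef]; simp

theorem union [DecidableEq R] (hI : IsPrimitiveDecomposition I e)
    (hJ : IsPrimitiveDecomposition J f) (hef : e * f = 0) (hfe : f * e = 0) :
    IsPrimitiveDecomposition (I ∪ J) (e + f) := by
  refine ⟨fun i hi => (Finset.mem_union.mp hi).elim (hI.1 i) (hJ.1 i), ?_, ?_⟩
  · intro i hi j hj hij
    rcases Finset.mem_union.mp hi with hi | hi <;> rcases Finset.mem_union.mp hj with hj | hj
    · exact hI.2.1 i hi j hj hij
    · rw [← hI.mul_right hi, ← hJ.mul_left hj, mul_assoc, ← mul_assoc e, hef, zero_mul, mul_zero]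
    · rw [← hJ.mul_right hi, ← hI.mul_left hj, mul_assoc, ← mul_assoc f, hfe, zero_mul, mul_zero]
    · exact hJ.2.1 i hi j hj hij
  · rw [Finset.sum_union (hI.disjoint hJ hef), hI.2.2, hJ.2.2]

theorem singleton (hi : IsPrimitiveIdem i) : IsPrimitiveDecomposition {i} i := by
  refine ⟨by simpa using hi, ?_, by simp⟩
  intro a ha b hb hab
  rw [Finset.mem_singleton] at ha hb
  exact absurd (ha.trans hb.symm) hab

theorem eq_empty (h : IsPrimitiveDecomposition I e) (he : e = 0) : I = ∅ := by
  refine Finset.eq_empty_of_forall_notMem fun i hi => (h.1 i hi).2.1 ?_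
  rw [← h.mul_left hi, he, zero_mul]

end IsPrimitiveDecomposition

theorem IdemEquiv.eq_zero {f : R} (h : IdemEquiv 0 f) (hf : IsIdempotentElem f) : f = 0 := by
  obtain ⟨a, b, h1, h2⟩ := h
  rw [← hf.eq, ← h2, mul_assoc, ← mul_assoc a, h1, zero_mul, mul_zero]

open Classical in
theorem idemCount_erase {I : Finset R} {i : R} (hi : i ∈ I) (x : R) :
    idemCount I x = idemCount (I.erase i) x + if IdemEquiv x i then 1 else 0 := by
  unfold idemCount
  rw [Finset.filter_erase]
  split_ifs with h
  · rw [Finset.card_erase_of_mem (Finset.mem_filter.mpr ⟨hi, h⟩)]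
    have : 0 < (I.filter (IdemEquiv x)).card :=
      Finset.card_pos.mpr ⟨i, Finset.mem_filter.mpr ⟨hi, h⟩⟩
    omega
  · rw [Finset.erase_eq_of_notMem (fun h' => h (Finset.mem_filter.mp h').2), add_zero]

theorem idemEquiv_congr_right {x i j : R} (hx : IsIdempotentElem x) (hi : IsIdempotentElem i)
    (hj : IsIdempotentElem j) (h : IdemEquiv i j) : IdemEquiv x i ↔ IdemEquiv x j :=
  ⟨fun h' => h'.trans h hx hi hj, fun h' => h'.trans h.symm hx hj hi⟩

/-- The Krull-Schmidt theorem for decompositions of equivalent idempotents. -/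
theorem idemCount_eq [IsSemiperfectRing R] {e f : R} {I J : Finset R}
    (hI : IsPrimitiveDecomposition I e) (hJ : IsPrimitiveDecomposition J f) (h : IdemEquiv e f)
    {x : R} (hx : IsIdempotentElem x) : idemCount I x = idemCount J x := by
  classical
  induction hn : I.card generalizing I J e f with
  | zero =>
    rw [Finset.card_eq_zero] at hn
    subst hn
    have he : e = 0 := by rw [← hI.2.2, Finset.sum_empty]
    rw [hJ.eq_empty ((he ▸ h).eq_zero hJ.isIdempotentElem)]
  | succ n ih =>
    have he := hI.isIdempotentElem
    have hf := hJ.isIdempotentElem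
    obtain ⟨i, hi⟩ : I.Nonempty := Finset.card_pos.mp (by omega)
    have hip := hI.1 i hi
    have hil := IsSemiperfectRing.isLocalIdem i hip
    have hii : i * i = i := hip.1
    obtain ⟨a, b, h1, h2, h3, h4, h5, h6⟩ := h.exists_normalized he hf
    -- The terms `i a j b i` sum to `i a b i = i`, so locality of the corner of `i` makes one of
    -- them invertible. The corresponding `j` is the partner of `i`.
    obtain ⟨j, hj, hu⟩ : ∃ j ∈ J, IsCornerUnit i (i * (a * j * b) * i) := by
      refine hil.exists_isCornerUnit_of_sum J (fun j => a * j * b) ?_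
      rw [← Finset.sum_mul, ← Finset.mul_sum, hJ.2.2, h4, h1, hI.mul_right hi, hii]
      exact ⟨i, hii, hii⟩
    have hjp := hJ.1 j hj
    have hjj : j * j = j := hjp.1
    obtain ⟨c, c1, c2, c3, c4⟩ := IsPrimitiveIdem.exists_inverse_of_isCornerUnit (a := i * a * j)
      (b := j * b * i) hip.1 hip.2.1 hjp (by simp only [← mul_assoc, hii])
      (by simp only [mul_assoc, hjj]) (by simp only [← mul_assoc, hjj])
      (by
        have : i * a * j * (j * b * i) = i * (a * j * b) * i := by
          calc i * a * j * (j * b * i) = i * a * (j * j) * b * i := by noncomm_ring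
            _ = _ := by rw [hjj]; noncomm_ring
        rwa [this])
    have hij : IdemEquiv i j := ⟨_, _, c3, c4⟩
    have hsub : IdemEquiv (e - i) (f - j) :=
      IdemEquiv.sub_of_cornerUnit he hf (hI.mul_left hi) (hI.mul_right hi) (hJ.mul_left hj)
        (hJ.mul_right hj) hip.1 hjp.1 h1 h2 h3 h4 c1 c2
        (by rwa [mul_assoc (i * a), c1] at c3) (by
          calc c * a * j = c * i * a * j := by rw [c2]
            _ = c * (i * a * j) := by noncomm_ring
            _ = j := c4)
    rw [idemCount_erase hi, idemCount_erase hj, ih (hI.erase hi) (hJ.erase hj) hsub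
      (by rw [Finset.card_erase_of_mem hi, hn]; rfl)]
    congr 1
    simp only [idemEquiv_congr_right hx hip.1 hjp.1 hij]

theorem exists_mem_idemEquiv {I J : Finset R} {e : R}
    (hI : IsPrimitiveDecomposition I e) {i : R} (hi : i ∈ I)
    (h : idemCount I i = idemCount J i) : ∃ j ∈ J, IdemEquiv i j := by
  classical
  have h1 : 0 < idemCount I i :=
    Finset.card_pos.mpr ⟨i, Finset.mem_filter.mpr ⟨hi, IdemEquiv.refl (hI.1 i hi).1⟩⟩
  rw [h] at h1
  obtain ⟨j, hj⟩ := Finset.card_pos.mp h1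
  exact ⟨j, (Finset.mem_filter.mp hj).1, (Finset.mem_filter.mp hj).2⟩

/-- Converse to Krull-Schmidt: equal counts allow the members to be paired off one at a time, and
equivalences of orthogonal idempotents add up. -/
theorem idemEquiv_of_idemCount_eq {e f : R} {I J : Finset R} (hI : IsPrimitiveDecomposition I e)
    (hJ : IsPrimitiveDecomposition J f)
    (h : ∀ x : R, IsPrimitiveIdem x → idemCount I x = idemCount J x) : IdemEquiv e f := by
  classical
  induction hn : I.card generalizing I J e f with
  | zero =>
    rw [Finset.card_eq_zero] at hn
    subst hn
    have hJ0 : J = ∅ := by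
      refine Finset.eq_empty_of_forall_notMem fun j hj => ?_
      obtain ⟨i, hi, -⟩ := exists_mem_idemEquiv hJ hj (h j (hJ.1 j hj)).symm
      simp at hi
    subst hJ0
    rw [← hI.2.2, ← hJ.2.2]
    exact ⟨0, 0, by simp, by simp⟩
  | succ n ih =>
    obtain ⟨i, hi⟩ : I.Nonempty := Finset.card_pos.mp (by omega)
    obtain ⟨j, hj, hij⟩ := exists_mem_idemEquiv hI hi (h i (hI.1 i hi))
    have hip := hI.1 i hi
    have hjp := hJ.1 j hj
    have := ih (hI.erase hi) (hJ.erase hj) (fun x hx => by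
      have := h x hx
      rw [idemCount_erase hi, idemCount_erase hj] at this
      simp only [idemEquiv_congr_right hx.1 hip.1 hjp.1 hij] at this
      exact Nat.add_right_cancel this) (by rw [Finset.card_erase_of_mem hi, hn]; rfl)
    have hs := this.add hij (hI.erase hi).isIdempotentElem (hJ.erase hj).isIdempotentElem
      hip.1 hjp.1 (by rw [sub_mul, hI.mul_left hi, hip.1.eq, sub_self])
      (by rw [mul_sub, hI.mul_right hi, hip.1.eq, sub_self])
      (by rw [sub_mul, hJ.mul_left hj, hjp.1.eq, sub_self])
      (by rw [mul_sub, hJ.mul_right hj, hjp.1.eq, sub_self])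
    simpa using hs

/-- Equivalent primitive idempotents are conjugate. -/
theorem IsPrimitiveIdem.exists_conj [IsSemiperfectRing R] {i j : R} (hi : IsPrimitiveIdem i)
    (hj : IsPrimitiveIdem j) (h : IdemEquiv i j) : ∃ u : Rˣ, j = u * i * (u⁻¹ : Rˣ) := by
  classical
  have hi' : i * i = i := hi.1
  have hj' : j * j = j := hj.1
  obtain ⟨I, hI⟩ := IsSemiperfectRing.exists_decomposition (1 - i) hi.1.one_sub
  obtain ⟨J, hJ⟩ := IsSemiperfectRing.exists_decomposition (1 - j) hj.1.one_sub
  have hi1 : (1 - i) * i = 0 := by rw [sub_mul, hi']; simp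
  have hi2 : i * (1 - i) = 0 := by rw [mul_sub, hi']; simp
  have hj1 : (1 - j) * j = 0 := by rw [sub_mul, hj']; simp
  have hj2 : j * (1 - j) = 0 := by rw [mul_sub, hj']; simp
  have hI' := hI.union (.singleton hi) hi1 hi2
  have hJ' := hJ.union (.singleton hj) hj1 hj2
  have hdI := hI.disjoint (.singleton hi) hi1
  have hdJ := hJ.disjoint (.singleton hj) hj1
  -- Complements are equivalent because Krull-Schmidt for `1` allows `i` and `j` to be cancelled.
  -- Adding the two equivalences then produces the conjugating unit `b + d`, with inverse `a + c`.
  have h1 : IdemEquiv (1 - i) (1 - j) := by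
    refine idemEquiv_of_idemCount_eq hI hJ fun x hx => ?_
    have := idemCount_eq hI' hJ' (by simpa using IdemEquiv.refl IsIdempotentElem.one) hx.1
    rw [idemCount_erase (I := I ∪ {i}) (i := i) (by simp),
      idemCount_erase (I := J ∪ {j}) (i := j) (by simp)] at this
    simp only [idemEquiv_congr_right hx.1 hi.1 hj.1 h] at this
    have e1 : (I ∪ {i}).erase i = I := by
      rw [Finset.union_comm, ← Finset.insert_eq, Finset.erase_insert]
      simpa using hdI
    have e2 : (J ∪ {j}).erase j = J := by
      rw [Finset.union_comm, ← Finset.insert_eq, Finset.erase_insert]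
      simpa using hdJ
    rw [e1, e2] at this
    exact Nat.add_right_cancel this
  obtain ⟨a, b, a1, a2, a3, a4, a5, a6⟩ := h.exists_normalized hi.1 hj.1
  obtain ⟨c, d, c1, c2, c3, c4, c5, c6⟩ := h1.exists_normalized hi.1.one_sub hj.1.one_sub
  have e1 : a * d = 0 := by rw [← a4, ← c5, mul_assoc, ← mul_assoc j, hj2, zero_mul, mul_zero]
  have e2 : c * b = 0 := by rw [← c4, ← a5, mul_assoc, ← mul_assoc (1 - j), hj1, zero_mul, mul_zero]
  have e3 : b * c = 0 := by rw [← a6, ← c3, mul_assoc, ← mul_assoc i, hi2, zero_mul, mul_zero]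
  have e4 : d * a = 0 := by rw [← c6, ← a3, mul_assoc, ← mul_assoc (1 - i), hi1, zero_mul, mul_zero]
  refine ⟨⟨b + d, a + c, ?_, ?_⟩, ?_⟩
  · rw [add_mul, mul_add, mul_add, a2, c2, e3, e4]; simp
  · rw [add_mul, mul_add, mul_add, a1, c1, e1, e2]; simp
  · change j = (b + d) * i * (a + c)
    have e5 : d * i = 0 := by rw [← c6, mul_assoc, hi1, mul_zero]
    have e6 : i * c = 0 := by rw [← c3, ← mul_assoc, hi2, zero_mul]
    rw [add_mul, e5, add_zero, a6, mul_add, e3, a2, add_zero]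

theorem IsPrimitiveIdem.conj {i : R} (hi : IsPrimitiveIdem i) (u : Rˣ) :
    IsPrimitiveIdem (u * i * (u⁻¹ : Rˣ) : R) := by
  obtain ⟨h1, h2, h3⟩ := hi
  have key : ∀ f : R, IsIdempotentElem f → IsIdempotentElem ((u⁻¹ : Rˣ) * f * u : R) := by
    intro f hf
    change _ * _ = _
    calc ((u⁻¹ : Rˣ) * f * u : R) * ((u⁻¹ : Rˣ) * f * u)
        = (u⁻¹ : Rˣ) * f * (u * (u⁻¹ : Rˣ)) * f * u := by noncomm_ring
      _ = (u⁻¹ : Rˣ) * (f * f) * u := by rw [Units.mul_inv]; noncomm_ring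
      _ = _ := by rw [hf.eq]
  refine ⟨?_, ?_, ?_⟩
  · have := h1.eq
    change _ * _ = _
    calc (u * i * (u⁻¹ : Rˣ) : R) * (u * i * (u⁻¹ : Rˣ))
        = u * i * ((u⁻¹ : Rˣ) * u) * i * (u⁻¹ : Rˣ) := by noncomm_ring
      _ = u * (i * i) * (u⁻¹ : Rˣ) := by rw [Units.inv_mul]; noncomm_ring
      _ = _ := by rw [this]
  · intro h
    apply h2
    calc i = (u⁻¹ : Rˣ) * (u * i * (u⁻¹ : Rˣ)) * u := by simp [mul_assoc]
      _ = 0 := by rw [h]; simp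
  · intro f g hf hg hfg hgf hs
    have := h3 ((u⁻¹ : Rˣ) * f * u) ((u⁻¹ : Rˣ) * g * u) (key f hf) (key g hg)
      (by
        calc ((u⁻¹ : Rˣ) * f * u : R) * ((u⁻¹ : Rˣ) * g * u)
            = (u⁻¹ : Rˣ) * f * (u * (u⁻¹ : Rˣ)) * g * u := by noncomm_ring
          _ = (u⁻¹ : Rˣ) * (f * g) * u := by rw [Units.mul_inv]; noncomm_ring
          _ = _ := by rw [hfg]; simp)
      (by
        calc ((u⁻¹ : Rˣ) * g * u : R) * ((u⁻¹ : Rˣ) * f * u)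
            = (u⁻¹ : Rˣ) * g * (u * (u⁻¹ : Rˣ)) * f * u := by noncomm_ring
          _ = (u⁻¹ : Rˣ) * (g * f) * u := by rw [Units.mul_inv]; noncomm_ring
          _ = _ := by rw [hgf]; simp)
      (by
        calc i = (u⁻¹ : Rˣ) * (u * i * (u⁻¹ : Rˣ)) * u := by simp [mul_assoc]
          _ = _ := by rw [hs]; noncomm_ring)
    have back : ∀ f : R, ((u⁻¹ : Rˣ) * f * u : R) = 0 → f = 0 := by
      intro f hf
      calc f = u * ((u⁻¹ : Rˣ) * f * u) * (u⁻¹ : Rˣ) := by simp [mul_assoc]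
        _ = 0 := by rw [hf]; simp
    exact this.imp (back f) (back g)

theorem idemEquiv_conj (i : R) (u : Rˣ) : IsIdempotentElem i → IdemEquiv i (u * i * (u⁻¹ : Rˣ)) := by
  intro hi
  refine ⟨i * (u⁻¹ : Rˣ), u * i, ?_, ?_⟩
  · simp [mul_assoc, hi.eq]
  · rw [mul_assoc, ← mul_assoc i, hi.eq, mul_assoc]

/-- A point is an equivalence class of primitive idempotents. -/
theorem IsPoint.mem_iff [IsSemiperfectRing R] {γ : Set R} (hγ : IsPoint γ) {i : R} (hi : i ∈ γ)
    {j : R} : j ∈ γ ↔ IsPrimitiveIdem j ∧ IdemEquiv i j := by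
  obtain ⟨e, he, rfl⟩ := hγ
  obtain ⟨u, rfl⟩ := hi
  have hu := he.conj u
  have heu := idemEquiv_conj e u he.1
  constructor
  · rintro ⟨v, rfl⟩
    exact ⟨he.conj v, heu.symm.trans (idemEquiv_conj e v he.1) hu.1 he.1 (he.conj v).1⟩
  · rintro ⟨hj, h⟩
    exact he.exists_conj hj (heu.trans h he.1 hu.1 hj.1)

theorem IsPoint.isPrimitiveIdem {γ : Set R} (hγ : IsPoint γ) {i : R} (hi : i ∈ γ) :
    IsPrimitiveIdem i := by
  obtain ⟨e, he, rfl⟩ := hγ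
  obtain ⟨u, rfl⟩ := hi
  exact he.conj u

/-- The point that contains a primitive idempotent. -/
def pointOf (i : R) : Set R := {f | ∃ u : Rˣ, f = u * i * (u⁻¹ : Rˣ)}

theorem isPoint_pointOf {i : R} (hi : IsPrimitiveIdem i) : IsPoint (pointOf i) := ⟨i, hi, rfl⟩

theorem mem_pointOf (i : R) : i ∈ pointOf i := ⟨1, by simp⟩

theorem IsPoint.nonempty {γ : Set R} (hγ : IsPoint γ) : γ.Nonempty := by
  obtain ⟨e, he, rfl⟩ := hγ
  exact ⟨e, 1, by simp⟩

/-- The multiplicity can be computed in any primitive decomposition. -/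
theorem IsPoint.pointMultiplicity_eq [IsSemiperfectRing R] {γ : Set R} (hγ : IsPoint γ) {i : R}
    (hi : i ∈ γ) {e : R} {I : Finset R} (hI : IsPrimitiveDecomposition I e) :
    pointMultiplicity γ e = idemCount I i := by
  classical
  have hip := hγ.isPrimitiveIdem hi
  have key : ∀ J : Finset R, IsPrimitiveDecomposition J e →
      {j | j ∈ J ∧ j ∈ γ}.ncard = idemCount I i := by
    intro J hJ
    rw [idemCount_eq hI hJ (IdemEquiv.refl hI.isIdempotentElem) hip.1, idemCount,
      ← Set.ncard_coe_finset]
    congr 1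
    ext j
    simp only [Set.mem_ofPred_eq, Finset.coe_filter]
    constructor
    · rintro ⟨h1, h2⟩
      exact ⟨h1, ((hγ.mem_iff hi).mp h2).2⟩
    · rintro ⟨h1, h2⟩
      exact ⟨h1, (hγ.mem_iff hi).mpr ⟨hJ.1 j h1, h2⟩⟩
  unfold pointMultiplicity
  have : {n | ∃ I : Finset R, IsPrimitiveDecomposition I e ∧ n = {i | i ∈ I ∧ i ∈ γ}.ncard} =
      {idemCount I i} := by
    ext n
    constructor
    · rintro ⟨J, hJ, rfl⟩
      exact key J hJ
    · rintro rfl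
      exact ⟨I, hI, (key I hI).symm⟩
  rw [this, csInf_singleton]

theorem pointMultiplicity_congr [IsSemiperfectRing R] {γ : Set R} (hγ : IsPoint γ) {e f : R}
    (he : IsIdempotentElem e) (hf : IsIdempotentElem f) (h : IdemEquiv e f) :
    pointMultiplicity γ e = pointMultiplicity γ f := by
  obtain ⟨I, hI⟩ := IsSemiperfectRing.exists_decomposition e he
  obtain ⟨J, hJ⟩ := IsSemiperfectRing.exists_decomposition f hf
  obtain ⟨i, hi⟩ := hγ.nonempty
  rw [hγ.pointMultiplicity_eq hi hI, hγ.pointMultiplicity_eq hi hJ,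
    idemCount_eq hI hJ h (hγ.isPrimitiveIdem hi).1]

end KrullSchmidt

/-! ### Finite algebras over a complete local ring are semiperfect. -/

section Lifting

/-- Fitting's lemma. The ideals generated by powers of `y` stabilize, so `yⁿ = yⁿ⁺¹ z`. Iterating
gives `yⁿ = y²ⁿ⁺¹ zⁿ⁺¹`, so with `w = yⁿ zⁿ⁺¹` the product `y w` acts as the identity on `yⁿ` and
hence on itself. -/
theorem exists_fitting_idempotent {R : Type*} [CommRing R] [IsArtinianRing R] (y : R) :
    ∃ (n : ℕ) (w : R), y * w * (y * w) = y * w ∧ y ^ n * (y * w) = y ^ n := by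
  obtain ⟨n, z, hz⟩ := IsArtinian.exists_pow_succ_smul_dvd y (1 : R)
  simp only [smul_eq_mul, mul_one] at hz
  have hstep : ∀ k : ℕ, y ^ (n + k) * z ^ k = y ^ n := by
    intro k
    induction k with
    | zero => simp
    | succ k ih =>
      calc y ^ (n + (k + 1)) * z ^ (k + 1) = (y ^ n.succ * z) * (y ^ k * z ^ k) := by
            rw [Nat.succ_eq_add_one]; ring
        _ = y ^ (n + k) * z ^ k := by rw [hz]; ring
        _ = y ^ n := ih
  have h1 := hstep (n + 1)
  refine ⟨n, y ^ n * z ^ (n + 1), ?_, ?_⟩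
  · calc y * (y ^ n * z ^ (n + 1)) * (y * (y ^ n * z ^ (n + 1)))
        = (y ^ (n + (n + 1)) * z ^ (n + 1)) * (y * z ^ (n + 1)) := by ring
      _ = y * (y ^ n * z ^ (n + 1)) := by rw [h1]; ring
  · calc y ^ n * (y * (y ^ n * z ^ (n + 1))) = y ^ (n + (n + 1)) * z ^ (n + 1) := by ring
      _ = y ^ n := h1

/-- Hensel's lemma for `X² - X`: the derivative `2a - 1` squares to `1 + 4(a² - a)`, so it is a unit
modulo `I`. -/
theorem exists_idempotent_sub_mem {R : Type*} [CommRing R] (I : Ideal R) [HenselianRing R I]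
    (a : R) (ha : a * a - a ∈ I) : ∃ e : R, e * e = e ∧ e - a ∈ I := by
  by_cases h0 : (1 : R) = 0
  · have := subsingleton_of_zero_eq_one h0.symm
    exact ⟨0, by simp, by rw [Subsingleton.elim (0 - a) 0]; exact I.zero_mem⟩
  have hmonic : (Polynomial.X ^ 2 - Polynomial.X : Polynomial R).Monic :=
    Polynomial.Monic.sub_of_left (Polynomial.monic_X_pow 2) (by
      rcases subsingleton_or_nontrivial R with h | h
      · exact (h0 (Subsingleton.elim _ _)).elim
      · rw [Polynomial.degree_X, Polynomial.degree_X_pow]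
        norm_num)
  have hval : (Polynomial.X ^ 2 - Polynomial.X : Polynomial R).eval a ∈ I := by
    rwa [Polynomial.eval_sub, Polynomial.eval_pow, Polynomial.eval_X, pow_two]
  have hder : (Polynomial.X ^ 2 - Polynomial.X : Polynomial R).derivative.eval a = 2 * a - 1 := by
    simp [one_add_one_eq_two]
  have hunit : IsUnit (Ideal.Quotient.mk I
      ((Polynomial.X ^ 2 - Polynomial.X : Polynomial R).derivative.eval a)) := by
    rw [hder]
    refine IsUnit.of_mul_eq_one (Ideal.Quotient.mk I (2 * a - 1)) ?_
    rw [← map_mul, ← map_one (Ideal.Quotient.mk I), Ideal.Quotient.eq]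
    have e1 : (2 * a - 1) * (2 * a - 1) - 1 = 4 * (a * a - a) := by ring
    rw [e1]
    exact I.mul_mem_left _ ha
  obtain ⟨e, he, hea⟩ := HenselianRing.is_henselian (I := I) _ hmonic a hval hunit
  refine ⟨e, ?_, hea⟩
  rw [Polynomial.IsRoot, Polynomial.eval_sub, Polynomial.eval_pow, Polynomial.eval_X, pow_two,
    sub_eq_zero] at he
  exact he

/-- The Fitting idempotent `y w` of the Artinian quotient lifts to `0` or `1`. In the first case
`yⁿ` lies in `I`, so `1 - y` divides the unit `1 - yⁿ`; in the second `y w` is a unit. -/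
theorem isUnit_or_isUnit_one_sub_of_henselianRing {R : Type*} [CommRing R] (I : Ideal R)
    [HenselianRing R I] [IsArtinianRing (R ⧸ I)] (h : ∀ e : R, e * e = e → e = 0 ∨ e = 1) (y : R) :
    IsUnit y ∨ IsUnit (1 - y) := by
  obtain ⟨n, w', h1, h2⟩ := exists_fitting_idempotent (Ideal.Quotient.mk I y)
  obtain ⟨w, rfl⟩ := Ideal.Quotient.mk_surjective w'
  rw [← map_mul, ← map_mul, Ideal.Quotient.eq] at h1
  rw [← map_pow, ← map_mul, ← map_mul, Ideal.Quotient.eq] at h2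
  have hjac : ∀ x ∈ I, IsUnit (1 - x) := by
    intro x hx
    have := Ideal.mem_jacobson_bot.mp (HenselianRing.jac hx) (-1)
    rwa [mul_neg_one, neg_add_eq_sub] at this
  obtain ⟨e, he, hea⟩ := exists_idempotent_sub_mem I (y * w) h1
  rcases h e he with rfl | rfl
  · right
    have h3 : y * w ∈ I := by simpa using hea
    have h4 : y ^ n ∈ I := by
      have := I.sub_mem (I.mul_mem_left (y ^ n) h3) h2
      rwa [sub_sub_cancel] at this
    have : (1 - y) ∣ 1 - y ^ n := by simpa using sub_dvd_pow_sub_pow (1 : R) y n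
    exact isUnit_of_dvd_unit this (hjac _ h4)
  · left
    have h3 := hjac _ hea
    rw [sub_sub_cancel] at h3
    exact isUnit_of_dvd_unit (dvd_mul_right y w) h3

variable {O : Type*} [CommRing O] [IsLocalRing O] [IsNoetherianRing O]
  [IsAdicComplete (IsLocalRing.maximalIdeal O) O]

/-- The completion of `M` is a quotient of the tensor product of `M` with the completion of `O`, and
the latter is `O`. Injectivity is separatedness of `M`. -/
theorem isAdicComplete_of_finite (M : Type*) [AddCommGroup M] [Module O M] [Module.Finite O M] :
    IsAdicComplete (IsLocalRing.maximalIdeal O) M := by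
  set m := IsLocalRing.maximalIdeal O
  rw [← AdicCompletion.of_bijective_iff]
  have h1 := AdicCompletion.ofTensorProduct_surjective_of_finite m M
  have h2 : Function.Bijective (AdicCompletion.of m O) := AdicCompletion.of_bijective_iff.mpr inferInstance
  refine ⟨(AdicCompletion.of_injective_iff (I := m) (M := M)).mpr inferInstance, fun x => ?_⟩
  obtain ⟨t, rfl⟩ := h1 x
  induction t with
  | zero => exact ⟨0, by simp⟩
  | add x y hx hy =>
    obtain ⟨a, ha⟩ := hx
    obtain ⟨b, hb⟩ := hy
    exact ⟨a + b, by rw [map_add, map_add, ha, hb]⟩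
  | tmul r x =>
    obtain ⟨c, rfl⟩ := h2.2 r
    refine ⟨c • x, ?_⟩
    rw [AdicCompletion.ofTensorProduct_tmul, map_smul]
    rfl

theorem isUnit_or_isUnit_one_sub_of_finite {R : Type*} [CommRing R] [Algebra O R]
    [Module.Finite O R] (h : ∀ e : R, e * e = e → e = 0 ∨ e = 1) (y : R) :
    IsUnit y ∨ IsUnit (1 - y) := by
  set m := IsLocalRing.maximalIdeal O
  have : IsAdicComplete m R := isAdicComplete_of_finite R
  have : IsAdicComplete (m.map (algebraMap O R)) R :=
    (IsAdicComplete.map_algebraMap_iff (I := m) (S := R) (M := R)).mpr inferInstance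
  have : IsArtinianRing (O ⧸ m) := by
    let _ := Ideal.Quotient.field m
    infer_instance
  have : IsArtinianRing (R ⧸ m.map (algebraMap O R)) := by
    have : Module.Finite (O ⧸ m) (R ⧸ m.map (algebraMap O R)) :=
      Module.Finite.of_restrictScalars_finite O _ _
    exact IsArtinianRing.of_finite (O ⧸ m) _
  exact isUnit_or_isUnit_one_sub_of_henselianRing (m.map (algebraMap O R)) h y

theorem isUnit_or_isUnit_one_sub_of_finite_noncomm (O : Type*) [CommRing O] [IsLocalRing O]
    [IsNoetherianRing O] [IsAdicComplete (IsLocalRing.maximalIdeal O) O] {D : Type*} [Ring D]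
    [Algebra O D] [Module.Finite O D]
    (h : ∀ e : D, e * e = e → e = 0 ∨ e = 1) (y : D) : IsUnit y ∨ IsUnit (1 - y) := by
  -- The commutative case suffices: `y` lies in the commutative subalgebra `O[y]`, which is finite
  -- over `O` and inherits the lack of nontrivial idempotents.
  have := Algebra.isMulCommutative_adjoin O (s := {y}) (by
    rintro _ rfl _ rfl
    rfl)
  have : Module.Finite O (Algebra.adjoin O {y}) :=
    have : IsNoetherian O D := isNoetherian_of_isNoetherianRing_of_finite O D
    Module.Finite.of_injective (Algebra.adjoin O {y}).val.toLinearMap Subtype.val_injective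
  have := isUnit_or_isUnit_one_sub_of_finite (O := O) (R := Algebra.adjoin O {y}) (fun e he => by
    have := h e.1 (congrArg Subtype.val he)
    exact this.imp (fun h => Subtype.ext h) (fun h => Subtype.ext h))
    ⟨y, Algebra.self_mem_adjoin_singleton O y⟩
  exact this.imp (fun h => h.map (Algebra.adjoin O {y}).val)
    (fun h => by simpa using h.map (Algebra.adjoin O {y}).val)

theorem IsPrimitiveIdem.isLocalIdem_of_finite (O : Type*) [CommRing O] [IsLocalRing O]
    [IsNoetherianRing O] [IsAdicComplete (IsLocalRing.maximalIdeal O) O] {D : Type*} [Ring D]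
    [Algebra O D] [Module.Finite O D] {i : D} (hi : IsPrimitiveIdem i) : IsLocalIdem i := by
  obtain ⟨hii, hi0, hp⟩ := hi
  refine ⟨hii, hi0, fun y => ?_⟩
  let π : D →ₗ[O] hii.Corner :=
    { toFun := fun x => ⟨i * x * i, ⟨x, rfl⟩⟩
      map_add' := fun a b => Subtype.ext (by
        change i * (a + b) * i = i * a * i + i * b * i
        rw [mul_add, add_mul])
      map_smul' := fun c a => Subtype.ext (by
        change i * (c • a) * i = c • (i * a * i)
        rw [mul_smul_comm, smul_mul_assoc]) }
  have : Module.Finite O hii.Corner := Module.Finite.of_surjective π (by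
    rintro ⟨x, y, rfl⟩
    exact ⟨y, rfl⟩)
  have hcu : ∀ x : hii.Corner, IsUnit x → IsCornerUnit i x.1 := by
    rintro x ⟨u, rfl⟩
    exact ⟨(u⁻¹ : (hii.Corner)ˣ).1.1, congrArg Subtype.val (Units.inv_mul u),
      congrArg Subtype.val (Units.mul_inv u)⟩
  have := isUnit_or_isUnit_one_sub_of_finite_noncomm O (D := hii.Corner) (fun e he => by
    have he1 : IsIdempotentElem (e.1 : D) := congrArg Subtype.val he
    obtain ⟨h1, h2⟩ := (Subsemigroup.mem_corner_iff hii).mp e.2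
    have h := hp e.1 (i - e.1) he1 (by
      change _ * _ = _
      rw [sub_mul, mul_sub, mul_sub, h1, h2, hii.eq, he1.eq]; simp)
      (by rw [mul_sub, h2, he1.eq, sub_self]) (by rw [sub_mul, h1, he1.eq, sub_self])
      (by abel)
    exact h.imp (fun h => Subtype.ext h) (fun h => Subtype.ext (sub_eq_zero.mp h).symm)) (π y)
  refine this.imp (fun h => hcu _ h) (fun h => ?_)
  have h' := hcu _ h
  have e1 : ((1 - π y : hii.Corner)).1 = i * (1 - y) * i := by
    change i - i * y * i = _
    rw [mul_sub, mul_one, sub_mul, hii.eq]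
  rwa [e1] at h'

/-- Noetherian induction on the right ideal `(1 - e) D`. If `e = f + g` splits properly, then `(1 -
f) D` is strictly larger, since it contains `g` while `e` annihilates `(1 - e) D`. -/
theorem exists_isPrimitiveDecomposition (O : Type*) [CommRing O] [IsNoetherianRing O] {D : Type*}
    [Ring D] [Algebra O D] [Module.Finite O D] (e : D) (he : IsIdempotentElem e) :
    ∃ I : Finset D, IsPrimitiveDecomposition I e := by
  classical
  have : IsNoetherian O D := isNoetherian_of_isNoetherianRing_of_finite O D
  induction hN : LinearMap.range (LinearMap.mulLeft O (1 - e)) using WellFoundedGT.induction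
    generalizing e with
  | ind N ih =>
    subst hN
    have he' := he.eq
    by_cases h0 : e = 0
    · exact ⟨∅, by simp, by simp, by simp [h0]⟩
    by_cases hprim : IsPrimitiveIdem e
    · exact ⟨{e}, .singleton hprim⟩
    have : ∃ f g : D, IsIdempotentElem f ∧ IsIdempotentElem g ∧ f * g = 0 ∧ g * f = 0 ∧
        e = f + g ∧ f ≠ 0 ∧ g ≠ 0 := by
      by_contra hcon
      refine hprim ⟨he, h0, fun f g hf hg hfg hgf hs => ?_⟩
      by_contra hne
      push Not at hne
      exact hcon ⟨f, g, hf, hg, hfg, hgf, hs, hne.1, hne.2⟩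
    obtain ⟨f, g, hf, hg, hfg, hgf, hs, hf0, hg0⟩ := this
    have key : ∀ f g : D, IsIdempotentElem f → IsIdempotentElem g → f * g = 0 → g * f = 0 →
        e = f + g → g ≠ 0 → LinearMap.range (LinearMap.mulLeft O (1 - e)) <
          LinearMap.range (LinearMap.mulLeft O (1 - f)) := by
      intro f g hf hg hfg hgf hs hg0
      have hf' := hf.eq
      have hg' := hg.eq
      have hfe : f * e = f := by rw [hs, mul_add, hf', hfg, add_zero]
      have heg : e * g = g := by rw [hs, add_mul, hg', hfg, zero_add]
      refine lt_of_le_of_ne ?_ fun heq => ?_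
      · rintro _ ⟨x, rfl⟩
        refine ⟨(1 - e) * x, ?_⟩
        simp only [LinearMap.mulLeft_apply]
        rw [← mul_assoc, sub_mul, one_mul, mul_sub f, hfe, mul_one, sub_self, sub_zero]
      · have : g ∈ LinearMap.range (LinearMap.mulLeft O (1 - f)) := ⟨g, by
          rw [LinearMap.mulLeft_apply, sub_mul, hfg, one_mul, sub_zero]⟩
        rw [← heq] at this
        obtain ⟨x, hx⟩ := this
        apply hg0
        rw [LinearMap.mulLeft_apply] at hx
        rw [← heg, ← hx, ← mul_assoc, mul_sub, he', mul_one, sub_self, zero_mul]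
    obtain ⟨I, hI⟩ := ih _ (key f g hf hg hfg hgf hs hg0) f hf rfl
    obtain ⟨J, hJ⟩ := ih _ (key g f hg hf hgf hfg (by rw [hs, add_comm]) hf0) g hg rfl
    exact ⟨I ∪ J, hs ▸ hI.union hJ hfg hgf⟩

/-- Finite algebras over a complete local Noetherian ring are semiperfect. -/
theorem isSemiperfectRing_of_finite (O : Type*) [CommRing O] [IsLocalRing O]
    [IsNoetherianRing O] [IsAdicComplete (IsLocalRing.maximalIdeal O) O] (D : Type*) [Ring D]
    [Algebra O D] [Module.Finite O D] : IsSemiperfectRing D where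
  isLocalIdem _ hi := hi.isLocalIdem_of_finite O
  exists_decomposition e he := exists_isPrimitiveDecomposition O e he

end Lifting

/-! ### Relative traces and Brauer kernels of representations. -/

section Representations

variable {O H M : Type*} [CommRing O] [Group H] [AddCommGroup M] [Module O M]
  (τ : H →* Module.End O M)

/-- The vectors that are fixed by a subgroup. -/
def repFixed (W : Subgroup H) : Submodule O M where
  carrier := {m | ∀ w ∈ W, τ w m = m}
  add_mem' ha hb w hw := by rw [map_add, ha w hw, hb w hw]
  zero_mem' w _ := map_zero _
  smul_mem' c _ ha w hw := by rw [map_smul, ha w hw]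

variable {τ} in
theorem mem_repFixed {W : Subgroup H} {m : M} : m ∈ repFixed τ W ↔ ∀ w ∈ W, τ w m = m := Iff.rfl

/-- The function `gW ↦ g • a` on the cosets of `W`, for a vector `a` fixed by `W`. -/
noncomputable def cosetFn (W : Subgroup H) (a : M) (c : H ⧸ W) : M := τ (Quotient.out c) a

/-- The relative trace of a vector fixed by `W`. -/
noncomputable def cosetSum (W : Subgroup H) (a : M) : M := ∑ᶠ c : H ⧸ W, cosetFn τ W a c

/-- The kernel of the Brauer homomorphism of a representation. -/
noncomputable def repBrauerKernel [IsLocalRing O] : Submodule O M :=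
  (IsLocalRing.maximalIdeal O) • repFixed τ ⊤ ⊔
    Submodule.span O {x : M | ∃ W : Subgroup H, W ≠ ⊤ ∧ ∃ a ∈ repFixed τ W, x = cosetSum τ W a}

variable {τ}

theorem cosetFn_mk {W : Subgroup H} {a : M} (ha : a ∈ repFixed τ W) (g : H) :
    cosetFn τ W a (QuotientGroup.mk g) = τ g a := by
  obtain ⟨w, hw⟩ := QuotientGroup.mk_out_eq_mul W g
  unfold cosetFn
  rw [show (Quotient.out (QuotientGroup.mk g : H ⧸ W)) = g * w from hw, map_mul,
    Module.End.mul_apply, ha w w.2]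

theorem cosetFn_smul {W : Subgroup H} {a : M} (ha : a ∈ repFixed τ W) (g : H) (c : H ⧸ W) :
    cosetFn τ W a (g • c) = τ g (cosetFn τ W a c) := by
  obtain ⟨x, rfl⟩ := QuotientGroup.mk_surjective c
  rw [MulAction.Quotient.smul_mk, cosetFn_mk ha, cosetFn_mk ha, smul_eq_mul, map_mul,
    Module.End.mul_apply]

theorem cosetSum_eq_sum [Finite H] (W : Subgroup H) [Fintype (H ⧸ W)] (a : M) :
    cosetSum τ W a = ∑ c : H ⧸ W, cosetFn τ W a c := finsum_eq_sum_of_fintype _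

/-- The sum of an equivariant function over a transitive `H`-set is a relative trace. -/
theorem sum_eq_cosetSum_of_isPretransitive [Finite H] {X : Type*} [MulAction H X] [Fintype X]
    [MulAction.IsPretransitive H X] {F : X → M} (hF : ∀ (h : H) (x : X), F (h • x) = τ h (F x))
    (x : X) : ∑ y, F y = cosetSum τ (MulAction.stabilizer H x) (F x) := by
  classical
  have := Fintype.ofFinite (H ⧸ MulAction.stabilizer H x)
  rw [cosetSum_eq_sum]
  symm
  refine Fintype.sum_bijective (MulAction.ofQuotientStabilizer H x)
    ⟨MulAction.injective_ofQuotientStabilizer H x, fun y => ?_⟩ _ _ fun c => ?_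
  · obtain ⟨g, rfl⟩ := MulAction.exists_smul_eq H x y
    exact ⟨QuotientGroup.mk g, rfl⟩
  · obtain ⟨g, rfl⟩ := QuotientGroup.mk_surjective c
    rw [cosetFn_mk, MulAction.ofQuotientStabilizer_mk, hF]
    intro w hw
    rw [← hF, MulAction.mem_stabilizer_iff.mp hw]

theorem apply_mem_repFixed_stabilizer {X : Type*} [MulAction H X]
    {F : X → M} (hF : ∀ (h : H) (x : X), F (h • x) = τ h (F x)) (x : X) :
    F x ∈ repFixed τ (MulAction.stabilizer H x) := fun w hw => by
  rw [← hF, MulAction.mem_stabilizer_iff.mp hw]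

open Classical in
/-- Modulo the kernel of the Brauer homomorphism, the sum of an equivariant function is the sum
over the fixed points. -/
theorem sum_sub_sum_fixedPoints_mem [IsLocalRing O] [Finite H] {X : Type*} [MulAction H X]
    [Fintype X] {F : X → M} (hF : ∀ (h : H) (x : X), F (h • x) = τ h (F x)) :
    ∑ x, F x - ∑ x ∈ Finset.univ.filter (· ∈ MulAction.fixedPoints H X), F x ∈
      repBrauerKernel τ := by
  -- The difference is sorted by orbits. A fixed point forms its own orbit and cancels; any other
  -- orbit sum is a relative trace from a proper stabilizer.
  have := Fintype.ofFinite (Quotient (MulAction.orbitRel H X))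
  rw [← Finset.sum_fiberwise (s := Finset.univ)
      (g := fun x : X => (Quotient.mk (MulAction.orbitRel H X) x)),
    ← Finset.sum_fiberwise (s := Finset.univ.filter (· ∈ MulAction.fixedPoints H X))
      (g := fun x : X => (Quotient.mk (MulAction.orbitRel H X) x)), ← Finset.sum_sub_distrib]
  refine Submodule.sum_mem _ fun ω _ => ?_
  obtain ⟨x, rfl⟩ := Quotient.mk_surjective ω
  have hfib : ∀ y : X, Quotient.mk (MulAction.orbitRel H X) y = Quotient.mk _ x ↔
      y ∈ MulAction.orbit H x := fun y => Quotient.eq.trans MulAction.orbitRel_apply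
  simp only [hfib]
  by_cases hx : x ∈ MulAction.fixedPoints H X
  · have horb : ∀ y, y ∈ MulAction.orbit H x ↔ y = x := fun y =>
      ⟨fun ⟨g, hg⟩ => hg.symm.trans (hx g), fun h => h.symm ▸ MulAction.mem_orbit_self x⟩
    have e1 : Finset.univ.filter (· ∈ MulAction.orbit H x) = {x} := by
      ext y; simp [horb]
    have e2 : (Finset.univ.filter (· ∈ MulAction.fixedPoints H X)).filter
        (· ∈ MulAction.orbit H x) = {x} := by
      ext y
      simp only [horb, Finset.mem_filter, Finset.mem_univ, true_and, Finset.mem_singleton]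
      exact ⟨fun h => h.2, fun h => ⟨h ▸ hx, h⟩⟩
    rw [e1, e2, sub_self]
    exact Submodule.zero_mem _
  · have e2 : (Finset.univ.filter (· ∈ MulAction.fixedPoints H X)).filter
        (· ∈ MulAction.orbit H x) = ∅ := by
      refine Finset.eq_empty_of_forall_notMem fun y hy => hx ?_
      simp only [Finset.mem_filter, Finset.mem_univ, true_and] at hy
      obtain ⟨h1, g, rfl⟩ := hy
      intro h
      have := h1 (g * h * g⁻¹)
      simp only [mul_smul, inv_smul_smul] at this
      exact MulAction.injective g this
    rw [e2, Finset.sum_empty, sub_zero]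
    refine Submodule.mem_sup_right (Submodule.subset_span
      ⟨MulAction.stabilizer H x, fun h => hx fun g => ?_, F x,
        apply_mem_repFixed_stabilizer hF x, ?_⟩)
    · exact MulAction.mem_stabilizer_iff.mp (h ▸ Subgroup.mem_top g)
    · have hF' : ∀ (h : H) (y : MulAction.orbit H x), F ((h • y : MulAction.orbit H x) : X) =
          τ h (F y) := fun h y => hF h y
      have hsum := sum_eq_cosetSum_of_isPretransitive (X := MulAction.orbit H x)
        (F := fun y => F y) hF' ⟨x, MulAction.mem_orbit_self x⟩
      have hst : MulAction.stabilizer H (⟨x, MulAction.mem_orbit_self x⟩ : MulAction.orbit H x) =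
          MulAction.stabilizer H x := by
        ext g
        simp only [MulAction.mem_stabilizer_iff, Subtype.ext_iff, MulAction.orbit.coe_smul]
      rw [hst] at hsum
      rw [← hsum]
      exact (Finset.sum_subtype _ (by simp) _)

theorem cosetSum_mem_repFixed [Finite H] {W : Subgroup H} {a : M} (ha : a ∈ repFixed τ W) :
    cosetSum τ W a ∈ repFixed τ ⊤ := by
  intro g _
  have := Fintype.ofFinite (H ⧸ W)
  rw [cosetSum_eq_sum, map_sum]
  simp only [← cosetFn_smul ha]
  exact Equiv.sum_comp (MulAction.toPerm g) (cosetFn τ W a)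

theorem map_cosetSum [Finite H] {M' : Type*} [AddCommGroup M'] [Module O M']
    {τ' : H →* Module.End O M'} (f : M →ₗ[O] M') (hf : ∀ (h : H) (m : M), f (τ h m) = τ' h (f m))
    (W : Subgroup H) (a : M) : f (cosetSum τ W a) = cosetSum τ' W (f a) := by
  have := Fintype.ofFinite (H ⧸ W)
  rw [cosetSum_eq_sum, cosetSum_eq_sum, map_sum]
  exact Finset.sum_congr rfl fun c _ => hf _ _

theorem cosetSum_add [Finite H] (W : Subgroup H) (a b : M) :
    cosetSum τ W (a + b) = cosetSum τ W a + cosetSum τ W b := by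
  have := Fintype.ofFinite (H ⧸ W)
  simp only [cosetSum_eq_sum, cosetFn, map_add, Finset.sum_add_distrib]

theorem cosetSum_smul [Finite H] (W : Subgroup H) (r : O) (a : M) :
    cosetSum τ W (r • a) = r • cosetSum τ W a := by
  have := Fintype.ofFinite (H ⧸ W)
  simp only [cosetSum_eq_sum, cosetFn, map_smul, Finset.smul_sum]

theorem cosetSum_top [Finite H] (a : M) (ha : a ∈ repFixed τ ⊤) : cosetSum τ ⊤ a = a := by
  have : Subsingleton (H ⧸ (⊤ : Subgroup H)) := QuotientGroup.subsingleton_quotient_top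
  unfold cosetSum
  rw [finsum_eq_single _ (QuotientGroup.mk 1) (fun c hc => absurd (Subsingleton.elim _ _) hc),
    cosetFn_mk ha, map_one, Module.End.one_apply]

theorem repFixed_comp_subtype (R : Subgroup H) (T : Subgroup R) :
    repFixed (τ.comp R.subtype) T = repFixed τ (T.map R.subtype) := by
  ext m
  simp only [mem_repFixed, Subgroup.mem_map, forall_exists_index, and_imp]
  exact ⟨fun h w r hr hw => hw ▸ h r hr, fun h r hr => h _ r hr rfl⟩

/-- Transitivity of relative traces. -/
theorem cosetSum_trans [Finite H] (R : Subgroup H) (T : Subgroup R) {a : M}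
    (ha : a ∈ repFixed τ (T.map R.subtype)) :
    cosetSum τ R (cosetSum (τ.comp R.subtype) T a) = cosetSum τ (T.map R.subtype) a := by
  classical
  have := Fintype.ofFinite (H ⧸ R)
  have := Fintype.ofFinite (R ⧸ T)
  have := Fintype.ofFinite (H ⧸ T.map R.subtype)
  have hle : T.map R.subtype ≤ R := Subgroup.map_subtype_le T
  have ha' : a ∈ repFixed (τ.comp R.subtype) T := by rwa [repFixed_comp_subtype]
  rw [cosetSum_eq_sum, cosetSum_eq_sum, cosetSum_eq_sum]
  simp only [cosetFn, map_sum, MonoidHom.comp_apply, Subgroup.coe_subtype,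
    ← Module.End.mul_apply, ← map_mul]
  rw [← Fintype.sum_prod_type']
  -- Products of representatives for `H / R` and for `R / T` form a system of representatives for
  -- the image of `T` in `H`.
  refine Fintype.sum_bijective
    (fun q : (H ⧸ R) × (R ⧸ T) => (QuotientGroup.mk (Quotient.out q.1 * (Quotient.out q.2 : R)) :
      H ⧸ T.map R.subtype)) ⟨?_, ?_⟩ _ _ ?_
  · rintro ⟨c, d⟩ ⟨c', d'⟩ h
    have h' := QuotientGroup.eq.mp h
    obtain ⟨t, ht, hte⟩ := h'
    have hc : c = c' := by
      rw [← QuotientGroup.out_eq' c, ← QuotientGroup.out_eq' c']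
      refine QuotientGroup.eq.mpr ?_
      have : (Quotient.out c)⁻¹ * Quotient.out c' =
          (Quotient.out d : R) * (t : H) * (Quotient.out d' : R)⁻¹ := by
        rw [show (t : H) = _ from hte]; simp [mul_assoc]
      rw [this]
      exact R.mul_mem (R.mul_mem (SetLike.coe_mem _) t.2) (R.inv_mem (SetLike.coe_mem _))
    subst hc
    have hd : d = d' := by
      rw [← QuotientGroup.out_eq' d, ← QuotientGroup.out_eq' d']
      refine QuotientGroup.eq.mpr ?_
      have : (Quotient.out d)⁻¹ * Quotient.out d' = t := by
        apply Subtype.ext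
        rw [show (t : H) = _ from hte]
        simp
      rw [this]
      exact ht
    rw [hd]
  · intro c
    obtain ⟨g, rfl⟩ := QuotientGroup.mk_surjective c
    obtain ⟨r, hr⟩ := QuotientGroup.mk_out_eq_mul R g
    obtain ⟨t, ht⟩ := QuotientGroup.mk_out_eq_mul T r⁻¹
    refine ⟨(QuotientGroup.mk g, QuotientGroup.mk r⁻¹), ?_⟩
    refine QuotientGroup.eq.mpr ?_
    simp only
    rw [show Quotient.out (QuotientGroup.mk g : H ⧸ R) = g * r from hr,
      show Quotient.out (QuotientGroup.mk r⁻¹ : R ⧸ T) = r⁻¹ * t from ht]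
    have : (g * r * ((r⁻¹ * t : R) : H))⁻¹ * g = ((t : R) : H)⁻¹ := by
      rw [Subgroup.coe_mul, Subgroup.coe_inv]; group
    rw [this]
    exact Subgroup.inv_mem _ ⟨t, t.2, rfl⟩
  · rintro ⟨c, d⟩
    exact (cosetFn_mk ha _).symm

/-- Functoriality of the kernel of the Brauer homomorphism. -/
theorem map_mem_repBrauerKernel [IsLocalRing O] [Finite H] {H' M' : Type*} [Group H']
    [AddCommGroup M'] [Module O M'] {τ' : H' →* Module.End O M'} (θ : H ≃* H') (f : M →ₗ[O] M')
    (hf : ∀ (h : H) (m : M), f (τ h m) = τ' (θ h) (f m)) {x : M} (hx : x ∈ repBrauerKernel τ) :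
    f x ∈ repBrauerKernel τ' := by
  classical
  have : Finite H' := Finite.of_equiv H θ.toEquiv
  suffices h : repBrauerKernel τ ≤ (repBrauerKernel τ').comap f from h hx
  refine sup_le ?_ (Submodule.span_le.mpr ?_)
  · refine Submodule.smul_le.mpr fun r hr m hm => ?_
    rw [Submodule.mem_comap, map_smul]
    refine Submodule.mem_sup_left (Submodule.smul_mem_smul hr fun w _ => ?_)
    rw [← θ.apply_symm_apply w, ← hf, hm _ trivial]
  · rintro _ ⟨W, hW, a, ha, rfl⟩
    have := Fintype.ofFinite (H ⧸ W)
    -- Letting `H'` act on `H / W` through `θ⁻¹` turns the image of the trace into the sum of an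
    -- equivariant function. As `W` is proper there are no fixed points, so the sum lies in the
    -- kernel.
    let _ : MulAction H' (H ⧸ W) := MulAction.compHom _ θ.symm.toMonoidHom
    have hF : ∀ (h : H') (c : H ⧸ W), f (cosetFn τ W a (h • c)) = τ' h (f (cosetFn τ W a c)) := by
      intro h c
      rw [show h • c = θ.symm h • c from rfl, cosetFn_smul ha, hf, θ.apply_symm_apply]
    have key := sum_sub_sum_fixedPoints_mem (τ := τ') (X := H ⧸ W) (F := fun c => f (cosetFn τ W a c)) hF
    have he : Finset.univ.filter (· ∈ MulAction.fixedPoints H' (H ⧸ W)) = ∅ := by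
      refine Finset.eq_empty_of_forall_notMem fun c hc => hW ?_
      simp only [Finset.mem_filter, Finset.mem_univ, true_and] at hc
      obtain ⟨g, rfl⟩ := QuotientGroup.mk_surjective c
      rw [eq_top_iff]
      intro w _
      have h1 := hc (θ (g * w * g⁻¹))
      rw [show ∀ c : H ⧸ W, θ (g * w * g⁻¹) • c = θ.symm (θ (g * w * g⁻¹)) • c from fun _ => rfl,
        θ.symm_apply_apply, MulAction.Quotient.smul_mk] at h1
      have h2 := QuotientGroup.eq.mp h1
      simp only [smul_eq_mul, mul_assoc, inv_mul_cancel, mul_one, mul_inv_rev] at h2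
      have h3 : w⁻¹ ∈ W := by simpa using h2
      simpa using h3
    rw [he, Finset.sum_empty, sub_zero] at key
    rw [SetLike.mem_coe, Submodule.mem_comap, cosetSum_eq_sum, map_sum]
    exact key

end Representations

/-! ### Brauer kernels of permutation modules. -/

section PermutationBasis

variable {O H M : Type*} [CommRing O] [IsLocalRing O] [Group H] [Finite H] [AddCommGroup M]
  [Module O M] {τ : H →* Module.End O M} {X : Type*} [MulAction H X]

theorem natCast_mem_maximalIdeal (O : Type*) [CommRing O] [IsLocalRing O] (p : ℕ)
    [CharP (IsLocalRing.ResidueField O) p] : (p : O) ∈ IsLocalRing.maximalIdeal O := by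
  rw [← IsLocalRing.residue_eq_zero_iff, map_natCast, CharP.cast_eq_zero]

theorem _root_.IsPGroup.prod_self {G : Type*} [Group G] {p : ℕ} (hp : IsPGroup p G) :
    IsPGroup p (G × G) := by
  intro s
  obtain ⟨k, hk⟩ := hp s.1
  obtain ⟨l, hl⟩ := hp s.2
  refine ⟨k + l, Prod.ext ?_ ?_⟩
  · rw [Prod.pow_fst, pow_add, pow_mul, hk, one_pow, Prod.fst_one]
  · rw [Prod.pow_snd, pow_add, mul_comm, pow_mul, hl, one_pow, Prod.snd_one]

theorem IsPGroup.dvd_card_quotient {p : ℕ} [Fact p.Prime] (hp : IsPGroup p H) {W : Subgroup H}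
    (hW : W ≠ ⊤) : p ∣ Nat.card (H ⧸ W) := by
  obtain ⟨n, hn⟩ := hp.index W
  rw [Subgroup.index] at hn
  rw [hn]
  refine dvd_pow_self p fun h0 => hW ?_
  rw [h0, pow_zero] at hn
  exact Subgroup.index_eq_one.mp hn

/-- A fixed element of a permutation basis is not in the kernel of the Brauer homomorphism. -/
theorem basis_notMem_repBrauerKernel (p : ℕ) [Fact p.Prime] [CharP (IsLocalRing.ResidueField O) p]
    (hp : IsPGroup p H) (b : Module.Basis X O M) (hb : ∀ (h : H) (x : X), τ h (b x) = b (h • x))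
    {x : X} (hx : x ∈ MulAction.fixedPoints H X) : b x ∉ repBrauerKernel τ := by
  classical
  -- The coordinate at a fixed point is an invariant functional. It multiplies a trace from a proper
  -- subgroup by an index divisible by `p`, so it maps the Brauer kernel into the maximal ideal,
  -- whereas it maps `b x` to `1`.
  have hcoord : ∀ (h : H) (m : M), b.coord x (τ h m) = b.coord x m := by
    intro h m
    have : (b.coord x).comp (τ h) = b.coord x := by
      refine b.ext fun y => ?_
      simp only [LinearMap.comp_apply, hb, Module.Basis.coord_apply, Module.Basis.repr_self,
        Finsupp.single_apply]
      have : h • y = x ↔ y = x :=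
        ⟨fun hy => MulAction.injective h (hy.trans (hx h).symm), fun hy => by rw [hy]; exact hx h⟩
      simp only [this]
    exact LinearMap.congr_fun this m
  have hker : repBrauerKernel τ ≤
      Submodule.comap (b.coord x) (IsLocalRing.maximalIdeal O : Submodule O O) := by
    refine sup_le ?_ (Submodule.span_le.mpr ?_)
    · refine Submodule.smul_le.mpr fun r hr m _ => ?_
      rw [Submodule.mem_comap, map_smul]
      exact Ideal.mul_mem_right _ _ hr
    · rintro _ ⟨W, hW, a, -, rfl⟩
      have := Fintype.ofFinite (H ⧸ W)
      rw [SetLike.mem_coe, Submodule.mem_comap, cosetSum_eq_sum, map_sum]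
      simp only [cosetFn, hcoord, Finset.sum_const, Finset.card_univ]
      rw [nsmul_eq_mul, ← Nat.card_eq_fintype_card]
      obtain ⟨k, hk⟩ := IsPGroup.dvd_card_quotient hp hW
      rw [hk, Nat.cast_mul, mul_assoc]
      exact Ideal.mul_mem_right _ _ (natCast_mem_maximalIdeal O p)
  intro h
  have h1 := hker h
  rw [Submodule.mem_comap, Module.Basis.coord_apply, Module.Basis.repr_self,
    Finsupp.single_eq_same] at h1
  exact (Ideal.ne_top_iff_one _).mp (IsLocalRing.maximalIdeal.isMaximal O).ne_top h1

/-- The basis expansion of an invariant vector is the sum of an equivariant function on `X`. Without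
fixed points such a sum lies in the Brauer kernel. -/
theorem fixedPoints_nonempty_of_notMem [Finite X] (b : Module.Basis X O M)
    (hb : ∀ (h : H) (x : X), τ h (b x) = b (h • x)) {m : M} (hm : m ∈ repFixed τ ⊤)
    (hm' : m ∉ repBrauerKernel τ) : (MulAction.fixedPoints H X).Nonempty := by
  classical
  have := Fintype.ofFinite X
  by_contra hcon
  rw [Set.not_nonempty_iff_eq_empty] at hcon
  have hrepr : ∀ (h : H) (x : X) (m : M), b.repr (τ h m) (h • x) = b.repr m x := by
    intro h x m
    have : (b.coord (h • x)).comp (τ h) = b.coord x := by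
      refine b.ext fun y => ?_
      simp only [LinearMap.comp_apply, hb, Module.Basis.coord_apply, Module.Basis.repr_self,
        Finsupp.single_apply, smul_left_cancel_iff]
    exact LinearMap.congr_fun this m
  have key := sum_sub_sum_fixedPoints_mem (τ := τ) (X := X) (F := fun x => b.repr m x • b x)
    (fun h x => by
      rw [LinearMap.map_smul, hb, ← hrepr h x m, hm h trivial])
  rw [b.sum_repr, hcon] at key
  simp only [Set.mem_empty_iff_false, Finset.filter_false, Finset.sum_empty, sub_zero] at key
  exact hm' key

end PermutationBasis

/-! ### Interior algebras as representations, and their Brauer quotients. -/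

section Interior

variable {O S A : Type*} [CommRing O] [Group S] [Ring A] [Algebra O A]

/-- The representation of `S × S` on an interior `S`-algebra. -/
def biactRep (O : Type*) {S A : Type*} [CommRing O] [Group S] [Ring A] [Algebra O A]
    (σ : S →* A) : S × S →* Module.End O A where
  toFun s :=
    { toFun := biact σ s
      map_add' := fun a b => by simp only [biact, mul_add, add_mul]
      map_smul' := fun c a => by
        simp only [biact, mul_smul_comm, smul_mul_assoc, RingHom.id_apply] }
  map_one' := by
    ext a
    change biact σ 1 a = a
    simp [biact]
  map_mul' s t := by
    ext a
    change biact σ (s * t) a = biact σ s (biact σ t a)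
    simp [biact, mul_assoc]

theorem biactRep_apply (σ : S →* A) (s : S × S) (a : A) : biactRep O σ s a = biact σ s a := rfl

/-- The conjugation representation of `S` on an interior `S`-algebra. -/
def conjRep (O : Type*) {S A : Type*} [CommRing O] [Group S] [Ring A] [Algebra O A]
    (σ : S →* A) : S →* Module.End O A :=
  (biactRep O σ).comp ((MonoidHom.id S).prod (MonoidHom.id S))

theorem conjRep_apply (σ : S →* A) (s : S) (a : A) : conjRep O σ s a = σ s * a * σ s⁻¹ := rfl

theorem map_mul_map_inv (σ : S →* A) (s : S) : σ s * σ s⁻¹ = 1 := by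
  rw [← map_mul, mul_inv_cancel, map_one]

theorem map_inv_mul_map (σ : S →* A) (s : S) : σ s⁻¹ * σ s = 1 := by
  rw [← map_mul, inv_mul_cancel, map_one]

theorem biact_eq_iff (σ : S →* A) (s : S × S) (a b : A) :
    biact σ s a = b ↔ σ s.1 * a = b * σ s.2 := by
  unfold biact
  constructor
  · rintro rfl
    rw [mul_assoc, map_inv_mul_map, mul_one]
  · intro h
    rw [h, mul_assoc, map_mul_map_inv, mul_one]

theorem mem_fixedSubmodule_twistedDiag {σ : S →* A} {P : Subgroup S} {φ : P →* S} {a : A} :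
    a ∈ fixedSubmodule O σ (twistedDiag φ) ↔ ∀ x : P, σ (φ x) * a = a * σ x := by
  constructor
  · intro h x
    exact (biact_eq_iff σ _ a a).mp (h (φ x, x) ⟨x, rfl⟩)
  · rintro h _ ⟨x, rfl⟩
    exact (biact_eq_iff σ _ a a).mpr (h x)

theorem mem_fixedAlgebra {σ : S →* A} {P : Subgroup S} {a : A} :
    a ∈ fixedAlgebra O σ P ↔ ∀ x ∈ P, σ x * a = a * σ x := by
  unfold fixedAlgebra
  rw [Subalgebra.mem_centralizer_iff]
  simp

theorem mem_fixedAlgebra_iff_mem_repFixed {σ : S →* A} {P : Subgroup S} {a : A} :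
    a ∈ fixedAlgebra O σ P ↔ a ∈ repFixed (conjRep O σ) P := by
  rw [mem_fixedAlgebra, mem_repFixed]
  refine forall₂_congr fun x _ => ?_
  exact (biact_eq_iff σ (x, x) a a).symm

theorem mem_fixedAlgebra_iff_mem_fixedSubmodule {σ : S →* A} {P : Subgroup S} {a : A} :
    a ∈ fixedAlgebra O σ P ↔ a ∈ fixedSubmodule O σ (twistedDiag P.subtype) := by
  rw [mem_fixedAlgebra, mem_fixedSubmodule_twistedDiag]
  exact ⟨fun h x => h x x.2, fun h x hx => h ⟨x, hx⟩⟩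

/-- The only difference is bookkeeping: proper subgroups of `U` are subgroups of `S × S` on one side
and of the group `U` on the other. This allows everything about Brauer quotients to be proved for
abstract representations. -/
theorem brauerKernel_eq_repBrauerKernel [IsLocalRing O] (σ : S →* A) (U : Subgroup (S × S)) :
    brauerKernel O σ U = repBrauerKernel ((biactRep O σ).comp U.subtype) := by
  unfold brauerKernel repBrauerKernel
  congr 2
  · ext a
    exact ⟨fun h u _ => h u u.2, fun h u hu => h ⟨u, hu⟩ trivial⟩
  · ext x
    constructor
    · rintro ⟨V, hV, a, ha, rfl⟩
      refine ⟨V.subgroupOf U, fun h => hV.not_ge (Subgroup.subgroupOf_eq_top.mp h), a,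
        fun w hw => ha w hw, rfl⟩
    · rintro ⟨W, hW, a, ha, rfl⟩
      have hsub : (W.map U.subtype).subgroupOf U = W :=
        Subgroup.comap_map_eq_self_of_injective U.subtype_injective W
      refine ⟨W.map U.subtype, lt_of_le_of_ne (Subgroup.map_subtype_le W) fun h => hW ?_, a, ?_, ?_⟩
      · rw [← hsub, h, Subgroup.subgroupOf_self]
      · rintro _ ⟨w, hw, rfl⟩
        exact ha w hw
      · have : relTrace σ (W.map U.subtype) U a =
            cosetSum ((biactRep O σ).comp U.subtype) ((W.map U.subtype).subgroupOf U) a := rfl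
        rw [this, hsub]

/-- The group isomorphism from `P` to a twisted diagonal subgroup. -/
noncomputable def twistedDiagEquiv {P : Subgroup S} (φ : P →* S) : P ≃* twistedDiag φ :=
  MonoidHom.ofInjective (f := φ.prod P.subtype) fun _ _ h => Subtype.ext (Prod.ext_iff.mp h).2

/-- Functoriality of the Brauer kernel at twisted diagonal subgroups. -/
theorem map_mem_brauerKernel [IsLocalRing O] [Finite S] {S' A' : Type*} [Group S'] [Ring A']
    [Algebra O A'] {σ : S →* A} {σ' : S' →* A'} {P : Subgroup S} {P' : Subgroup S'} {φ : P →* S}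
    {φ' : P' →* S'} (κ : P ≃* P') (f : A →ₗ[O] A')
    (hf : ∀ (x : P) (a : A), f (biact σ (φ x, x) a) = biact σ' (φ' (κ x), κ x) (f a)) {a : A}
    (ha : a ∈ brauerKernel O σ (twistedDiag φ)) : f a ∈ brauerKernel O σ' (twistedDiag φ') := by
  rw [brauerKernel_eq_repBrauerKernel] at ha ⊢
  refine map_mem_repBrauerKernel (((twistedDiagEquiv φ).symm.trans κ).trans (twistedDiagEquiv φ')) f
    (fun u m => ?_) ha
  obtain ⟨x, rfl⟩ := (twistedDiagEquiv φ).surjective u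
  simp only [MulEquiv.trans_apply, MulEquiv.symm_apply_apply]
  exact hf x m

/-- Multiplication by an intertwiner is an equivariant map, so functoriality of Brauer kernels
applies. This is how the products between different Brauer quotients enter. -/
theorem mul_left_mem_brauerKernel [IsLocalRing O] [Finite S] {σ : S →* A} {P : Subgroup S}
    {φ χ : P →* S} {b : A} (hb : ∀ x : P, σ (χ x) * b = b * σ (φ x)) {a : A}
    (ha : a ∈ brauerKernel O σ (twistedDiag φ)) : b * a ∈ brauerKernel O σ (twistedDiag χ) := by
  refine map_mem_brauerKernel (MulEquiv.refl P) (LinearMap.mulLeft O b) (fun x a => ?_) ha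
  simp only [biact, LinearMap.mulLeft_apply, MulEquiv.refl_apply]
  simp only [← mul_assoc, hb]

theorem mul_right_mem_brauerKernel [IsLocalRing O] [Finite S] {σ : S →* A} {P P' : Subgroup S}
    {φ : P →* S} (κ : P ≃* P') {b : A} (hb : ∀ x : P, σ x * b = b * σ (κ x)) {a : A}
    (ha : a ∈ brauerKernel O σ (twistedDiag φ)) :
    a * b ∈ brauerKernel O σ (twistedDiag (φ.comp κ.symm.toMonoidHom)) := by
  refine map_mem_brauerKernel κ (LinearMap.mulRight O b) (fun x a => ?_) ha
  have h1 : σ (x : S)⁻¹ * b = b * σ ((κ x : P') : S)⁻¹ := by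
    calc σ (x : S)⁻¹ * b = σ (x : S)⁻¹ * (b * σ (κ x)) * σ ((κ x : P') : S)⁻¹ := by
          rw [mul_assoc, mul_assoc, map_mul_map_inv, mul_one]
      _ = _ := by rw [← hb, ← mul_assoc, map_inv_mul_map, one_mul]
  simp only [biact, LinearMap.mulRight_apply, MonoidHom.comp_apply, MulEquiv.toMonoidHom_eq_coe,
    MonoidHom.coe_coe, MulEquiv.symm_apply_apply]
  rw [mul_assoc _ _ b, h1]
  simp only [mul_assoc]

theorem conj_mem_brauerKernel [IsLocalRing O] [Finite S] {σ : S →* A} {P Q : Subgroup S}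
    (φ : P ≃* Q) {u v : A} (hu : ∀ x : P, σ (φ x) * u = u * σ x)
    (hv : ∀ x : P, σ x * v = v * σ (φ x)) {a : A}
    (ha : a ∈ brauerKernel O σ (twistedDiag P.subtype)) :
    u * a * v ∈ brauerKernel O σ (twistedDiag Q.subtype) := by
  have h1 := mul_left_mem_brauerKernel (χ := Q.subtype.comp φ.toMonoidHom) hu ha
  have h2 := mul_right_mem_brauerKernel φ hv h1
  have : (Q.subtype.comp φ.toMonoidHom).comp φ.symm.toMonoidHom = Q.subtype := by
    ext x
    simp
  rwa [this] at h2

theorem brauerKernel_diag_eq [IsLocalRing O] [Finite S] (σ : S →* A) (P : Subgroup S) :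
    brauerKernel O σ (twistedDiag P.subtype) =
      repBrauerKernel ((conjRep O σ).comp P.subtype) := by
  rw [brauerKernel_eq_repBrauerKernel]
  ext a
  constructor
  · intro ha
    refine map_mem_repBrauerKernel (twistedDiagEquiv P.subtype).symm LinearMap.id (fun u m => ?_) ha
    obtain ⟨x, rfl⟩ := (twistedDiagEquiv P.subtype).surjective u
    rw [MulEquiv.symm_apply_apply]
    rfl
  · intro ha
    exact map_mem_repBrauerKernel (twistedDiagEquiv P.subtype) LinearMap.id (fun u m => rfl) ha

theorem nontrivial_brauerQuotient_iff [IsLocalRing O] {σ : S →* A} {U : Subgroup (S × S)} :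
    Nontrivial (BrauerQuotient O σ U) ↔ ∃ a ∈ fixedSubmodule O σ U, a ∉ brauerKernel O σ U := by
  rw [Submodule.Quotient.nontrivial_iff, Ne, Submodule.submoduleOf_eq_top, SetLike.not_le_iff_exists]

theorem isFixedPointFusion_equiv_iff [IsLocalRing O] {σ : S →* A} {P Q : Subgroup S} (φ : P ≃* Q) :
    IsFixedPointFusion O σ φ.toMonoidHom ↔ ∃ a : A, (∀ x : P, σ (φ x) * a = a * σ x) ∧
      a ∉ brauerKernel O σ (twistedDiag (Q.subtype.comp φ.toMonoidHom)) := by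
  unfold IsFixedPointFusion
  rw [nontrivial_brauerQuotient_iff, and_iff_right (show Function.Injective φ.toMonoidHom from
    φ.injective)]
  refine exists_congr fun a => and_congr_left fun _ => ?_
  rw [mem_fixedSubmodule_twistedDiag]
  rfl

/-- The action of `S × S` on an invariant basis. -/
@[reducible]
def IsInvariantBasis.mulAction {σ : S →* A} {Y : Set A} (hY : IsInvariantBasis O σ Y) :
    MulAction (S × S) Y where
  smul s y := ⟨biact σ s y, hY.right_mem _ _ (hY.left_mem _ _ y.2)⟩
  one_smul y := Subtype.ext (by
    change biact σ 1 y = y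
    rw [← biactRep_apply (O := O), map_one, Module.End.one_apply])
  mul_smul s t y := Subtype.ext (by
    change biact σ (s * t) y = biact σ s (biact σ t y)
    simp only [← biactRep_apply (O := O), map_mul, Module.End.mul_apply])

/-- The basis of an interior algebra that is given by an invariant basis. -/
noncomputable def IsInvariantBasis.basis {σ : S →* A} {Y : Set A} (hY : IsInvariantBasis O σ Y) :
    Module.Basis Y O A :=
  Module.Basis.mk (v := ((↑) : Y → A)) hY.linearIndep (by
    rw [Subtype.range_coe, hY.span_eq_top])

theorem IsInvariantBasis.basis_apply {σ : S →* A} {Y : Set A} (hY : IsInvariantBasis O σ Y)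
    (y : Y) : hY.basis y = y := by
  exact Module.Basis.mk_apply _ _ y

/-- The Brauer quotient at `U` is nonzero if and only if `U` fixes an element of the basis. -/
theorem IsInvariantBasis.nontrivial_brauerQuotient_iff [IsLocalRing O] [Module.Finite O A]
    [Finite S] (p : ℕ) [Fact p.Prime] [CharP (IsLocalRing.ResidueField O) p] (hp : IsPGroup p S)
    {σ : S →* A} {Y : Set A} (hY : IsInvariantBasis O σ Y) (U : Subgroup (S × S)) :
    (∃ a ∈ fixedSubmodule O σ U, a ∉ brauerKernel O σ U) ↔ ∃ y ∈ Y, y ∈ fixedSubmodule O σ U := by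
  let _ := hY.mulAction
  have hb : ∀ (h : U) (x : Y), ((biactRep O σ).comp U.subtype) h (hY.basis x) = hY.basis (h • x) := by
    intro h x
    rw [hY.basis_apply, hY.basis_apply]
    rfl
  rw [brauerKernel_eq_repBrauerKernel]
  constructor
  · rintro ⟨a, ha, ha'⟩
    have : Finite Y := Module.Finite.finite_basis hY.basis
    obtain ⟨y, hy⟩ := fixedPoints_nonempty_of_notMem hY.basis hb (fun u _ => ha u u.2) ha'
    exact ⟨y, y.2, fun u hu => congrArg Subtype.val (hy ⟨u, hu⟩)⟩
  · rintro ⟨y, hy, hy'⟩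
    have hpU : IsPGroup p U := hp.prod_self.to_subgroup U
    have := basis_notMem_repBrauerKernel p hpU hY.basis hb (x := ⟨y, hy⟩)
      (fun u => Subtype.ext (hy' u u.2))
    rw [hY.basis_apply] at this
    exact ⟨y, hy', this⟩

end Interior

/-! ### Fixed vectors of `p`-groups in modules of exponent `p`. -/

section FixedVector

/-- A `p`-group that acts on a nonzero module of exponent `p` has a nonzero fixed vector. -/
theorem exists_fixed_mod {O N M : Type*} [CommRing O] [Group N] [Finite N] [AddCommGroup M]
    [Module O M] {p : ℕ} [Fact p.Prime] (hp : IsPGroup p N) (ρ : N →* Module.End O M)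
    (L K : Submodule O M) (hL : ∀ n, ∀ x ∈ L, ρ n x ∈ L) (hK : ∀ n, ∀ x ∈ K, ρ n x ∈ K)
    (hpK : ∀ x ∈ L, (p : O) • x ∈ K) {x : M} (hxL : x ∈ L) (hxK : x ∉ K) :
    ∃ y ∈ L, y ∉ K ∧ ∀ n, ρ n y - y ∈ K := by
  let act : N → (M ⧸ K) →ₗ[O] (M ⧸ K) := fun n => K.mapQ K (ρ n) (hK n)
  have hact : ∀ n m, act n (K.mkQ m) = K.mkQ (ρ n m) := fun n m => rfl
  -- The residue field is infinite in the application, so counting takes place in the additive group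
  -- generated by one orbit. It is finitely generated of exponent `p`, hence a finite set.
  let Z : AddSubgroup (M ⧸ K) := AddSubgroup.closure (Set.range fun n => K.mkQ (ρ n x))
  have hZL : Z ≤ (L.map K.mkQ).toAddSubgroup := by
    refine (AddSubgroup.closure_le _).mpr ?_
    rintro _ ⟨n, rfl⟩
    exact ⟨ρ n x, hL n x hxL, rfl⟩
  have hpZ : ∀ z ∈ Z, p • z = 0 := by
    intro z hz
    obtain ⟨m, hm, rfl⟩ := hZL hz
    rw [← map_nsmul, Submodule.mkQ_apply, Submodule.Quotient.mk_eq_zero, ← Nat.cast_smul_eq_nsmul O]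
    exact hpK m hm
  have hstab : ∀ n, ∀ z ∈ Z, act n z ∈ Z := by
    intro n z hz
    have : Z ≤ Z.comap (act n).toAddMonoidHom := by
      refine (AddSubgroup.closure_le _).mpr ?_
      rintro _ ⟨k, rfl⟩
      refine AddSubgroup.subset_closure ⟨n * k, ?_⟩
      change K.mkQ (ρ (n * k) x) = act n (K.mkQ (ρ k x))
      rw [hact, map_mul, Module.End.mul_apply]
    exact this hz
  have hfg : AddGroup.FG Z := by
    rw [AddGroup.fg_iff_addSubgroup_fg]
    exact ⟨(Set.finite_range fun n => K.mkQ (ρ n x)).toFinset, by simp [Z]⟩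
  have hfin : Finite Z := AddCommGroup.finite_of_fg_isAddTorsion _ fun z => by
    rw [isOfFinAddOrder_iff_nsmul_eq_zero]
    exact ⟨p, (Fact.out (p := p.Prime)).pos, Subtype.ext (hpZ z z.2)⟩
  let _ : MulAction N Z :=
    { smul := fun n z => ⟨act n z, hstab n z z.2⟩
      one_smul := fun z => Subtype.ext (by
        obtain ⟨m, hm⟩ := K.mkQ_surjective (z : M ⧸ K)
        change act 1 z = z
        rw [← hm, hact, map_one, Module.End.one_apply])
      mul_smul := fun a b z => Subtype.ext (by
        obtain ⟨m, hm⟩ := K.mkQ_surjective (z : M ⧸ K)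
        change act (a * b) z = act a (act b z)
        rw [← hm, hact, hact, hact, map_mul, Module.End.mul_apply]) }
  have hx1 : K.mkQ x ∈ Z := AddSubgroup.subset_closure ⟨1, by simp⟩
  have hx0 : (⟨K.mkQ x, hx1⟩ : Z) ≠ 0 := fun h =>
    hxK ((Submodule.Quotient.mk_eq_zero K).mp (congrArg Subtype.val h))
  have hdvd : p ∣ Nat.card Z := by
    rw [← addOrderOf_eq_prime (p := p) (x := (⟨K.mkQ x, hx1⟩ : Z)) (Subtype.ext (hpZ _ hx1)) hx0]
    exact addOrderOf_dvd_natCard _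
  -- The number of fixed points is divisible by `p`, and `0` is one of them, so there is a nonzero
  -- one.
  obtain ⟨z, hz, hz0⟩ := hp.exists_fixed_point_of_prime_dvd_card_of_fixed_point (α := Z) hdvd
    (a := 0) (fun n => Subtype.ext (map_zero (act n)))
  obtain ⟨y, hyL, hy⟩ := hZL z.2
  refine ⟨y, hyL, fun hyK => hz0 ?_, fun n => ?_⟩
  · refine Subtype.ext ?_
    rw [← hy]
    exact ((Submodule.Quotient.mk_eq_zero K).mpr hyK).symm
  · rw [← Submodule.Quotient.mk_eq_zero, Submodule.Quotient.mk_sub, sub_eq_zero]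
    have : act n z = z := congrArg Subtype.val (hz n)
    rw [← hy] at this
    exact this

end FixedVector

/-! ### Additivity of multiplicities. -/

section MultiplicityAdd

variable {R : Type*} [Ring R]

theorem idemCount_union [DecidableEq R] {I J : Finset R} (h : Disjoint I J) (x : R) :
    idemCount (I ∪ J) x = idemCount I x + idemCount J x := by
  classical
  unfold idemCount
  rw [← Finset.card_union_of_disjoint (Finset.disjoint_filter_filter h), ← Finset.filter_union]

theorem IsPoint.pointMultiplicity_add [IsSemiperfectRing R] {γ : Set R} (hγ : IsPoint γ) {e f : R}
    (he : IsIdempotentElem e) (hf : IsIdempotentElem f) (hef : e * f = 0) (hfe : f * e = 0) :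
    pointMultiplicity γ (e + f) = pointMultiplicity γ e + pointMultiplicity γ f := by
  classical
  obtain ⟨I, hI⟩ := IsSemiperfectRing.exists_decomposition e he
  obtain ⟨J, hJ⟩ := IsSemiperfectRing.exists_decomposition f hf
  obtain ⟨i, hi⟩ := hγ.nonempty
  rw [hγ.pointMultiplicity_eq hi hI, hγ.pointMultiplicity_eq hi hJ,
    hγ.pointMultiplicity_eq hi (hI.union hJ hef hfe), idemCount_union (hI.disjoint hJ hef)]

end MultiplicityAdd

/-! ### Vertices of primitive idempotents in fixed point algebras. -/

section Vertices

variable {O H A : Type*} [CommRing O] [Group H] [Ring A] [Algebra O A] {σ : H →* A}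

theorem conjRep_mul (h : H) (a b : A) :
    conjRep O σ h (a * b) = conjRep O σ h a * conjRep O σ h b := by
  simp only [conjRep_apply]
  calc σ h * (a * b) * σ h⁻¹ = σ h * a * 1 * b * σ h⁻¹ := by noncomm_ring
    _ = _ := by rw [← map_inv_mul_map σ h]; noncomm_ring

theorem fixedAlgebra_mono {R T : Subgroup H} (h : R ≤ T) :
    fixedAlgebra O σ T ≤ fixedAlgebra O σ R :=
  Subalgebra.centralizer_le O _ _ (Set.image_mono h)

/-- The element `y` is singular in the corner of `i` in the fixed point algebra. -/
def IsCornerSingular (O : Type*) {H A : Type*} [CommRing O] [Group H] [Ring A] [Algebra O A]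
    (σ : H →* A) (i y : A) : Prop :=
  ¬ ∃ z ∈ fixedAlgebra O σ ⊤, z * (i * y * i) = i ∧ (i * y * i) * z = i

theorem isCornerSingular_iff (i y : fixedAlgebra O σ ⊤) :
    IsCornerSingular O σ (i : A) y ↔ ¬ IsCornerUnit i (i * y * i) := by
  refine not_congr ⟨?_, ?_⟩
  · rintro ⟨z, hz, h1, h2⟩
    exact ⟨⟨z, hz⟩, Subtype.ext h1, Subtype.ext h2⟩
  · rintro ⟨z, h1, h2⟩
    exact ⟨z, z.2, congrArg Subtype.val h1, congrArg Subtype.val h2⟩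

theorem IsCornerSingular.add {i : fixedAlgebra O σ ⊤} (hi : IsLocalIdem i) {x y : A}
    (hx : x ∈ fixedAlgebra O σ ⊤) (hy : y ∈ fixedAlgebra O σ ⊤) (h1 : IsCornerSingular O σ (i : A) x)
    (h2 : IsCornerSingular O σ (i : A) y) : IsCornerSingular O σ (i : A) (x + y) := by
  have k1 := (isCornerSingular_iff i ⟨x, hx⟩).mp h1
  have k2 := (isCornerSingular_iff i ⟨y, hy⟩).mp h2
  refine (isCornerSingular_iff i (⟨x, hx⟩ + ⟨y, hy⟩)).mpr fun h => ?_
  exact (hi.isCornerUnit_add h).elim k1 k2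

/-- If `r y` were invertible at `i`, then `i = r w` for some `w`. Taking powers gives `i = rⁿ (i
wⁿ)` for all `n`, so `i` lies in the intersection of the `𝔪ⁿ A`, which is zero. -/
theorem isCornerSingular_smul [IsLocalRing O] [IsNoetherianRing O] [Module.Finite O A] {i : A}
    (hi : IsIdempotentElem i) (hi0 : i ≠ 0) {r : O} (hr : r ∈ IsLocalRing.maximalIdeal O) (y : A) :
    IsCornerSingular O σ i (r • y) := by
  rintro ⟨z, -, hz, -⟩
  have h1 : i = r • (z * (i * y * i)) := by
    rw [← mul_smul_comm, ← smul_mul_assoc, ← mul_smul_comm, hz]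
  set w := z * (i * y * i)
  have hpow : ∀ n : ℕ, i = r ^ n • (i * w ^ n) := by
    intro n
    induction n with
    | zero => simp
    | succ n ih =>
      calc i = i * i := hi.eq.symm
        _ = (r ^ n • (i * w ^ n)) * (r • w) := by rw [← ih, ← h1]
        _ = r ^ (n + 1) • (i * w ^ (n + 1)) := by
          rw [smul_mul_smul_comm, pow_succ, mul_assoc, pow_succ w]
  have hH : IsHausdorff (IsLocalRing.maximalIdeal O) A := inferInstance
  refine hi0 (hH.haus _ fun n => ?_)
  rw [SModEq.zero, hpow n]
  exact Submodule.smul_mem_smul (Ideal.pow_mem_pow hr n) trivial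

theorem stabilizer_mk_eq {R : Subgroup H} {n : H} (hn : n ∈ Subgroup.normalizer (R : Set H)) :
    MulAction.stabilizer H (QuotientGroup.mk n : H ⧸ R) = R := by
  ext r
  rw [MulAction.mem_stabilizer_iff, MulAction.Quotient.smul_mk, eq_comm, QuotientGroup.eq,
    smul_eq_mul, ← mul_assoc]
  exact (Subgroup.mem_normalizer_iff''.mp hn r).symm

theorem conj_mem_fixedAlgebra {R : Subgroup H} {n : H} (hn : n ∈ Subgroup.normalizer (R : Set H)) {a : A}
    (ha : a ∈ fixedAlgebra O σ R) : conjRep O σ n a ∈ fixedAlgebra O σ R := by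
  rw [mem_fixedAlgebra_iff_mem_repFixed] at ha ⊢
  have h := apply_mem_repFixed_stabilizer (cosetFn_smul ha) (QuotientGroup.mk n : H ⧸ R)
  rwa [stabilizer_mk_eq hn, cosetFn_mk ha] at h

variable [Finite H]

theorem cosetSum_mem_fixedAlgebra {W : Subgroup H} {a : A} (ha : a ∈ fixedAlgebra O σ W) :
    cosetSum (conjRep O σ) W a ∈ fixedAlgebra O σ ⊤ := by
  rw [mem_fixedAlgebra_iff_mem_repFixed] at ha ⊢
  exact cosetSum_mem_repFixed ha

theorem mul_cosetSum {W : Subgroup H} {b : A} (hb : b ∈ fixedAlgebra O σ ⊤) (a : A) :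
    b * cosetSum (conjRep O σ) W a = cosetSum (conjRep O σ) W (b * a) := by
  rw [mem_fixedAlgebra_iff_mem_repFixed] at hb
  refine map_cosetSum (LinearMap.mulLeft O b) (fun h m => ?_) W a
  rw [LinearMap.mulLeft_apply, LinearMap.mulLeft_apply, conjRep_mul, hb h trivial]

theorem cosetSum_mul {W : Subgroup H} {b : A} (hb : b ∈ fixedAlgebra O σ ⊤) (a : A) :
    cosetSum (conjRep O σ) W a * b = cosetSum (conjRep O σ) W (a * b) := by
  rw [mem_fixedAlgebra_iff_mem_repFixed] at hb
  refine map_cosetSum (LinearMap.mulRight O b) (fun h m => ?_) W a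
  rw [LinearMap.mulRight_apply, LinearMap.mulRight_apply, conjRep_mul, hb h trivial]

theorem mul_cosetSum_subtype {R : Subgroup H} {T : Subgroup R} {b : A}
    (hb : b ∈ fixedAlgebra O σ R) (a : A) :
    b * cosetSum ((conjRep O σ).comp R.subtype) T a =
      cosetSum ((conjRep O σ).comp R.subtype) T (b * a) := by
  rw [mem_fixedAlgebra_iff_mem_repFixed] at hb
  refine map_cosetSum (LinearMap.mulLeft O b) (fun h m => ?_) T a
  rw [LinearMap.mulLeft_apply, LinearMap.mulLeft_apply, MonoidHom.comp_apply, conjRep_mul,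
    Subgroup.coe_subtype, hb h h.2]

theorem mul_mem_repBrauerKernel [IsLocalRing O] {R : Subgroup H} {b z : A}
    (hb : b ∈ fixedAlgebra O σ R) (hz : z ∈ repBrauerKernel ((conjRep O σ).comp R.subtype)) :
    z * b ∈ repBrauerKernel ((conjRep O σ).comp R.subtype) := by
  rw [mem_fixedAlgebra_iff_mem_repFixed] at hb
  refine map_mem_repBrauerKernel (MulEquiv.refl _) (LinearMap.mulRight O b) (fun h m => ?_) hz
  change conjRep O σ h m * b = conjRep O σ h (m * b)
  rw [conjRep_mul, hb h h.2]

/-- The element `x` is a relative trace from the subgroup `W`. -/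
def IsTraceFrom (O : Type*) {H A : Type*} [CommRing O] [Group H] [Ring A] [Algebra O A]
    (σ : H →* A) (W : Subgroup H) (x : A) : Prop :=
  ∃ a ∈ fixedAlgebra O σ W, cosetSum (conjRep O σ) W a = x

/-- `R` is a minimal subgroup from which `x` is a relative trace. -/
def IsVertex (O : Type*) {H A : Type*} [CommRing O] [Group H] [Ring A] [Algebra O A]
    (σ : H →* A) (R : Subgroup H) (x : A) : Prop :=
  IsTraceFrom O σ R x ∧ ∀ T : Subgroup H, IsTraceFrom O σ T x → Nat.card R ≤ Nat.card T

theorem exists_isVertex {x : A} (hx : x ∈ fixedAlgebra O σ ⊤) : ∃ R, IsVertex O σ R x := by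
  have h : ∃ R, IsTraceFrom O σ R x :=
    ⟨⊤, x, hx, cosetSum_top x (mem_fixedAlgebra_iff_mem_repFixed.mp hx)⟩
  obtain ⟨R, hR, hmin⟩ := (Set.toFinite {R | IsTraceFrom O σ R x}).exists_minimalFor
    (fun R : Subgroup H => Nat.card R) _ h
  refine ⟨R, hR, fun T hT => ?_⟩
  rcases le_total (Nat.card R) (Nat.card T) with h | h
  · exact h
  · exact hmin hT h

/-- The relative Brauer kernel at `R` of a primitive idempotent `i`: the largest left ideal of
the fixed points of `R` whose traces are singular at `i`. -/
noncomputable def singularSubmodule {i : fixedAlgebra O σ ⊤} (hi : IsLocalIdem i) (R : Subgroup H) :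
    Submodule O A where
  carrier := {x | x ∈ fixedAlgebra O σ R ∧ ∀ c ∈ fixedAlgebra O σ R,
    IsCornerSingular O σ (i : A) (cosetSum (conjRep O σ) R (c * x))}
  add_mem' := by
    rintro x y ⟨hx, hx'⟩ ⟨hy, hy'⟩
    refine ⟨add_mem hx hy, fun c hc => ?_⟩
    rw [mul_add, cosetSum_add]
    exact (hx' c hc).add hi (cosetSum_mem_fixedAlgebra (mul_mem hc hx))
      (cosetSum_mem_fixedAlgebra (mul_mem hc hy)) (hy' c hc)
  zero_mem' := by
    refine ⟨zero_mem _, fun c hc => ?_⟩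
    have h0 : cosetSum (conjRep O σ) R (c * 0) = 0 := by
      simpa using cosetSum_smul (τ := conjRep O σ) R (0 : O) (0 : A)
    rintro ⟨z, -, h1, -⟩
    rw [h0, mul_zero, zero_mul, mul_zero] at h1
    exact hi.2.1 (Subtype.ext h1.symm)
  smul_mem' := by
    rintro r x ⟨hx, hx'⟩
    refine ⟨Subalgebra.smul_mem _ hx r, fun c hc => ?_⟩
    rw [mul_smul_comm, ← smul_mul_assoc]
    exact hx' _ (Subalgebra.smul_mem _ hc r)

variable {i : fixedAlgebra O σ ⊤} {hi : IsLocalIdem i} {R : Subgroup H}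

theorem mul_mem_singularSubmodule {b x : A} (hb : b ∈ fixedAlgebra O σ R)
    (hx : x ∈ singularSubmodule hi R) : b * x ∈ singularSubmodule hi R :=
  ⟨mul_mem hb hx.1, fun c hc => by
    rw [← mul_assoc]
    exact hx.2 _ (mul_mem hc hb)⟩

/-- The coset `nR` also has stabilizer `R`, so the same transitive sum can be read as a trace from
this base point. -/
theorem cosetSum_conj {n : H} (hn : n ∈ Subgroup.normalizer (R : Set H)) {a : A}
    (ha : a ∈ fixedAlgebra O σ R) :
    cosetSum (conjRep O σ) R (conjRep O σ n a) = cosetSum (conjRep O σ) R a := by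
  have := Fintype.ofFinite (H ⧸ R)
  rw [mem_fixedAlgebra_iff_mem_repFixed] at ha
  have h := sum_eq_cosetSum_of_isPretransitive (cosetFn_smul ha) (QuotientGroup.mk n : H ⧸ R)
  rw [stabilizer_mk_eq hn, cosetFn_mk ha, ← cosetSum_eq_sum] at h
  exact h.symm

theorem conj_mem_singularSubmodule {n : H} (hn : n ∈ Subgroup.normalizer (R : Set H)) {x : A}
    (hx : x ∈ singularSubmodule hi R) : conjRep O σ n x ∈ singularSubmodule hi R := by
  refine ⟨conj_mem_fixedAlgebra hn hx.1, fun c hc => ?_⟩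
  have hc' := conj_mem_fixedAlgebra (inv_mem hn) hc
  have : c * conjRep O σ n x = conjRep O σ n (conjRep O σ n⁻¹ c * x) := by
    rw [conjRep_mul, ← Module.End.mul_apply, ← map_mul, mul_inv_cancel, map_one,
      Module.End.one_apply]
  rw [this, cosetSum_conj hn (mul_mem hc' hx.1)]
  exact hx.2 _ hc'

/-- Minimality of the vertex: a trace from a proper subgroup `T` of `R`, multiplied by `c` and
traced up to `H`, is a trace from `T`. If it were invertible at `i`, then `i` itself would be a
trace from `T`. -/
theorem repBrauerKernel_le_singularSubmodule [IsLocalRing O] [IsNoetherianRing O]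
    [Module.Finite O A] (hR : IsVertex O σ R (i : A)) :
    repBrauerKernel ((conjRep O σ).comp R.subtype) ≤ singularSubmodule hi R := by
  have hfix : repFixed ((conjRep O σ).comp R.subtype) ⊤ = repFixed (conjRep O σ) R := by
    rw [repFixed_comp_subtype, ← MonoidHom.range_eq_map, Subgroup.range_subtype]
  have hii : (i : A) * i = i := congrArg Subtype.val hi.1.eq
  refine sup_le (Submodule.smul_le.mpr fun r hr m hm => ?_) (Submodule.span_le.mpr ?_)
  · rw [hfix, ← mem_fixedAlgebra_iff_mem_repFixed] at hm
    refine ⟨Subalgebra.smul_mem _ hm r, fun c hc => ?_⟩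
    rw [mul_smul_comm, cosetSum_smul]
    exact isCornerSingular_smul hii (fun h => hi.2.1 (Subtype.ext h)) hr _
  · rintro _ ⟨T, hT, a, ha, rfl⟩
    have hmem := cosetSum_mem_repFixed ha
    rw [hfix, ← mem_fixedAlgebra_iff_mem_repFixed] at hmem
    refine ⟨hmem, fun c hc => ?_⟩
    rw [repFixed_comp_subtype] at ha
    have hle : T.map R.subtype ≤ R := Subgroup.map_subtype_le T
    have hca : c * a ∈ fixedAlgebra O σ (T.map R.subtype) :=
      mul_mem (fixedAlgebra_mono hle hc) (mem_fixedAlgebra_iff_mem_repFixed.mpr ha)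
    rw [mul_cosetSum_subtype hc, cosetSum_trans _ _ (mem_fixedAlgebra_iff_mem_repFixed.mp hca)]
    rintro ⟨z, hz, h1, -⟩
    have hi' := i.2
    rw [mul_cosetSum hi', cosetSum_mul hi', mul_cosetSum hz] at h1
    have h2 := hR.2 (T.map R.subtype) ⟨_, mul_mem (fixedAlgebra_mono le_top hz)
      (mul_mem (mul_mem (fixedAlgebra_mono le_top hi') hca) (fixedAlgebra_mono le_top hi')), h1⟩
    have h3 : T.map R.subtype = R := Subgroup.eq_of_le_of_card_ge hle h2
    refine hT ?_
    have := Subgroup.comap_map_eq_self_of_injective R.subtype_injective T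
    rw [← this, h3, eq_top_iff]
    exact fun x _ => x.2

/-- If `i` is the trace of `a`, then the trace of `a i` is `i`, which is invertible at `i`. -/
theorem self_notMem_singularSubmodule (hR : IsVertex O σ R (i : A)) :
    (i : A) ∉ singularSubmodule hi R := by
  rintro ⟨-, h⟩
  obtain ⟨a, ha, hai⟩ := hR.1
  have hii : (i : A) * i = i := congrArg Subtype.val hi.1.eq
  refine h a ha ⟨i, i.2, ?_, ?_⟩ <;>
  rw [← cosetSum_mul i.2, hai] <;> simp only [hii]

/-- Two primitive idempotents are equivalent if the second one is a trace from a subgroup that is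
not larger than a vertex `R` of the first one, and acts nontrivially modulo the singular elements. -/
theorem idemEquiv_of_mul_notMem [IsLocalRing O] [IsNoetherianRing O] [Module.Finite O A] (p : ℕ)
    [Fact p.Prime] [CharP (IsLocalRing.ResidueField O) p] (hp : IsPGroup p H)
    (hR : IsVertex O σ R (i : A)) {j : fixedAlgebra O σ ⊤} (hj : IsPrimitiveIdem j)
    {V : Subgroup H} (hV : IsTraceFrom O σ V (j : A)) (hVR : Nat.card V ≤ Nat.card R) {x : A}
    (hx : x ∈ fixedAlgebra O σ R) (hjx : (j : A) * x ∉ singularSubmodule hi R) : IdemEquiv i j := by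
  classical
  have hjj : (j : A) * j = j := congrArg Subtype.val hj.1.eq
  have hjR : (j : A) ∈ fixedAlgebra O σ R := fixedAlgebra_mono le_top j.2
  set K := singularSubmodule hi R with hK
  have hker : repBrauerKernel ((conjRep O σ).comp R.subtype) ≤ K :=
    repBrauerKernel_le_singularSubmodule hR
  let N := Subgroup.normalizer (R : Set H)
  let L : Submodule O A :=
    { carrier := {y | y ∈ fixedAlgebra O σ R ∧ (j : A) * y = y}
      add_mem' := fun {a b} ha hb => ⟨add_mem ha.1 hb.1, by rw [mul_add, ha.2, hb.2]⟩
      zero_mem' := ⟨zero_mem _, mul_zero _⟩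
      smul_mem' := fun r a ha => ⟨Subalgebra.smul_mem _ ha.1 r, by rw [mul_smul_comm, ha.2]⟩ }
  -- The normalizer of `R` acts on `j A^R` and on `K`, and `p` maps the former into `K`. Hence `j x`
  -- may be replaced by some `x0 = j x0` outside `K` that is fixed by the normalizer modulo `K`.
  obtain ⟨x0, ⟨hx0R, hjx0⟩, hx0K, hx0N⟩ := exists_fixed_mod (p := p) (hp.to_subgroup N)
    ((conjRep O σ).comp N.subtype) L K
    (fun n y hy => ⟨conj_mem_fixedAlgebra n.2 hy.1, by
      have hjn := (mem_fixedAlgebra_iff_mem_repFixed.mp j.2) n trivial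
      calc (j : A) * conjRep O σ n y = conjRep O σ n (j * y) := by rw [conjRep_mul, hjn]
        _ = conjRep O σ n y := by rw [hy.2]⟩)
    (fun n y hy => conj_mem_singularSubmodule n.2 hy)
    (fun y hy => hker (Submodule.mem_sup_left (Submodule.smul_mem_smul
      (natCast_mem_maximalIdeal O p) fun w _ =>
        mem_fixedAlgebra_iff_mem_repFixed.mp hy.1 w w.2)))
    (x := (j : A) * x) ⟨mul_mem hjR hx, by rw [← mul_assoc, hjj]⟩ hjx
  -- Mackey's formula modulo the Brauer kernel at `R`: only the cosets fixed by `R` contribute to a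
  -- trace.
  have hmackey : ∀ (V : Subgroup H) [Fintype (H ⧸ V)] (a : A), a ∈ fixedAlgebra O σ V →
      cosetSum (conjRep O σ) V a - ∑ c ∈ Finset.univ.filter (· ∈ MulAction.fixedPoints R (H ⧸ V)),
        cosetFn (conjRep O σ) V a c ∈ repBrauerKernel ((conjRep O σ).comp R.subtype) := by
    intro V _ a ha
    rw [cosetSum_eq_sum]
    exact sum_sub_sum_fixedPoints_mem (τ := (conjRep O σ).comp R.subtype) (H := R)
      (fun r c => cosetFn_smul (mem_fixedAlgebra_iff_mem_repFixed.mp ha) (r : H) c)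
  have := Fintype.ofFinite (H ⧸ V)
  have := Fintype.ofFinite (H ⧸ R)
  -- As `x0 = j x0` is not in `K`, the Mackey sum for `j` is nonempty and `R` fixes a coset of `V`.
  -- The stabilizer of that coset contains `R` and has the order of `V`, so it equals `R`; hence `j`
  -- is a trace from `R`.
  obtain ⟨a', ha', haj'⟩ : ∃ a ∈ fixedAlgebra O σ R, cosetSum (conjRep O σ) R a = j := by
    obtain ⟨a, ha, haj⟩ := hV
    have hm := hker (mul_mem_repBrauerKernel hx0R (hmackey V a ha))
    rw [haj, sub_mul, hjx0] at hm
    have hne : (MulAction.fixedPoints R (H ⧸ V)).Nonempty := by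
      rw [Set.nonempty_iff_ne_empty]
      intro hcon
      rw [hcon] at hm
      simp only [Set.mem_empty_iff_false, Finset.filter_false, Finset.sum_empty, zero_mul,
        sub_zero] at hm
      exact hx0K hm
    obtain ⟨c, hc⟩ := hne
    have ha' := mem_fixedAlgebra_iff_mem_repFixed.mp ha
    have hst : MulAction.stabilizer H c = R := by
      refine (Subgroup.eq_of_le_of_card_ge (fun r hr => hc ⟨r, hr⟩) ?_).symm
      have h1 := MulAction.index_stabilizer_of_transitive H c
      have h2 := (MulAction.stabilizer H c).card_mul_index
      rw [h1, ← V.card_mul_index, Subgroup.index] at h2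
      exact (Nat.eq_of_mul_eq_mul_right Nat.card_pos h2).trans_le hVR
    refine ⟨cosetFn (conjRep O σ) V a c, ?_, ?_⟩
    · rw [mem_fixedAlgebra_iff_mem_repFixed]
      have := apply_mem_repFixed_stabilizer (cosetFn_smul ha') c
      rwa [hst] at this
    · have := sum_eq_cosetSum_of_isPretransitive (cosetFn_smul ha') c
      rw [hst, ← cosetSum_eq_sum, haj] at this
      exact this.symm
  have hz : a' * x0 ∈ fixedAlgebra O σ R := mul_mem ha' hx0R
  have hm1 := hker (mul_mem_repBrauerKernel hx0R (hmackey R a' ha'))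
  rw [haj', sub_mul, hjx0, Finset.sum_mul] at hm1
  have hm2 := hker (hmackey R (a' * x0) hz)
  have hm3 : ∑ c ∈ Finset.univ.filter (· ∈ MulAction.fixedPoints R (H ⧸ R)),
        cosetFn (conjRep O σ) R a' c * x0 -
      ∑ c ∈ Finset.univ.filter (· ∈ MulAction.fixedPoints R (H ⧸ R)),
        cosetFn (conjRep O σ) R (a' * x0) c ∈ K := by
    rw [← Finset.sum_sub_distrib]
    refine Submodule.sum_mem _ fun c hc => ?_
    obtain ⟨n, rfl⟩ := QuotientGroup.mk_surjective c
    have hn : n ∈ Subgroup.normalizer (R : Set H) :=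
      Sylow.mem_fixedPoints_mul_left_cosets_iff_mem_normalizer.mp (Finset.mem_filter.mp hc).2
    rw [cosetFn_mk (mem_fixedAlgebra_iff_mem_repFixed.mp ha'),
      cosetFn_mk (mem_fixedAlgebra_iff_mem_repFixed.mp hz), conjRep_mul, ← mul_sub]
    refine mul_mem_singularSubmodule (conj_mem_fixedAlgebra hn ha') ?_
    rw [← neg_sub]
    exact Submodule.neg_mem _ (hx0N ⟨n, hn⟩)
  -- Mackey's formula for `j x0` has terms `ⁿa' x0`, and for the trace of `a' x0` it has terms `ⁿa'
  -- ⁿx0`. They agree modulo `K` by the choice of `x0`, so `x0` is congruent to an element of `A^H`.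
  have hm4 : x0 - cosetSum (conjRep O σ) R (a' * x0) ∈ K := by
    have := K.sub_mem (K.add_mem hm1 hm3) hm2
    rwa [sub_add_sub_cancel, sub_sub_sub_cancel_right] at this
  have hw : (j : A) * cosetSum (conjRep O σ) R (a' * x0) ∉ K := by
    intro h
    have h5 := mul_mem_singularSubmodule hjR hm4
    rw [mul_sub, hjx0] at h5
    have := K.add_mem h5 h
    rw [sub_add_cancel] at this
    exact hx0K this
  have hy := cosetSum_mem_fixedAlgebra hz
  -- By the definition of `K`, some trace of `c j y` is invertible at `i`, where `y` is the trace of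
  -- `a' x0`. As `j y` is fixed by `H`, it can be pulled out, which leaves an invertible composite
  -- from `i` through `j` to `i` inside `A^H`.
  have hex : ∃ c ∈ fixedAlgebra O σ R, ¬ IsCornerSingular O σ (i : A) (cosetSum (conjRep O σ) R
      (c * ((j : A) * cosetSum (conjRep O σ) R (a' * x0)))) := by
    by_contra hcon
    push Not at hcon
    exact hw ⟨mul_mem hjR (fixedAlgebra_mono le_top hy), hcon⟩
  obtain ⟨c, hc, hcs⟩ := hex
  rw [← cosetSum_mul (mul_mem j.2 hy), ← mul_assoc] at hcs
  have hb := cosetSum_mem_fixedAlgebra hc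
  have := (isCornerSingular_iff i (⟨_, hb⟩ * j * ⟨_, hy⟩)).not_left.mp hcs
  exact IsPrimitiveIdem.idemEquiv_of_isCornerUnit hi.1 hi.2.1 hj this

end Vertices

/-! ### Idempotents with equal multiplicities at local points. -/

section SameMultiplicities

variable {O A : Type*} [CommRing O] [Ring A] [Algebra O A]

theorem isIdempotentElem_mk {B : Subalgebra O A} {x : A} (hx : IsIdempotentElem x) (hB : x ∈ B) :
    IsIdempotentElem (⟨x, hB⟩ : B) :=
  Subtype.ext hx

theorem isIdempotentElem_coe {B : Subalgebra O A} {x : B} (hx : IsIdempotentElem x) :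
    IsIdempotentElem (x : A) :=
  congrArg Subtype.val hx

/-- The idempotents `e` and `f` have the same multiplicities at those points of `B` that are not
contained in `K`. -/
def SameMultiplicities (B : Subalgebra O A) (K : Submodule O A) (e f : A) : Prop :=
  ∃ (he : e ∈ B) (hf : f ∈ B), ∀ x : B, IsPrimitiveIdem x → (x : A) ∉ K →
    pointMultiplicity (pointOf x) ⟨e, he⟩ = pointMultiplicity (pointOf x) ⟨f, hf⟩

theorem SameMultiplicities.symm {B : Subalgebra O A} {K : Submodule O A} {e f : A}
    (h : SameMultiplicities B K e f) : SameMultiplicities B K f e := by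
  obtain ⟨he, hf, h⟩ := h
  exact ⟨hf, he, fun x hx hxK => (h x hx hxK).symm⟩

end SameMultiplicities

/-! ### Local multiplicities determine idempotents up to equivalence. -/

section LocalMultiplicities

variable {O H A : Type*} [CommRing O] [IsLocalRing O] [IsNoetherianRing O]
  [IsAdicComplete (IsLocalRing.maximalIdeal O) O] [Group H] [Ring A] [Algebra O A]
  [Module.Finite O A] {σ : H →* A}

theorem isSemiperfectRing_subalgebra (B : Subalgebra O A) : IsSemiperfectRing B := by
  have : IsNoetherian O A := isNoetherian_of_isNoetherianRing_of_finite O A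
  have : Module.Finite O B := Module.Finite.of_injective B.val.toLinearMap Subtype.val_injective
  exact isSemiperfectRing_of_finite O B

/-- Equivalent idempotents can be cancelled. -/
theorem SameMultiplicities.sub {B : Subalgebra O A} {K : Submodule O A} {e f i j : A}
    (h : SameMultiplicities B K e f) (he : IsIdempotentElem e) (hf : IsIdempotentElem f)
    (hi : IsIdempotentElem i) (hj : IsIdempotentElem j) (hiB : i ∈ B) (hjB : j ∈ B)
    (hij : IdemEquiv (⟨i, hiB⟩ : B) ⟨j, hjB⟩) (hei : e * i = i) (hie : i * e = i) (hfj : f * j = j)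
    (hjf : j * f = j) : SameMultiplicities B K (e - i) (f - j) := by
  have := isSemiperfectRing_subalgebra B
  obtain ⟨heB, hfB, h⟩ := h
  have aux : ∀ {e i : A} (heB : e ∈ B) (hiB : i ∈ B), IsIdempotentElem e → IsIdempotentElem i →
      e * i = i → i * e = i → ∀ x : B, IsPrimitiveIdem x →
      pointMultiplicity (pointOf x) ⟨e, heB⟩ =
        pointMultiplicity (pointOf x) ⟨e - i, sub_mem heB hiB⟩ +
        pointMultiplicity (pointOf x) ⟨i, hiB⟩ := by
    intro e i heB hiB he hi hei hie x hx
    rw [← (isPoint_pointOf hx).pointMultiplicity_add]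
    · congr 1
      exact Subtype.ext (sub_add_cancel e i).symm
    · refine Subtype.ext ?_
      change (e - i) * (e - i) = e - i
      rw [sub_mul, mul_sub, mul_sub, he.eq, hei, hie, hi.eq]; simp
    · exact Subtype.ext hi
    · refine Subtype.ext ?_
      change (e - i) * i = 0
      rw [sub_mul, hei, hi.eq, sub_self]
    · refine Subtype.ext ?_
      change i * (e - i) = 0
      rw [mul_sub, hie, hi.eq, sub_self]
  refine ⟨sub_mem heB hiB, sub_mem hfB hjB, fun x hx hxK => ?_⟩
  have h1 := h x hx hxK
  rw [aux heB hiB he hi hei hie x hx, aux hfB hjB hf hj hfj hjf x hx,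
    pointMultiplicity_congr (isPoint_pointOf hx) (isIdempotentElem_mk hi hiB)
      (isIdempotentElem_mk hj hjB) hij] at h1
  exact Nat.add_right_cancel h1

variable [Finite H]

/-- The maximal vertex of a decomposition of `e` also occurs in a decomposition of `f`. -/
theorem exists_idemEquiv_of_sameMultiplicities (p : ℕ) [Fact p.Prime]
    [CharP (IsLocalRing.ResidueField O) p] (hp : IsPGroup p H) {e f : fixedAlgebra O σ ⊤}
    {I J : Finset (fixedAlgebra O σ ⊤)} (hI : IsPrimitiveDecomposition I e)
    (hJ : IsPrimitiveDecomposition J f) {i : fixedAlgebra O σ ⊤} (hiI : i ∈ I) {R : Subgroup H}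
    (hR : IsVertex O σ R (i : A))
    (hmax : ∀ j ∈ J, ∃ V, IsVertex O σ V (j : A) ∧ Nat.card V ≤ Nat.card R)
    (h : SameMultiplicities (fixedAlgebra O σ R)
      (repBrauerKernel ((conjRep O σ).comp R.subtype)) (e : A) f) :
    ∃ j ∈ J, IdemEquiv i j := by
  classical
  have := isSemiperfectRing_subalgebra (fixedAlgebra O σ ⊤)
  have := isSemiperfectRing_subalgebra (fixedAlgebra O σ R)
  have hip := hI.1 i hiI
  have hi : IsLocalIdem i := IsSemiperfectRing.isLocalIdem i hip
  obtain ⟨heR, hfR, h⟩ := h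
  set K := singularSubmodule hi R with hK
  have hiK : (i : A) ∉ K := self_notMem_singularSubmodule hR
  have hiR : (i : A) ∈ fixedAlgebra O σ R := fixedAlgebra_mono le_top i.2
  have hker := repBrauerKernel_le_singularSubmodule (hi := hi) hR
  have heI : IsIdempotentElem (⟨e, heR⟩ : fixedAlgebra O σ R) :=
    isIdempotentElem_mk (isIdempotentElem_coe hI.isIdempotentElem) heR
  have hfJ : IsIdempotentElem (⟨f, hfR⟩ : fixedAlgebra O σ R) :=
    isIdempotentElem_mk (isIdempotentElem_coe hJ.isIdempotentElem) hfR
  obtain ⟨I', hI'⟩ := IsSemiperfectRing.exists_decomposition _ heI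
  obtain ⟨J', hJ'⟩ := IsSemiperfectRing.exists_decomposition _ hfJ
  -- Since `i = e i`, not every `x i` with `x` in the decomposition of `e` over `R` can lie in `K`.
  -- Such an `x` avoids the Brauer kernel, so its multiplicities in `e` and `f` agree.
  obtain ⟨x, hx, hxi⟩ : ∃ x ∈ I', (x : A) * i ∉ K := by
    by_contra hcon
    push Not at hcon
    refine hiK ?_
    have h1 : (i : A) = ∑ x ∈ I', (x : A) * i := by
      have h2 : ∑ x ∈ I', (x : A) = e := by
        have := congrArg Subtype.val hI'.2.2
        rwa [AddSubmonoidClass.coe_finsetSum] at this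
      rw [← Finset.sum_mul, h2]
      exact (congrArg Subtype.val (hI.mul_left hiI)).symm
    rw [h1]
    exact Submodule.sum_mem _ hcon
  have hxp := hI'.1 x hx
  have hxker : (x : A) ∉ repBrauerKernel ((conjRep O σ).comp R.subtype) := fun hxk =>
    hxi (hker (mul_mem_repBrauerKernel hiR hxk))
  have hm := h x hxp hxker
  rw [(isPoint_pointOf hxp).pointMultiplicity_eq (mem_pointOf x) hI',
    (isPoint_pointOf hxp).pointMultiplicity_eq (mem_pointOf x) hJ'] at hm
  obtain ⟨y, hy, hxy⟩ := exists_mem_idemEquiv hI' hx hm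
  obtain ⟨a, b, h1, h2, h3, h4, h5, h6⟩ := hxy.exists_normalized hxp.1 (hJ'.1 y hy).1
  have hby : ((b : A) * i) ∉ K := by
    intro hcon
    refine hxi ?_
    have := mul_mem_singularSubmodule a.2 hcon
    rwa [← mul_assoc, show (a : A) * b = x from congrArg Subtype.val h1] at this
  have hfb : (f : A) * b = b := by
    have e1 : (⟨f, hfR⟩ : fixedAlgebra O σ R) * b = b := by
      rw [← h5, ← mul_assoc, hJ'.mul_left hy]
    exact congrArg Subtype.val e1
  -- The equivalence of `x` with a member `y` of the decomposition of `f` over `R` moves `x i` to `b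
  -- i`, which lies below `f` and outside `K`. Decomposing `f` in `A^H` then singles out `j`.
  obtain ⟨j, hj, hjK⟩ : ∃ j ∈ J, (j : A) * ((b : A) * i) ∉ K := by
    by_contra hcon
    push Not at hcon
    refine hby ?_
    have h2 : ∑ j ∈ J, (j : A) = f := by
      have := congrArg Subtype.val hJ.2.2
      rwa [AddSubmonoidClass.coe_finsetSum] at this
    rw [← hfb, mul_assoc, ← h2, Finset.sum_mul]
    exact Submodule.sum_mem _ hcon
  obtain ⟨V, hV, hVR⟩ := hmax j hj
  exact ⟨j, hj, idemEquiv_of_mul_notMem p hp hR (hJ.1 j hj) hV.1 hVR (mul_mem b.2 hiR) hjK⟩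

/-- Idempotents that are fixed by a finite `p`-group `H` are equivalent as such if their
multiplicities at the local points of all subgroups of `H` agree. -/
theorem idemEquiv_of_sameMultiplicities (p : ℕ) [Fact p.Prime]
    [CharP (IsLocalRing.ResidueField O) p] (hp : IsPGroup p H) {e f : fixedAlgebra O σ ⊤}
    (he : IsIdempotentElem e) (hf : IsIdempotentElem f)
    (h : ∀ R : Subgroup H, SameMultiplicities (fixedAlgebra O σ R)
      (repBrauerKernel ((conjRep O σ).comp R.subtype)) (e : A) f) : IdemEquiv e f := by
  classical
  have := isSemiperfectRing_subalgebra (fixedAlgebra O σ ⊤)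
  obtain ⟨I, hI⟩ := IsSemiperfectRing.exists_decomposition e he
  obtain ⟨J, hJ⟩ := IsSemiperfectRing.exists_decomposition f hf
  clear he hf
  induction hn : I.card generalizing I J e f with
  | zero =>
    rw [Finset.card_eq_zero] at hn
    subst hn
    have hJ0 : J = ∅ := by
      by_contra hne
      choose! V hV using fun x : fixedAlgebra O σ ⊤ => exists_isVertex (O := O) (σ := σ) x.2
      obtain ⟨j, hj, -⟩ := Finset.exists_max_image J (fun x => Nat.card (V x))
        (Finset.nonempty_iff_ne_empty.mpr hne)
      obtain ⟨i, hi, -⟩ := exists_idemEquiv_of_sameMultiplicities p hp hJ hI hj (hV j)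
        (by simp) (h (V j)).symm
      simp at hi
    subst hJ0
    rw [← hI.2.2, ← hJ.2.2]
    exact ⟨0, 0, by simp, by simp⟩
  | succ n ih =>
    have hexists : ∃ i ∈ I, ∃ j ∈ J, IdemEquiv i j := by
      choose! V hV using fun x : fixedAlgebra O σ ⊤ => exists_isVertex (O := O) (σ := σ) x.2
      -- A vertex of largest order among both decompositions is chosen, so that the bound on
      -- vertices holds whichever side `k` belongs to.
      obtain ⟨k, hk, hmax⟩ := Finset.exists_max_image (I ∪ J) (fun x => Nat.card (V x))
        ((Finset.card_pos.mp (by omega)).mono Finset.subset_union_left)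
      rcases Finset.mem_union.mp hk with hk | hk
      · obtain ⟨j, hj, hkj⟩ := exists_idemEquiv_of_sameMultiplicities p hp hI hJ hk (hV k)
          (fun j hj => ⟨V j, hV j, hmax j (Finset.mem_union_right _ hj)⟩) (h (V k))
        exact ⟨k, hk, j, hj, hkj⟩
      · obtain ⟨i, hi, hki⟩ := exists_idemEquiv_of_sameMultiplicities p hp hJ hI hk (hV k)
          (fun j hj => ⟨V j, hV j, hmax j (Finset.mem_union_left _ hj)⟩) (h (V k)).symm
        exact ⟨i, hi, k, hk, hki.symm⟩
    obtain ⟨i, hi, j, hj, hij⟩ := hexists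
    have hip := hI.1 i hi
    have hjp := hJ.1 j hj
    have hsub : IdemEquiv (e - i) (f - j) := by
      refine ih (fun R => ?_) (I.erase i) (hI.erase hi) (J.erase j) (hJ.erase hj)
        (by rw [Finset.card_erase_of_mem hi, hn]; rfl)
      have v : ∀ {a b : fixedAlgebra O σ ⊤}, a = b → (a : A) = b := fun h => congrArg _ h
      refine (h R).sub (v hI.isIdempotentElem) (v hJ.isIdempotentElem) (v hip.1) (v hjp.1)
        (fixedAlgebra_mono le_top i.2) (fixedAlgebra_mono le_top j.2) ?_ (v (hI.mul_left hi))
        (v (hI.mul_right hi)) (v (hJ.mul_left hj)) (v (hJ.mul_right hj))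
      obtain ⟨a, b, h1, h2⟩ := hij
      exact ⟨⟨a, fixedAlgebra_mono le_top a.2⟩, ⟨b, fixedAlgebra_mono le_top b.2⟩,
        Subtype.ext (v h1), Subtype.ext (v h2)⟩
    have hs := hsub.add hij (hI.erase hi).isIdempotentElem (hJ.erase hj).isIdempotentElem
      hip.1 hjp.1 (by rw [sub_mul, hI.mul_left hi, hip.1.eq, sub_self])
      (by rw [mul_sub, hI.mul_right hi, hip.1.eq, sub_self])
      (by rw [sub_mul, hJ.mul_left hj, hjp.1.eq, sub_self])
      (by rw [mul_sub, hJ.mul_right hj, hjp.1.eq, sub_self])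
    simpa using hs

end LocalMultiplicities

/-! ### Comparing decompositions with bounded multiplicities. -/

section SubDecomposition

variable {R : Type*} [Ring R]

theorem exists_mem_of_idemCount_pos {I : Finset R} {x : R} (h : 0 < idemCount I x) :
    ∃ i ∈ I, IdemEquiv x i := by
  classical
  unfold idemCount at h
  obtain ⟨i, hi⟩ := Finset.card_pos.mp h
  exact ⟨i, (Finset.mem_filter.mp hi).1, (Finset.mem_filter.mp hi).2⟩

/-- A decomposition whose multiplicities are bounded by those of a second one is equivalent to a
part of the latter. -/
theorem exists_subset_idemCount_eq {I D : Finset R} (hI : ∀ i ∈ I, IsPrimitiveIdem i)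
    (hD : ∀ d ∈ D, IsPrimitiveIdem d)
    (h : ∀ x : R, IsPrimitiveIdem x → idemCount I x ≤ idemCount D x) :
    ∃ D' ⊆ D, ∀ x : R, IsPrimitiveIdem x → idemCount I x = idemCount D' x := by
  classical
  induction hn : I.card generalizing I D with
  | zero =>
    rw [Finset.card_eq_zero] at hn
    subst hn
    exact ⟨∅, by simp, fun _ _ => rfl⟩
  | succ n ih =>
    obtain ⟨i, hi⟩ := Finset.card_pos.mp (show 0 < I.card by omega)
    have hip := hI i hi
    have h1 := h i hip
    rw [idemCount_erase hi, if_pos (IdemEquiv.refl hip.1)] at h1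
    obtain ⟨d, hd, hid⟩ := exists_mem_of_idemCount_pos (show 0 < idemCount D i by omega)
    have hdp := hD d hd
    have key : ∀ x, IsPrimitiveIdem x → (IdemEquiv x i ↔ IdemEquiv x d) := fun x hx =>
      ⟨fun k => k.trans hid hx.1 hip.1 hdp.1, fun k => k.trans hid.symm hx.1 hdp.1 hip.1⟩
    obtain ⟨D', hD', hcount⟩ := ih (I := I.erase i) (D := D.erase d)
      (fun j hj => hI j (Finset.mem_of_mem_erase hj)) (fun j hj => hD j (Finset.mem_of_mem_erase hj))
      (fun x hx => by
        have := h x hx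
        rw [idemCount_erase hi, idemCount_erase hd, if_congr (key x hx) rfl rfl] at this
        omega)
      (by rw [Finset.card_erase_of_mem hi, hn]; rfl)
    have hdD' : d ∉ D' := fun h => Finset.notMem_erase d D (hD' h)
    refine ⟨insert d D', Finset.insert_subset hd (hD'.trans (Finset.erase_subset _ _)),
      fun x hx => ?_⟩
    rw [idemCount_erase hi, idemCount_erase (Finset.mem_insert_self d D'),
      Finset.erase_insert hdD', hcount x hx, if_congr (key x hx) rfl rfl]

end SubDecomposition

/-! ### Summands of permutation modules of `p`-groups. -/

section OrbitProjection

variable {O H M : Type*} [CommRing O] [Group H] [AddCommGroup M]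
  [Module O M] {τ : H →* Module.End O M} {X : Type*} [MulAction H X]

theorem repr_apply_smul (b : Module.Basis X O M) (hb : ∀ (h : H) (x : X), τ h (b x) = b (h • x))
    (h : H) (x : X) (m : M) : b.repr (τ h m) (h • x) = b.repr m x := by
  classical
  have : (b.coord (h • x)).comp (τ h) = b.coord x := by
    refine b.ext fun y => ?_
    simp only [LinearMap.comp_apply, hb, Module.Basis.coord_apply, Module.Basis.repr_self,
      Finsupp.single_apply, smul_left_cancel_iff]
  exact LinearMap.congr_fun this m

open Classical in
/-- The projection of a permutation module onto the span of an orbit. -/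
noncomputable def orbitProj (b : Module.Basis X O M) (q : MulAction.orbitRel.Quotient H X) :
    Module.End O M :=
  b.constr ℕ fun x => if (Quotient.mk _ x : MulAction.orbitRel.Quotient H X) = q then b x else 0

open Classical in
theorem orbitProj_basis (b : Module.Basis X O M) (q : MulAction.orbitRel.Quotient H X) (x : X) :
    orbitProj b q (b x) =
      if (Quotient.mk _ x : MulAction.orbitRel.Quotient H X) = q then b x else 0 :=
  b.constr_basis ..

open Classical in
theorem repr_orbitProj (b : Module.Basis X O M) (q : MulAction.orbitRel.Quotient H X) (x : X)
    (m : M) : b.repr (orbitProj b q m) x =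
      if (Quotient.mk _ x : MulAction.orbitRel.Quotient H X) = q then b.repr m x else 0 := by
  have : (b.coord x).comp (orbitProj b q) =
      if (Quotient.mk _ x : MulAction.orbitRel.Quotient H X) = q then b.coord x else 0 := by
    refine b.ext fun y => ?_
    rw [LinearMap.comp_apply, orbitProj_basis]
    by_cases hxy : y = x
    · subst hxy
      split_ifs <;> simp
    · split_ifs <;> simp [hxy]
  have h2 := LinearMap.congr_fun this m
  rw [LinearMap.comp_apply, Module.Basis.coord_apply] at h2
  rw [h2]
  split_ifs <;> simp

theorem quotient_mk_smul (h : H) (x : X) :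
    (Quotient.mk _ (h • x) : MulAction.orbitRel.Quotient H X) = Quotient.mk _ x :=
  Quotient.sound ⟨h, rfl⟩

theorem mem_centralizer_range_iff {f : Module.End O M} :
    f ∈ Subalgebra.centralizer O (Set.range τ) ↔ ∀ h m, τ h (f m) = f (τ h m) := by
  rw [Subalgebra.mem_centralizer_iff, Set.forall_mem_range]
  exact forall_congr' fun h => LinearMap.ext_iff

theorem orbitProj_mem (b : Module.Basis X O M) (hb : ∀ (h : H) (x : X), τ h (b x) = b (h • x))
    (q : MulAction.orbitRel.Quotient H X) :
    orbitProj b q ∈ Subalgebra.centralizer O (Set.range τ) := by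
  classical
  refine mem_centralizer_range_iff.mpr fun h => LinearMap.congr_fun (f := (τ h).comp (orbitProj b q))
    (g := (orbitProj b q).comp (τ h)) (b.ext fun x => ?_)
  rw [LinearMap.comp_apply, LinearMap.comp_apply, hb, orbitProj_basis, orbitProj_basis,
    quotient_mk_smul]
  split_ifs
  · exact hb h x
  · exact map_zero _

theorem orbitProj_mul_self (b : Module.Basis X O M) (q : MulAction.orbitRel.Quotient H X) :
    orbitProj b q * orbitProj b q = orbitProj b q := by
  classical
  refine b.ext fun x => ?_
  rw [Module.End.mul_apply, orbitProj_basis]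
  split_ifs with h
  · rw [orbitProj_basis, if_pos h]
  · exact map_zero _

theorem orbitProj_mul_of_ne (b : Module.Basis X O M) {q r : MulAction.orbitRel.Quotient H X}
    (h : q ≠ r) : orbitProj b q * orbitProj b r = 0 := by
  classical
  refine b.ext fun x => ?_
  rw [Module.End.mul_apply, orbitProj_basis]
  split_ifs with h1
  · rw [orbitProj_basis, if_neg fun h2 => h (h2.symm.trans h1), LinearMap.zero_apply]
  · exact map_zero _

theorem orbitProj_ne_zero [Nontrivial O] (b : Module.Basis X O M)
    (q : MulAction.orbitRel.Quotient H X) : orbitProj b q ≠ 0 := by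
  classical
  obtain ⟨x, rfl⟩ := Quotient.exists_rep q
  intro h
  have h1 := orbitProj_basis b (Quotient.mk _ x : MulAction.orbitRel.Quotient H X) x
  rw [h, if_pos rfl, LinearMap.zero_apply] at h1
  exact b.ne_zero x h1.symm

variable [Finite H] [Finite X] [IsLocalRing O]

theorem mem_maximalIdeal_smul_top_iff (b : Module.Basis X O M) {m : M} :
    m ∈ IsLocalRing.maximalIdeal O • (⊤ : Submodule O M) ↔
      ∀ x, b.repr m x ∈ IsLocalRing.maximalIdeal O := by
  have := Fintype.ofFinite X
  constructor
  · intro hm x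
    have : IsLocalRing.maximalIdeal O • (⊤ : Submodule O M) ≤
        Submodule.comap (b.coord x) (IsLocalRing.maximalIdeal O : Submodule O O) := by
      refine Submodule.smul_le.mpr fun r hr m _ => ?_
      rw [Submodule.mem_comap, map_smul]
      exact Ideal.mul_mem_right _ _ hr
    exact this hm
  · intro h
    rw [← b.sum_repr m]
    exact Submodule.sum_mem _ fun x _ => Submodule.smul_mem_smul (h x) trivial

open Classical in
/-- A nonzero idempotent endomorphism of the permutation module of an orbit of a `p`-group fixes
the sum over the orbit. -/
theorem apply_orbitSum_of_isIdempotentElem [Fintype X] (p : ℕ) [Fact p.Prime]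
    [CharP (IsLocalRing.ResidueField O) p] (hp : IsPGroup p H) (b : Module.Basis X O M)
    (hb : ∀ (h : H) (x : X), τ h (b x) = b (h • x)) (q : MulAction.orbitRel.Quotient H X)
    {f : Module.End O M} (hf : f ∈ Subalgebra.centralizer O (Set.range τ)) (hff : f * f = f)
    (hqf : orbitProj b q * f = f) (hf0 : f ≠ 0) :
    f (∑ x ∈ Finset.univ.filter
        (fun x => (Quotient.mk _ x : MulAction.orbitRel.Quotient H X) = q), b x) =
      ∑ x ∈ Finset.univ.filter
        (fun x => (Quotient.mk _ x : MulAction.orbitRel.Quotient H X) = q), b x := by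
  set N := ∑ x ∈ Finset.univ.filter
        (fun x => (Quotient.mk _ x : MulAction.orbitRel.Quotient H X) = q), b x with hN
  have hfm : ∀ m, f (f m) = f m := fun m => LinearMap.congr_fun hff m
  rw [mem_centralizer_range_iff] at hf
  have hfin : Module.Finite O M := Module.Finite.of_basis b
  set 𝔪 := IsLocalRing.maximalIdeal O
  have hNrepr : ∀ x, b.repr N x =
      if (Quotient.mk _ x : MulAction.orbitRel.Quotient H X) = q then 1 else 0 := by
    intro x
    rw [hN, map_sum, Finsupp.finsetSum_apply]
    simp only [Module.Basis.repr_self, Finsupp.single_apply]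
    rw [Finset.sum_ite_eq']
    simp
  obtain ⟨x0, hx0⟩ := Quotient.exists_rep q
  have hoff : ∀ m x, (Quotient.mk _ x : MulAction.orbitRel.Quotient H X) ≠ q →
      b.repr (f m) x = 0 := by
    intro m x hx
    rw [← hqf, Module.End.mul_apply, repr_orbitProj, if_neg hx]
  have horb : ∀ x, (Quotient.mk _ x : MulAction.orbitRel.Quotient H X) = q → ∃ h : H, h • x0 = x := by
    intro x hx
    obtain ⟨h, hh⟩ := Quotient.exact (hx.trans hx0.symm)
    exact ⟨h, hh⟩
  have hfix : ∀ h, τ h N = N := by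
    intro h
    refine b.repr.injective (Finsupp.ext fun x => ?_)
    have := repr_apply_smul b hb h (h⁻¹ • x) N
    rw [smul_inv_smul] at this
    rw [this, hNrepr, hNrepr, quotient_mk_smul]
  -- `f N` is an invariant vector supported on one orbit, so all of its coordinates there coincide.
  -- The scalar `c` is then idempotent, and it remains to see that it is a unit.
  obtain ⟨c, hc⟩ : ∃ c : O, f N = c • N := by
    refine ⟨b.repr (f N) x0, b.repr.injective (Finsupp.ext fun x => ?_)⟩
    rw [map_smul, Finsupp.smul_apply, hNrepr]
    split_ifs with hx
    · obtain ⟨h, rfl⟩ := horb x hx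
      rw [smul_eq_mul, mul_one, ← repr_apply_smul b hb h x0, hf, hfix]
    · rw [hoff _ _ hx, smul_zero]
  have hN0 : b.repr N x0 = 1 := by rw [hNrepr, if_pos hx0]
  have hcc : c * c = c := by
    have h1 := hfm N
    rw [hc, map_smul, hc, smul_smul] at h1
    have h2 := congrArg (fun m => b.repr m x0) h1
    simpa [hN0] using h2
  -- Nakayama's lemma: otherwise the image `L` of `f` would satisfy `L ≤ 𝔪 L`, because `f` is the
  -- identity on `L`.
  have hL : ¬ LinearMap.range f ≤ 𝔪 • (⊤ : Submodule O M) := by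
    intro hle
    refine hf0 (LinearMap.range_eq_bot.mp ?_)
    refine Submodule.eq_bot_of_le_smul_of_le_jacobson_bot 𝔪 _ ?_ ?_
      (IsLocalRing.maximalIdeal_le_jacobson ⊥)
    · have : Module.Finite O (LinearMap.range f) := Module.Finite.range f
      exact Module.Finite.iff_fg.mp this
    · rintro _ ⟨m, rfl⟩
      rw [← hfm m]
      have h1 := Submodule.mem_map_of_mem (f := f) (hle ⟨m, rfl⟩)
      rwa [Submodule.map_smul'', Submodule.map_top] at h1
  obtain ⟨x, hxL, hxK⟩ := SetLike.not_le_iff_exists.mp hL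
  have hKstab : ∀ n, ∀ x ∈ 𝔪 • (⊤ : Submodule O M), τ n x ∈ 𝔪 • (⊤ : Submodule O M) := by
    intro n x hx
    have h1 := Submodule.mem_map_of_mem (f := τ n) hx
    rw [Submodule.map_smul''] at h1
    exact Submodule.smul_mono le_rfl le_top h1
  -- A vector of the image that is invariant modulo `𝔪` but not zero there must be congruent to `r
  -- N` with `r` a unit. Applying `f` gives `r N ≡ r c N`, so `1 - c` lies in `𝔪`.
  obtain ⟨y, ⟨w, rfl⟩, hyK, hy⟩ := exists_fixed_mod hp τ (LinearMap.range f) (𝔪 • ⊤)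
    (by rintro n _ ⟨m, rfl⟩; exact ⟨τ n m, (hf n m).symm⟩) hKstab
    (fun x _ => Submodule.smul_mem_smul (natCast_mem_maximalIdeal O p) trivial) hxL hxK
  set r := b.repr (f w) x0 with hr
  have hyN : f w - r • N ∈ 𝔪 • (⊤ : Submodule O M) := by
    rw [mem_maximalIdeal_smul_top_iff b]
    intro x
    rw [map_sub, map_smul, Finsupp.sub_apply, Finsupp.smul_apply, hNrepr]
    split_ifs with hx
    · obtain ⟨h, rfl⟩ := horb x hx
      have h1 := (mem_maximalIdeal_smul_top_iff b).mp (hy h) (h • x0)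
      rw [map_sub, Finsupp.sub_apply, repr_apply_smul b hb] at h1
      rw [smul_eq_mul, mul_one, ← neg_sub]
      exact neg_mem h1
    · rw [hoff _ _ hx]
      simp
  have hru : IsUnit r := by
    by_contra hru
    refine hyK ?_
    rw [← sub_add_cancel (f w) (r • N)]
    exact add_mem hyN (Submodule.smul_mem_smul ((IsLocalRing.mem_maximalIdeal r).mpr hru) trivial)
  have h1 : f w - r • c • N ∈ 𝔪 • (⊤ : Submodule O M) := by
    have h2 := Submodule.mem_map_of_mem (f := f) hyN
    rw [Submodule.map_smul'', map_sub, map_smul, hc, hfm] at h2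
    exact Submodule.smul_mono le_rfl le_top h2
  have h3 := (mem_maximalIdeal_smul_top_iff b).mp (sub_mem h1 hyN) x0
  have h4 : r * (1 - c) ∈ 𝔪 := by
    have : b.repr (f w - r • c • N - (f w - r • N)) x0 = r * (1 - c) := by
      simp only [map_sub, map_smul, Finsupp.sub_apply, Finsupp.smul_apply, hN0, smul_eq_mul]
      ring
    rwa [this] at h3
  have h5 : 1 - c ∈ 𝔪 := (Ideal.unit_mul_mem_iff_mem 𝔪 hru).mp h4
  have hcu : IsUnit c := by
    by_contra hcu
    have := add_mem h5 ((IsLocalRing.mem_maximalIdeal c).mpr hcu)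
    rw [sub_add_cancel] at this
    exact (Ideal.ne_top_iff_one _).mp (IsLocalRing.maximalIdeal.isMaximal O).ne_top this
  rw [hc, hcu.mul_left_cancel (hcc.trans (mul_one c).symm), one_smul]

/-- Permutation modules of transitive actions of `p`-groups are indecomposable. -/
theorem isPrimitiveIdem_orbitProj (p : ℕ) [Fact p.Prime]
    [CharP (IsLocalRing.ResidueField O) p] (hp : IsPGroup p H) (b : Module.Basis X O M)
    (hb : ∀ (h : H) (x : X), τ h (b x) = b (h • x)) (q : MulAction.orbitRel.Quotient H X) :
    IsPrimitiveIdem (⟨orbitProj b q, orbitProj_mem b hb q⟩ :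
      Subalgebra.centralizer O (Set.range τ)) := by
  classical
  have := Fintype.ofFinite X
  refine ⟨Subtype.ext (orbitProj_mul_self b q), fun h => orbitProj_ne_zero b q
    (congrArg Subtype.val h), fun f g hf hg hfg hgf h => ?_⟩
  by_contra! hcon
  have hqf : orbitProj b q * f = f := by
    have : (⟨orbitProj b q, orbitProj_mem b hb q⟩ : Subalgebra.centralizer O (Set.range τ)) * f = f := by
      rw [h, add_mul, hf.eq, hgf, add_zero]
    exact congrArg Subtype.val this
  have hqg : orbitProj b q * g = g := by
    have : (⟨orbitProj b q, orbitProj_mem b hb q⟩ : Subalgebra.centralizer O (Set.range τ)) * g = g := by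
      rw [h, add_mul, hg.eq, hfg, zero_add]
    exact congrArg Subtype.val this
  -- In a proper splitting both summands would fix the orbit sum `N`, and so does their sum. Then `N
  -- + N = N`, although `N` has a coordinate equal to `1`.
  have h1 := apply_orbitSum_of_isIdempotentElem p hp b hb q f.2 (congrArg Subtype.val hf.eq) hqf
    (fun h0 => hcon.1 (Subtype.ext h0))
  have h2 := apply_orbitSum_of_isIdempotentElem p hp b hb q g.2 (congrArg Subtype.val hg.eq) hqg
    (fun h0 => hcon.2 (Subtype.ext h0))
  have h3 : orbitProj b q = (f : Module.End O M) + g := congrArg Subtype.val h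
  set N := ∑ x ∈ Finset.univ.filter
        (fun x => (Quotient.mk _ x : MulAction.orbitRel.Quotient H X) = q), b x with hN
  have h4 : orbitProj b q N = N := by
    rw [hN, map_sum]
    refine Finset.sum_congr rfl fun x hx => ?_
    rw [orbitProj_basis, if_pos (Finset.mem_filter.mp hx).2]
  rw [h3, LinearMap.add_apply, h1, h2, add_eq_left] at h4
  obtain ⟨x, rfl⟩ := Quotient.exists_rep q
  have h5 : b.repr N x = 1 := by
    rw [hN, map_sum, Finsupp.finsetSum_apply]
    simp only [Module.Basis.repr_self, Finsupp.single_apply]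
    rw [Finset.sum_ite_eq']
    simp
  rw [h4] at h5
  simp at h5

/-- Direct summands of permutation modules of `p`-groups are permutation modules. -/
theorem exists_basis_range_of_isIdempotentElem [IsNoetherianRing O]
    [IsAdicComplete (IsLocalRing.maximalIdeal O) O] (p : ℕ) [Fact p.Prime]
    [CharP (IsLocalRing.ResidueField O) p] (hp : IsPGroup p H) (b : Module.Basis X O M)
    (hb : ∀ (h : H) (x : X), τ h (b x) = b (h • x)) {π : Module.End O M}
    (hπ : ∀ h m, τ h (π m) = π (τ h m)) (hππ : π * π = π) :
    ∃ (X' : Set X) (a : Module.End O M), (∀ h m, τ h (a m) = a (τ h m)) ∧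
      (∀ (h : H), ∀ x ∈ X', h • x ∈ X') ∧ LinearIndepOn O (fun x => a (b x)) X' ∧
      Submodule.span O ((fun x => a (b x)) '' X') = LinearMap.range π := by
  classical
  have := Fintype.ofFinite X
  have : Module.Finite O M := Module.Finite.of_basis b
  have := Module.Free.of_basis b
  set E := Subalgebra.centralizer O (Set.range τ) with hE
  have := isSemiperfectRing_subalgebra E
  have := Fintype.ofFinite (MulAction.orbitRel.Quotient H X)
  let e : MulAction.orbitRel.Quotient H X → E := fun q => ⟨orbitProj b q, orbitProj_mem b hb q⟩
  have heprim : ∀ q, IsPrimitiveIdem (e q) := isPrimitiveIdem_orbitProj p hp b hb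
  have heorth : ∀ q r, q ≠ r → e q * e r = 0 := fun q r h => Subtype.ext (orbitProj_mul_of_ne b h)
  have heinj : Function.Injective e := by
    intro q r h
    by_contra hne
    have := heorth q r hne
    rw [← h, (heprim q).1.eq] at this
    exact (heprim q).2.1 this
  have heapp : ∀ q x, (e q : Module.End O M) (b x) =
      if e q = e (Quotient.mk _ x) then b x else 0 := by
    intro q x
    rw [if_congr heinj.eq_iff rfl rfl, if_congr eq_comm rfl rfl]
    exact orbitProj_basis b q x
  set D : Finset E := Finset.univ.image e with hD
  have hsum : ∀ D' ⊆ D, ∀ x, ((∑ d ∈ D', d : E) : Module.End O M) (b x) =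
      if e (Quotient.mk _ x) ∈ D' then b x else 0 := by
    intro D' hD' x
    rw [AddSubmonoidClass.coe_finsetSum, LinearMap.sum_apply,
      Finset.sum_congr rfl (g := fun d => if d = e (Quotient.mk _ x) then b x else 0),
      Finset.sum_ite_eq']
    intro d hd
    obtain ⟨q, -, rfl⟩ := Finset.mem_image.mp (hD' hd)
    exact heapp q x
  have hDprim : ∀ d ∈ D, IsPrimitiveIdem d := by
    intro d hd
    obtain ⟨q, -, rfl⟩ := Finset.mem_image.mp hd
    exact heprim q
  have hDorth : ∀ d ∈ D, ∀ d' ∈ D, d ≠ d' → d * d' = 0 := by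
    intro d hd d' hd' hne
    obtain ⟨q, -, rfl⟩ := Finset.mem_image.mp hd
    obtain ⟨r, -, rfl⟩ := Finset.mem_image.mp hd'
    exact heorth q r fun h => hne (congrArg e h)
  have hDdec : IsPrimitiveDecomposition D 1 := by
    refine ⟨hDprim, hDorth, Subtype.ext (b.ext fun x => ?_)⟩
    rw [hsum D subset_rfl, if_pos (Finset.mem_image_of_mem e (Finset.mem_univ _))]
    rfl
  let ϖ : E := ⟨π, mem_centralizer_range_iff.mpr hπ⟩
  have hϖ : IsIdempotentElem ϖ := Subtype.ext hππ
  obtain ⟨I, hI⟩ := IsSemiperfectRing.exists_decomposition ϖ hϖ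
  obtain ⟨J, hJ⟩ := IsSemiperfectRing.exists_decomposition (1 - ϖ) hϖ.one_sub
  have hIJ := hI.union hJ (by rw [mul_sub, mul_one, hϖ.eq, sub_self])
    (by rw [sub_mul, one_mul, hϖ.eq, sub_self])
  have hdisj := hI.disjoint hJ (by rw [mul_sub, mul_one, hϖ.eq, sub_self])
  rw [add_sub_cancel] at hIJ
  -- A decomposition of `ϖ` is part of one of `1`, and the orbit projections are another
  -- decomposition of `1`. By Krull-Schmidt `ϖ` is equivalent to a sum of orbit projections, and the
  -- equivalence `a` carries those orbits onto a basis of the image.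
  obtain ⟨D', hD', hcount⟩ := exists_subset_idemCount_eq hI.1 hDprim fun x hx => by
    rw [← idemCount_eq hIJ hDdec (IdemEquiv.refl IsIdempotentElem.one) hx.1,
      idemCount_union hdisj]
    exact Nat.le_add_right _ _
  have hD'dec : IsPrimitiveDecomposition D' (∑ d ∈ D', d) :=
    ⟨fun d hd => hDprim d (hD' hd), fun d hd d' hd' => hDorth d (hD' hd) d' (hD' hd'), rfl⟩
  obtain ⟨a, c, h1, h2, h3, h4, h5, h6⟩ := (idemEquiv_of_idemCount_eq hI hD'dec hcount).exists_normalized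
    hϖ hD'dec.isIdempotentElem
  have v : ∀ {x y : E}, x = y → ∀ m, (x : Module.End O M) m = (y : Module.End O M) m :=
    fun h m => by rw [h]
  refine ⟨{x | e (Quotient.mk _ x) ∈ D'}, a, mem_centralizer_range_iff.mp a.2, fun h x hx => ?_,
    ?_, le_antisymm ?_ ?_⟩
  · rw [Set.mem_ofPred_eq] at hx ⊢
    rwa [quotient_mk_smul]
  -- On the chosen orbits `c` undoes `a`, so independence is inherited from the basis `b`.
  · have hli : LinearIndepOn O (fun x => (c : Module.End O M) ((a : Module.End O M) (b x)))
        {x | e (Quotient.mk _ x) ∈ D'} := by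
      refine (b.linearIndependent.linearIndepOn _).congr fun x hx => ?_
      have h7 := v h2 (b x)
      rw [hsum D' hD', if_pos (Set.mem_ofPred_eq ▸ hx)] at h7
      exact h7.symm
    exact LinearIndependent.of_comp (c : Module.End O M) hli
  · rw [Submodule.span_le]
    rintro _ ⟨x, -, rfl⟩
    exact ⟨(a : Module.End O M) (b x), v h3 (b x)⟩
  · rintro _ ⟨m, rfl⟩
    have h7 : π m = (a : Module.End O M) (((∑ d ∈ D', d : E) : Module.End O M)
        ((c : Module.End O M) m)) := by
      have h8 : a * ((∑ d ∈ D', d) * c) = ϖ := by rw [h5, h1]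
      exact (v h8 m).symm
    rw [h7]
    generalize (c : Module.End O M) m = n
    rw [← b.sum_repr n, map_sum, map_sum]
    refine Submodule.sum_mem _ fun x _ => ?_
    rw [map_smul, map_smul, hsum D' hD']
    refine Submodule.smul_mem _ _ ?_
    split_ifs with hx
    · exact Submodule.subset_span ⟨x, hx, rfl⟩
    · rw [map_zero]; exact zero_mem _

end OrbitProjection

/-! ### Deforming an invariant basis into units. -/

section UnitalBasis

variable {O S A : Type*} [CommRing O] [Group S] [Ring A] [Algebra O A] {σ : S →* A}

theorem isUnit_biact {a : A} (ha : IsUnit a) (s : S × S) : IsUnit (biact σ s a) :=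
  ((IsUnit.map σ (Group.isUnit s.1)).mul ha).mul (IsUnit.map σ (Group.isUnit s.2⁻¹))

theorem biact_mul_apply (s t : S × S) (a : A) : biact σ (s * t) a = biact σ s (biact σ t a) := by
  simp [biact, mul_assoc]

/-- Units that are fixed by the stabilizers of the elements of an invariant basis can be chosen
equivariantly. -/
theorem IsInvariantBasis.exists_equivariant_isUnit {Y : Set A} (hY : IsInvariantBasis O σ Y)
    (h : ∀ y ∈ Y, ∃ u : A, IsUnit u ∧ ∀ s, biact σ s y = y → biact σ s u = u) :
    ∃ f : A →ₗ[O] A, (∀ y ∈ Y, IsUnit (f y)) ∧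
      ∀ s, ∀ y ∈ Y, f (biact σ s y) = biact σ s (f y) := by
  let act := hY.mulAction
  choose! u hu hfix using h
  let r : Y → Y := fun y => Quotient.out (Quotient.mk (MulAction.orbitRel (S × S) Y) y)
  have hr : ∀ y : Y, ∃ s : S × S, s • r y = y := fun y => by
    obtain ⟨s, hs⟩ := (Quotient.mk_out (s := MulAction.orbitRel (S × S) Y) y)
    exact ⟨s⁻¹, by rw [inv_smul_eq_iff]; exact hs.symm⟩
  choose t ht using hr
  have hrs : ∀ (s : S × S) (y : Y), r (s • y) = r y := fun s y =>
    congrArg Quotient.out (Quotient.sound ⟨s, rfl⟩)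
  let f := hY.basis.constr ℕ fun y => biact σ (t y) (u (r y))
  have hf : ∀ y : Y, f y = biact σ (t y) (u (r y)) := fun y => by
    have := hY.basis.constr_basis ℕ (fun y => biact σ (t y) (u (r y))) y
    rwa [hY.basis_apply] at this
  refine ⟨f, fun y hy => ?_, fun s y hy => ?_⟩
  · rw [hf ⟨y, hy⟩]
    exact isUnit_biact (hu _ (r ⟨y, hy⟩).2) _
  · have h1 : biact σ s y = ((s • ⟨y, hy⟩ : Y) : A) := rfl
    rw [h1, hf, hf ⟨y, hy⟩, hrs, ← biact_mul_apply]
    -- Two translations that take the orbit representative to the same point differ by an element of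
    -- its stabilizer, which fixes the chosen unit.
    have h2 : biact σ ((s * t ⟨y, hy⟩)⁻¹ * t (s • ⟨y, hy⟩)) (u (r ⟨y, hy⟩)) = u (r ⟨y, hy⟩) := by
      refine hfix _ (r ⟨y, hy⟩).2 _ ?_
      have h3 : ((s * t ⟨y, hy⟩)⁻¹ * t (s • ⟨y, hy⟩)) • r ⟨y, hy⟩ = r ⟨y, hy⟩ := by
        rw [mul_smul, inv_smul_eq_iff, mul_smul, ht]
        have h4 := ht (s • ⟨y, hy⟩)
        rwa [hrs] at h4
      exact congrArg Subtype.val h3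
    conv_rhs => rw [← h2]
    rw [← biact_mul_apply, mul_inv_cancel_left]

theorem IsInvariantBasis.image {Y : Set A} (hY : IsInvariantBasis O σ Y) (T : A ≃ₗ[O] A)
    (hT : ∀ s, ∀ y ∈ Y, T (biact σ s y) = biact σ s (T y)) : IsInvariantBasis O σ (T '' Y) where
  linearIndep := by
    have h1 : LinearIndepOn O (T ∘ id) Y :=
      LinearIndepOn.map_injOn hY.linearIndep T.toLinearMap T.injective.injOn
    exact h1.id_image
  span_eq_top := by
    have : T '' Y = T.toLinearMap '' Y := rfl
    rw [this, Submodule.span_image, hY.span_eq_top, Submodule.map_top, LinearEquiv.range]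
  left_mem := by
    rintro s _ ⟨y, hy, rfl⟩
    refine ⟨_, hY.left_mem s y hy, ?_⟩
    have h1 := hT (s, 1) y hy
    simpa [biact] using h1
  right_mem := by
    rintro s _ ⟨y, hy, rfl⟩
    refine ⟨_, hY.right_mem s y hy, ?_⟩
    have h1 := hT (1, s⁻¹) y hy
    simpa [biact] using h1

variable [IsLocalRing O]

/-- `r - f` is invertible when its determinant, the value at `r` of the characteristic polynomial,
is nonzero in the residue field. Only the finitely many roots of the reduced polynomial are
excluded. -/
theorem exists_finset_isUnit_algebraMap_sub {M : Type*} [AddCommGroup M] [Module O M]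
    [Module.Free O M] [Module.Finite O M] (f : Module.End O M) :
    ∃ B : Finset (IsLocalRing.ResidueField O), ∀ r : O, IsLocalRing.residue O r ∉ B →
      IsUnit (algebraMap O (Module.End O M) r - f) := by
  classical
  refine ⟨(f.charpoly.map (IsLocalRing.residue O)).roots.toFinset, fun r hr => ?_⟩
  rw [LinearMap.isUnit_iff_isUnit_det, ← LinearMap.eval_charpoly,
    ← IsLocalRing.residue_ne_zero_iff_isUnit]
  intro h0
  refine hr ?_
  rw [Multiset.mem_toFinset, Polynomial.mem_roots ((f.charpoly_monic.map _).ne_zero),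
    Polynomial.IsRoot.def, Polynomial.eval_map, Polynomial.eval₂_hom, h0]

/-- With equivariant units `f(y)` at hand, the map `T = r⁻¹ - f` is equivariant on the basis and
bijective for generic `r`, so it carries the basis to an invariant basis. Genericity also makes each
`T y` a unit. -/
theorem IsInvariantBasis.hasUnitalInvariantBasis [IsAlgClosed (IsLocalRing.ResidueField O)]
    [Module.Finite O A] {Y : Set A} (hY : IsInvariantBasis O σ Y)
    (h : ∀ y ∈ Y, ∃ u : A, IsUnit u ∧ ∀ s, biact σ s y = y → biact σ s u = u) :
    HasUnitalInvariantBasis O σ := by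
  classical
  obtain ⟨f, hfu, hf⟩ := hY.exists_equivariant_isUnit h
  have : Module.Free O A := Module.Free.of_basis hY.basis
  have : Finite Y := Module.Finite.finite_basis hY.basis
  have := Fintype.ofFinite Y
  obtain ⟨B, hB⟩ := exists_finset_isUnit_algebraMap_sub f
  choose C hC using fun a : A => exists_finset_isUnit_algebraMap_sub (Algebra.lmul O A a)
  let g : Y → A := fun y => ((hfu y y.2).unit⁻¹ : Aˣ) * (y : A)
  have : Infinite (IsLocalRing.ResidueField O) := IsAlgClosed.instInfinite
  -- The residue of `r` must avoid `0`, the inverses of the bad values for `f` (so that `r⁻¹ - f` is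
  -- bijective) and the bad values of left multiplication by each `f(y)⁻¹ y`.
  obtain ⟨k, hk⟩ := Infinite.exists_notMem_finset
    (insert 0 (B.image (·⁻¹) ∪ Finset.univ.biUnion fun y => C (g y)))
  simp only [Finset.mem_insert, Finset.mem_union, Finset.mem_image, Finset.mem_biUnion,
    Finset.mem_univ, true_and, not_or, not_exists, not_and] at hk
  obtain ⟨hk0, hkB, hkC⟩ := hk
  obtain ⟨r, rfl⟩ := IsLocalRing.residue_surjective k
  obtain ⟨r, rfl⟩ := (IsLocalRing.residue_ne_zero_iff_isUnit r).mp hk0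
  have hinv : IsLocalRing.residue O (r⁻¹ : Oˣ) = (IsLocalRing.residue O r)⁻¹ := by
    refine eq_inv_of_mul_eq_one_left ?_
    rw [← map_mul, Units.inv_mul, map_one]
  have h1 : IsUnit (algebraMap O (Module.End O A) (r⁻¹ : Oˣ) - f) := by
    refine hB _ fun hmem => hkB _ hmem ?_
    rw [hinv, inv_inv]
  have h2 : ∀ y : Y, IsUnit (algebraMap O A r - g y) := fun y => by
    rw [← Algebra.lmul_isUnit_iff (R := O), map_sub, AlgHom.commutes]
    exact hC _ _ (hkC y)
  have h3 : ∀ a, (algebraMap O (Module.End O A) (r⁻¹ : Oˣ) - f) a = ((r⁻¹ : Oˣ) : O) • a - f a :=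
    fun a => by rw [LinearMap.sub_apply, Module.algebraMap_end_apply]
  let T : A ≃ₗ[O] A := LinearEquiv.ofBijective _ ((Module.End.isUnit_iff _).mp h1)
  have hT : ∀ a, T a = ((r⁻¹ : Oˣ) : O) • a - f a := h3
  refine ⟨T '' Y, hY.image T fun s y hy => ?_, ?_⟩
  · rw [hT, hT, hf s y hy]
    simp only [← biactRep_apply (O := O), map_sub, map_smul]
  · rintro _ ⟨y, hy, rfl⟩
    have h4 : T y = -((r⁻¹ : Oˣ) : O) • (f y * (algebraMap O A r - g ⟨y, hy⟩)) := by
      rw [hT, mul_sub, ← mul_assoc, IsUnit.mul_val_inv, one_mul, ← Algebra.commutes,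
        ← Algebra.smul_def, smul_sub, smul_smul, neg_mul, Units.inv_mul, neg_smul, one_smul,
        neg_smul]
      abel
    rw [h4, Algebra.smul_def]
    exact (IsUnit.map _ (r⁻¹ : Oˣ).isUnit.neg).mul ((hfu y hy).mul (h2 ⟨y, hy⟩))

end UnitalBasis

/-! ### The corner: fixed points, Brauer kernels and invariant bases. -/

section Corner

variable {O S A : Type*} [CommRing O] [Group S] [Ring A] [Algebra O A] {l : A}

/-- The inclusion of the corner. -/
def cornerVal (O : Type*) {A : Type*} [CommRing O] [Ring A] [Algebra O A] {l : A}
    (hl : IsIdempotentElem l) : hl.Corner →ₗ[O] A where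
  toFun x := x.1
  map_add' _ _ := rfl
  map_smul' _ _ := rfl

/-- The projection onto the corner. -/
def cornerProj (O : Type*) {A : Type*} [CommRing O] [Ring A] [Algebra O A] {l : A}
    (hl : IsIdempotentElem l) : A →ₗ[O] hl.Corner where
  toFun a := ⟨l * a * l, a, rfl⟩
  map_add' a b := Subtype.ext (by
    change l * (a + b) * l = l * a * l + l * b * l
    rw [mul_add, add_mul])
  map_smul' c a := Subtype.ext (by
    change l * (c • a) * l = c • (l * a * l)
    rw [mul_smul_comm, smul_mul_assoc])

variable (hl : IsIdempotentElem l)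

theorem coe_cornerProj (a : A) : (cornerProj O hl a).1 = l * a * l := rfl

theorem corner_left (x : hl.Corner) : l * x.1 = x.1 :=
  ((Subsemigroup.mem_corner_iff hl).mp x.2).1

theorem corner_right (x : hl.Corner) : x.1 * l = x.1 :=
  ((Subsemigroup.mem_corner_iff hl).mp x.2).2

theorem cornerProj_val (x : hl.Corner) : cornerProj O hl x.1 = x :=
  Subtype.ext (by rw [coe_cornerProj, corner_left, corner_right])

/-- Viewing an element of `lAl` as an element of the corner. -/
def toCorner {a : A} (h1 : l * a = a) (h2 : a * l = a) : hl.Corner :=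
  ⟨a, (Subsemigroup.mem_corner_iff hl).mpr ⟨h1, h2⟩⟩

variable {σ : S →* A} (hS : l ∈ fixedAlgebra O σ ⊤)

include hS in
theorem comm_of_mem_fixedAlgebra_top (s : S) : σ s * l = l * σ s :=
  mem_fixedAlgebra.mp hS s trivial

theorem coe_cornerHom_mul (s : S) (x : hl.Corner) : (cornerHom σ hl hS s * x).1 = σ s * x.1 := by
  change l * σ s * l * x.1 = σ s * x.1
  rw [mul_assoc, corner_left, ← comm_of_mem_fixedAlgebra_top hS, mul_assoc, corner_left]

theorem coe_mul_cornerHom (s : S) (x : hl.Corner) : (x * cornerHom σ hl hS s).1 = x.1 * σ s := by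
  change x.1 * (l * σ s * l) = x.1 * σ s
  rw [mul_assoc, comm_of_mem_fixedAlgebra_top hS, ← mul_assoc l, hl.eq, ← mul_assoc, corner_right]

theorem coe_biact_corner (s : S × S) (x : hl.Corner) :
    (biact (cornerHom σ hl hS) s x).1 = biact σ s x.1 := by
  unfold biact
  rw [coe_mul_cornerHom, coe_cornerHom_mul]

theorem cornerProj_biact (s : S × S) (a : A) :
    cornerProj O hl (biact σ s a) = biact (cornerHom σ hl hS) s (cornerProj O hl a) := by
  refine Subtype.ext ?_
  rw [coe_biact_corner, coe_cornerProj, coe_cornerProj, biact, biact]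
  simp only [mul_assoc, comm_of_mem_fixedAlgebra_top hS]
  simp only [← mul_assoc, comm_of_mem_fixedAlgebra_top hS]

theorem mem_fixedSubmodule_corner_iff {U : Subgroup (S × S)} {x : hl.Corner} :
    x ∈ fixedSubmodule O (cornerHom σ hl hS) U ↔ x.1 ∈ fixedSubmodule O σ U :=
  forall₂_congr fun s _ => by rw [← coe_biact_corner hl hS]; exact Subtype.ext_iff

theorem mem_fixedAlgebra_corner_iff {P : Subgroup S} {x : hl.Corner} :
    x ∈ fixedAlgebra O (cornerHom σ hl hS) P ↔ x.1 ∈ fixedAlgebra O σ P := by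
  rw [mem_fixedAlgebra_iff_mem_fixedSubmodule, mem_fixedAlgebra_iff_mem_fixedSubmodule,
    mem_fixedSubmodule_corner_iff]

theorem mem_brauerKernel_corner_iff [IsLocalRing O] [Finite S] {U : Subgroup (S × S)}
    {x : hl.Corner} :
    x ∈ brauerKernel O (cornerHom σ hl hS) U ↔ x.1 ∈ brauerKernel O σ U := by
  rw [brauerKernel_eq_repBrauerKernel, brauerKernel_eq_repBrauerKernel]
  constructor
  · intro h
    exact map_mem_repBrauerKernel (τ := (biactRep O (cornerHom σ hl hS)).comp U.subtype)
      (τ' := (biactRep O σ).comp U.subtype) (MulEquiv.refl U) (cornerVal O hl)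
      (fun u m => coe_biact_corner hl hS u m) h
  · intro h
    have := map_mem_repBrauerKernel (MulEquiv.refl U) (cornerProj O hl)
      (τ := (biactRep O σ).comp U.subtype) (τ' := (biactRep O (cornerHom σ hl hS)).comp U.subtype)
      (fun u m => cornerProj_biact hl hS u m) h
    rwa [cornerProj_val] at this

/-- The corner has an invariant basis. -/
theorem exists_isInvariantBasis_corner [IsLocalRing O] [IsNoetherianRing O]
    [IsAdicComplete (IsLocalRing.maximalIdeal O) O] [Finite S] [Module.Finite O A] (p : ℕ)
    [Fact p.Prime] [CharP (IsLocalRing.ResidueField O) p] (hp : IsPGroup p S) {Y : Set A}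
    (hY : IsInvariantBasis O σ Y) :
    ∃ Y' : Set hl.Corner, IsInvariantBasis O (cornerHom σ hl hS) Y' := by
  let _ := hY.mulAction
  have : Finite Y := Module.Finite.finite_basis hY.basis
  have hb : ∀ (h : S × S) (x : Y), biactRep O σ h (hY.basis x) = hY.basis (h • x) := by
    intro h x
    rw [hY.basis_apply, hY.basis_apply]
    rfl
  -- `a ↦ l a l` is an idempotent endomorphism that commutes with `S × S`, because `l` commutes with
  -- the image of `S`. So the corner is a direct summand of the permutation module `A`.
  let π : Module.End O A := (cornerVal O hl).comp (cornerProj O hl)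
  have hπx : ∀ x : hl.Corner, π x.1 = x.1 := fun x => congrArg Subtype.val (cornerProj_val hl x)
  obtain ⟨X, a, ha, hX, hli, hspan⟩ := exists_basis_range_of_isIdempotentElem p hp.prod_self
    hY.basis hb (π := π)
    (fun h m => by
      change biact σ h (cornerProj O hl m).1 = (cornerProj O hl (biact σ h m)).1
      rw [cornerProj_biact hl hS, coe_biact_corner])
    (LinearMap.ext fun m => hπx (cornerProj O hl m))
  have hmem : ∀ x ∈ X, π (a (hY.basis x)) = a (hY.basis x) := by
    intro x hx
    have h1 : a (hY.basis x) ∈ LinearMap.range π := by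
      rw [← hspan]
      exact Submodule.subset_span ⟨x, hx, rfl⟩
    obtain ⟨m, hm⟩ := h1
    rw [← hm]
    exact hπx (cornerProj O hl m)
  let g : Y → hl.Corner := fun x => cornerProj O hl (a (hY.basis x))
  have hgval : ∀ x ∈ X, (g x).1 = a (hY.basis x) := hmem
  have hstab : ∀ s : S × S, ∀ x ∈ X, biact (cornerHom σ hl hS) s (g x) ∈ g '' X := by
    intro s x hx
    refine ⟨s • x, hX s x hx, ?_⟩
    change cornerProj O hl (a (hY.basis (s • x))) =
      biact (cornerHom σ hl hS) s (cornerProj O hl (a (hY.basis x)))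
    rw [← cornerProj_biact, ← hb, ← ha]
    rfl
  refine ⟨g '' X, ⟨?_, ?_, ?_, ?_⟩⟩
  · refine LinearIndepOn.id_image ?_
    refine LinearIndependent.of_comp (cornerVal O hl) ?_
    exact LinearIndepOn.congr hli fun x hx => (hgval x hx).symm
  · rw [eq_top_iff]
    intro x _
    have h1 : x.1 ∈ Submodule.span O ((fun x => a (hY.basis x)) '' X) := by
      rw [hspan]
      exact ⟨x.1, hπx x⟩
    have h2 := Submodule.mem_map_of_mem (f := cornerProj O hl) h1
    rw [cornerProj_val, ← Submodule.span_image, ← Set.image_comp] at h2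
    exact h2
  · rintro s _ ⟨x, hx, rfl⟩
    have := hstab (s, 1) x hx
    simpa [biact] using this
  · rintro s _ ⟨x, hx, rfl⟩
    have := hstab (1, s⁻¹) x hx
    simpa [biact] using this

theorem finite_corner [Module.Finite O A] : Module.Finite O hl.Corner :=
  Module.Finite.of_surjective (cornerProj O hl) fun x => ⟨x.1, cornerProj_val hl x⟩

end Corner

/-! ### Fusion units and unital bases. -/

section FusionUnits

variable {O S A : Type*} [CommRing O] [IsLocalRing O] [Group S] [Ring A] [Algebra O A]

/-- Every isomorphism of the fixed-point fusion presystem is induced by a unit. -/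
def HasFusionUnits (O : Type*) {S A : Type*} [CommRing O] [IsLocalRing O] [Group S] [Ring A]
    [Algebra O A] (σ : S →* A) : Prop :=
  ∀ (P Q : Subgroup S) (φ : P ≃* Q), IsFixedPointFusion O σ φ.toMonoidHom →
    ∃ u : Aˣ, ∀ x : P, σ (φ x) * u = u * σ x

variable {σ : S →* A}

/-- A nonzero Brauer quotient at the twisted diagonal of `φ` gives a basis element fixed by it.
Being fixed means intertwining along `φ`, and the basis element is a unit. -/
theorem HasUnitalInvariantBasis.hasFusionUnits [Module.Finite O A] [Finite S] (p : ℕ)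
    [Fact p.Prime] [CharP (IsLocalRing.ResidueField O) p] (hp : IsPGroup p S)
    (h : HasUnitalInvariantBasis O σ) : HasFusionUnits O σ := by
  obtain ⟨Y, hY, hYu⟩ := h
  intro P Q φ hφ
  have h1 := nontrivial_brauerQuotient_iff.mp hφ.2
  obtain ⟨y, hy, hyf⟩ := (hY.nontrivial_brauerQuotient_iff p hp _).mp h1
  obtain ⟨u, rfl⟩ := hYu y hy
  exact ⟨u, mem_fixedSubmodule_twistedDiag.mp hyf⟩

/-- A subgroup of `S × S` on which both projections are injective is a twisted diagonal. -/
theorem exists_eq_twistedDiag {U : Subgroup (S × S)} (h1 : ∀ s, (s, 1) ∈ U → s = 1)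
    (h2 : ∀ s, (1, s) ∈ U → s = 1) : ∃ (P Q : Subgroup S) (φ : P ≃* Q),
      U = twistedDiag (Q.subtype.comp φ.toMonoidHom) := by
  let f : U →* S := (MonoidHom.snd S S).comp U.subtype
  let g : U →* S := (MonoidHom.fst S S).comp U.subtype
  have hf : Function.Injective f := by
    rw [injective_iff_map_eq_one]
    rintro ⟨⟨s, t⟩, hst⟩ h
    obtain rfl : t = 1 := h
    obtain rfl := h1 s hst
    rfl
  have hg : Function.Injective g := by
    rw [injective_iff_map_eq_one]
    rintro ⟨⟨s, t⟩, hst⟩ h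
    obtain rfl : s = 1 := h
    obtain rfl := h2 t hst
    rfl
  let φ : f.range ≃* g.range :=
    (MonoidHom.ofInjective hf).symm.trans (MonoidHom.ofInjective hg)
  have hφ : ∀ u : U, φ (MonoidHom.ofInjective hf u) = MonoidHom.ofInjective hg u := fun u => by
    rw [MulEquiv.trans_apply, MulEquiv.symm_apply_apply]
  refine ⟨f.range, g.range, φ, ?_⟩
  ext ⟨s, t⟩
  constructor
  · intro hst
    refine ⟨MonoidHom.ofInjective hf ⟨(s, t), hst⟩, Prod.ext ?_ rfl⟩
    exact congrArg Subtype.val (hφ ⟨(s, t), hst⟩)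
  · rintro ⟨x, hx⟩
    obtain ⟨u, rfl⟩ := (MonoidHom.ofInjective hf).surjective x
    have h3 : s = (u : S × S).1 :=
      (congrArg Prod.fst hx).symm.trans (congrArg Subtype.val (hφ u))
    have h4 : t = (u : S × S).2 := (congrArg Prod.snd hx).symm
    rw [h3, h4]
    exact u.2

variable {l : A} (hl : IsIdempotentElem l) (hS : l ∈ fixedAlgebra O σ ⊤)

theorem isFixedPointFusion_of_corner [Finite S] {P Q : Subgroup S} {φ : P →* Q}
    (h : IsFixedPointFusion O (cornerHom σ hl hS) φ) : IsFixedPointFusion O σ φ := by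
  refine ⟨h.1, nontrivial_brauerQuotient_iff.mpr ?_⟩
  obtain ⟨x, hx, hx'⟩ := nontrivial_brauerQuotient_iff.mp h.2
  exact ⟨x.1, (mem_fixedSubmodule_corner_iff hl hS).mp hx,
    fun h => hx' ((mem_brauerKernel_corner_iff hl hS).mpr h)⟩

/-- The stabilizer `U` of a basis element of the corner has a nonzero Brauer quotient there, hence
also in `A`, so it fixes an element of a basis of `A`. Bifreeness forces `U` to be a twisted
diagonal, and the fusion unit of its isomorphism is fixed by `U`. -/
theorem HasFusionUnits.hasUnitalInvariantBasis_corner [IsNoetherianRing O]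
    [IsAdicComplete (IsLocalRing.maximalIdeal O) O] [IsAlgClosed (IsLocalRing.ResidueField O)]
    [Finite S] [Module.Finite O A] (p : ℕ)
    [Fact p.Prime] [CharP (IsLocalRing.ResidueField O) p] (hp : IsPGroup p S)
    (hσ : IsBifree O σ) (h : HasFusionUnits O (cornerHom σ hl hS)) :
    HasUnitalInvariantBasis O (cornerHom σ hl hS) := by
  obtain ⟨⟨Y, hY⟩, hfree⟩ := hσ
  obtain ⟨Y', hY'⟩ := exists_isInvariantBasis_corner hl hS p hp hY
  have := finite_corner (O := O) hl
  refine hY'.hasUnitalInvariantBasis fun y hy => ?_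
  let _ := hY'.mulAction
  let U : Subgroup (S × S) := MulAction.stabilizer (S × S) (⟨y, hy⟩ : Y')
  have hU : ∀ s, s ∈ U ↔ biact (cornerHom σ hl hS) s y = y := fun s => Subtype.ext_iff
  obtain ⟨x, hx, hx'⟩ := (hY'.nontrivial_brauerQuotient_iff p hp U).mpr
    ⟨y, hy, fun s hs => (hU s).mp hs⟩
  obtain ⟨z, hz, hzU⟩ := (hY.nontrivial_brauerQuotient_iff p hp U).mp
    ⟨x.1, (mem_fixedSubmodule_corner_iff hl hS).mp hx,
      fun h => hx' ((mem_brauerKernel_corner_iff hl hS).mpr h)⟩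
  obtain ⟨P, Q, φ, hφ⟩ := exists_eq_twistedDiag (U := U)
    (fun s hs => (hfree Y hY z hz s).1 (by simpa [biact] using hzU _ hs))
    (fun s hs => (hfree Y hY z hz s).2 (by simpa [biact] using hzU _ (U.inv_mem hs)))
  obtain ⟨u, hu⟩ := h P Q φ ⟨φ.injective, nontrivial_brauerQuotient_iff.mpr
    (by rw [hφ] at hx hx'; exact ⟨x, hx, hx'⟩)⟩
  refine ⟨u, u.isUnit, fun s hs => ?_⟩
  have h1 : (u : hl.Corner) ∈ fixedSubmodule O (cornerHom σ hl hS) U := by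
    rw [hφ]
    exact mem_fixedSubmodule_twistedDiag.mpr hu
  exact h1 s ((hU s).mpr hs)

end FusionUnits

/-! ### Points and multiplicities under embeddings onto corners. -/

section CornerEmbedding

variable {R R' : Type*} [Ring R] [Ring R']

/-- `ι` identifies `R` with a corner of `R'`. -/
structure IsCornerEmbedding (ι : R →ₙ+* R') : Prop where
  injective : Function.Injective ι
  exists_eq : ∀ x : R', ι 1 * x = x → x * ι 1 = x → ∃ y, ι y = x

variable {ι : R →ₙ+* R'}

theorem map_isIdempotentElem {i : R} (hi : IsIdempotentElem i) : IsIdempotentElem (ι i) := by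
  change ι i * ι i = ι i
  rw [← map_mul, hi.eq]

theorem IsCornerEmbedding.exists_eq_of_le (hι : IsCornerEmbedding ι) {i j : R} {x : R'}
    (h1 : ι i * x = x) (h2 : x * ι j = x) : ∃ y, ι y = x := by
  refine hι.exists_eq x ?_ ?_
  · rw [← h1, ← mul_assoc, ← map_mul, one_mul]
  · rw [← h2, mul_assoc, ← map_mul, mul_one]

/-- The summands of any splitting of `ι i` lie below `ι i`, hence in the image, so the splitting
comes from `R`. -/
theorem IsCornerEmbedding.isPrimitiveIdem_map (hι : IsCornerEmbedding ι) {i : R}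
    (hi : IsPrimitiveIdem i) : IsPrimitiveIdem (ι i) := by
  obtain ⟨h1, h2, h3⟩ := hi
  refine ⟨map_isIdempotentElem h1, fun h => h2 (hι.injective (h.trans (map_zero ι).symm)),
    fun f g hf hg hfg hgf h => ?_⟩
  obtain ⟨f, rfl⟩ := hι.exists_eq_of_le (i := i) (j := i) (x := f)
    (by rw [h, add_mul, hf.eq, hgf, add_zero]) (by rw [h, mul_add, hf.eq, hfg, add_zero])
  obtain ⟨g, rfl⟩ := hι.exists_eq_of_le (i := i) (j := i) (x := g)
    (by rw [h, add_mul, hg.eq, hfg, zero_add]) (by rw [h, mul_add, hg.eq, hgf, zero_add])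
  rw [← map_add] at h
  refine (h3 f g (hι.injective ?_) (hι.injective ?_) (hι.injective ?_) (hι.injective ?_)
    (hι.injective h)).imp (fun h0 => ?_) fun h0 => ?_
  · rw [map_mul, hf.eq]
  · rw [map_mul, hg.eq]
  · rw [map_mul, hfg, map_zero]
  · rw [map_mul, hgf, map_zero]
  · rw [h0, map_zero]
  · rw [h0, map_zero]

theorem IsCornerEmbedding.isPrimitiveIdem_of_map (hι : IsCornerEmbedding ι) {i : R}
    (hi : IsPrimitiveIdem (ι i)) : IsPrimitiveIdem i := by
  obtain ⟨h1, h2, h3⟩ := hi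
  refine ⟨hι.injective ?_, fun h => h2 (by rw [h, map_zero]), fun f g hf hg hfg hgf h => ?_⟩
  · rw [map_mul, h1.eq]
  · refine (h3 (ι f) (ι g) (map_isIdempotentElem hf) (map_isIdempotentElem hg) ?_ ?_ ?_).imp
      (fun h0 => hι.injective (h0.trans (map_zero ι).symm))
      fun h0 => hι.injective (h0.trans (map_zero ι).symm)
    · rw [← map_mul, hfg, map_zero]
    · rw [← map_mul, hgf, map_zero]
    · rw [h, map_add]

theorem IdemEquiv.map {i j : R} (h : IdemEquiv i j) (ι : R →ₙ+* R') :
    IdemEquiv (ι i) (ι j) := by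
  obtain ⟨a, b, rfl, rfl⟩ := h
  exact ⟨ι a, ι b, (map_mul ι a b).symm, (map_mul ι b a).symm⟩

theorem IsCornerEmbedding.idemEquiv_map_iff (hι : IsCornerEmbedding ι) {i j : R}
    (hi : IsIdempotentElem i) (hj : IsIdempotentElem j) :
    IdemEquiv (ι i) (ι j) ↔ IdemEquiv i j := by
  refine ⟨fun h => ?_, fun h => h.map ι⟩
  obtain ⟨a, b, h1, h2, h3, h4, h5, h6⟩ :=
    h.exists_normalized (map_isIdempotentElem hi) (map_isIdempotentElem hj)
  obtain ⟨a, rfl⟩ := hι.exists_eq_of_le h3 h4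
  obtain ⟨b, rfl⟩ := hι.exists_eq_of_le h5 h6
  rw [← map_mul] at h1 h2
  exact ⟨a, b, hι.injective h1, hι.injective h2⟩

theorem IsCornerEmbedding.isPrimitiveDecomposition_map (hι : IsCornerEmbedding ι) {I : Finset R}
    {e : R} (hI : IsPrimitiveDecomposition I e) :
    IsPrimitiveDecomposition (I.map ⟨ι, hι.injective⟩) (ι e) := by
  refine ⟨fun i hi => ?_, fun i hi j hj hij => ?_, ?_⟩
  · obtain ⟨k, hk, rfl⟩ := Finset.mem_map.mp hi
    exact hι.isPrimitiveIdem_map (hI.1 k hk)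
  · obtain ⟨k, hk, rfl⟩ := Finset.mem_map.mp hi
    obtain ⟨m, hm, rfl⟩ := Finset.mem_map.mp hj
    have := hI.2.1 k hk m hm fun h => hij (by rw [h])
    change ι k * ι m = 0
    rw [← map_mul, this, map_zero]
  · rw [Finset.sum_map, ← hI.2.2, map_sum]
    rfl

theorem IsCornerEmbedding.idemCount_map (hι : IsCornerEmbedding ι) {I : Finset R} {x : R}
    (hx : IsIdempotentElem x) (hI : ∀ i ∈ I, IsIdempotentElem i) :
    idemCount (I.map ⟨ι, hι.injective⟩) (ι x) = idemCount I x := by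
  classical
  unfold idemCount
  rw [Finset.filter_map, Finset.card_map]
  congr 1
  exact Finset.filter_congr fun i hi => hι.idemEquiv_map_iff hx (hI i hi)

theorem IsCornerEmbedding.pointMultiplicity_map [IsSemiperfectRing R] [IsSemiperfectRing R']
    (hι : IsCornerEmbedding ι) {x e : R} (hx : IsPrimitiveIdem x) (he : IsIdempotentElem e) :
    pointMultiplicity (pointOf (ι x)) (ι e) = pointMultiplicity (pointOf x) e := by
  obtain ⟨I, hI⟩ := IsSemiperfectRing.exists_decomposition e he
  rw [(isPoint_pointOf hx).pointMultiplicity_eq (mem_pointOf x) hI,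
    (isPoint_pointOf (hι.isPrimitiveIdem_map hx)).pointMultiplicity_eq (mem_pointOf _)
      (hι.isPrimitiveDecomposition_map hI), hι.idemCount_map hx.1 fun i hi => (hI.1 i hi).1]

theorem IsPoint.eq_pointOf [IsSemiperfectRing R] {γ : Set R} (hγ : IsPoint γ) {i : R}
    (hi : i ∈ γ) : γ = pointOf i := by
  ext j
  rw [hγ.mem_iff hi, (isPoint_pointOf (hγ.isPrimitiveIdem hi)).mem_iff (mem_pointOf i)]

theorem pointOf_eq_of_idemEquiv [IsSemiperfectRing R] {i j : R} (hi : IsPrimitiveIdem i)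
    (hj : IsPrimitiveIdem j) (h : IdemEquiv i j) : pointOf i = pointOf j :=
  (isPoint_pointOf hi).eq_pointOf
    (((isPoint_pointOf hi).mem_iff (mem_pointOf i)).mpr ⟨hj, h⟩)

/-- A point of nonzero multiplicity in `e` has a member below `e`. -/
theorem exists_idemEquiv_of_pointMultiplicity_ne_zero [IsSemiperfectRing R] {i e : R}
    (hi : IsPrimitiveIdem i) (he : IsIdempotentElem e) (h : pointMultiplicity (pointOf i) e ≠ 0) :
    ∃ k, IsPrimitiveIdem k ∧ IdemEquiv i k ∧ e * k = k ∧ k * e = k := by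
  obtain ⟨I, hI⟩ := IsSemiperfectRing.exists_decomposition e he
  rw [(isPoint_pointOf hi).pointMultiplicity_eq (mem_pointOf i) hI] at h
  obtain ⟨k, hk, hik⟩ := exists_mem_of_idemCount_pos (Nat.pos_of_ne_zero h)
  exact ⟨k, hI.1 k hk, hik, hI.mul_left hk, hI.mul_right hk⟩

end CornerEmbedding

/-! ### Equivalence of idempotents along an isomorphism of subgroups. -/

section TwistedEquivalence

variable {O S A : Type*} [CommRing O] [Group S] [Ring A] [Algebra O A] {σ : S →* A}
  {P Q : Subgroup S}

/-- The elements `i` and `j` are equivalent through elements that intertwine along `φ`. -/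
def TwistedEquiv (σ : S →* A) (φ : P ≃* Q) (i j : A) : Prop :=
  ∃ a b : A, (∀ x : P, σ (φ x) * a = a * σ x) ∧ (∀ x : P, σ x * b = b * σ (φ x)) ∧
    b * a = i ∧ a * b = j

theorem TwistedEquiv.symm {φ : P ≃* Q} {i j : A} (h : TwistedEquiv σ φ i j) :
    TwistedEquiv σ φ.symm j i := by
  obtain ⟨a, b, ha, hb, h1, h2⟩ := h
  refine ⟨b, a, fun y => ?_, fun y => ?_, h2, h1⟩
  · have := hb (φ.symm y)
    rwa [φ.apply_symm_apply] at this
  · have := ha (φ.symm y)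
    rwa [φ.apply_symm_apply] at this

theorem inv_intertwines {φ : P ≃* Q} {v : Aˣ} (hv : ∀ x : P, σ (φ x) * v = v * σ x) (x : P) :
    σ x * (v⁻¹ : Aˣ) = (v⁻¹ : Aˣ) * σ (φ x) := by
  rw [Units.mul_inv_eq_iff_eq_mul, mul_assoc, hv, Units.inv_mul_cancel_left]

theorem inv_intertwines_symm {φ : P ≃* Q} {v : Aˣ} (hv : ∀ x : P, σ (φ x) * v = v * σ x) (y : Q) :
    σ (φ.symm y) * (v⁻¹ : Aˣ) = (v⁻¹ : Aˣ) * σ y := by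
  have := inv_intertwines hv (φ.symm y)
  rwa [φ.apply_symm_apply] at this

theorem mul_mem_fixedAlgebra_of_intertwines {φ : P ≃* Q} {a b : A}
    (ha : ∀ x : P, σ (φ x) * a = a * σ x) (hb : ∀ x : P, σ x * b = b * σ (φ x)) :
    a * b ∈ fixedAlgebra O σ Q := by
  refine mem_fixedAlgebra.mpr fun y hy => ?_
  obtain ⟨x, hx⟩ := φ.surjective ⟨y, hy⟩
  have hy' : y = (φ x : S) := by rw [hx]
  rw [hy', ← mul_assoc, ha, mul_assoc, hb, mul_assoc]

theorem mul_mem_fixedAlgebra_of_intertwines' {φ : P ≃* Q} {a b : A}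
    (ha : ∀ x : P, σ (φ x) * a = a * σ x) (hb : ∀ x : P, σ x * b = b * σ (φ x)) :
    b * a ∈ fixedAlgebra O σ P := by
  refine mem_fixedAlgebra.mpr fun x hx => ?_
  rw [← mul_assoc, hb ⟨x, hx⟩, mul_assoc, ha ⟨x, hx⟩, mul_assoc]

theorem mul_intertwines {φ : P ≃* Q} {a c : A} (ha : ∀ x : P, σ (φ x) * a = a * σ x)
    (hc : c ∈ fixedAlgebra O σ P) (x : P) : σ (φ x) * (a * c) = a * c * σ x := by
  rw [← mul_assoc, ha, mul_assoc, mem_fixedAlgebra.mp hc x x.2, mul_assoc]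

theorem intertwines_mul {φ : P ≃* Q} {b c : A} (hb : ∀ x : P, σ x * b = b * σ (φ x))
    (hc : c ∈ fixedAlgebra O σ P) (x : P) : σ x * (c * b) = c * b * σ (φ x) := by
  rw [← mul_assoc, mem_fixedAlgebra.mp hc x x.2, mul_assoc, hb, mul_assoc]

theorem conj_mem_fixedAlgebra_of_intertwines {φ : P ≃* Q} {v : Aˣ}
    (hv : ∀ x : P, σ (φ x) * v = v * σ x) {c : A} (hc : c ∈ fixedAlgebra O σ P) :
    v * c * (v⁻¹ : Aˣ) ∈ fixedAlgebra O σ Q :=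
  mul_mem_fixedAlgebra_of_intertwines (mul_intertwines hv hc) (inv_intertwines hv)

/-- Conjugation by a unit that intertwines along `φ : P ≃ Q`, as a map `A ^ P → A ^ Q`. -/
def conjFixed (O : Type*) {S A : Type*} [CommRing O] [Group S] [Ring A] [Algebra O A] {σ : S →* A}
    {P Q : Subgroup S} {φ : P ≃* Q} {v : Aˣ} (hv : ∀ x : P, σ (φ x) * v = v * σ x) :
    fixedAlgebra O σ P →ₙ+* fixedAlgebra O σ Q where
  toFun c := ⟨v * c * (v⁻¹ : Aˣ), conj_mem_fixedAlgebra_of_intertwines hv c.2⟩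
  map_mul' c d := Subtype.ext (by
    change (v * (c * d) * (v⁻¹ : Aˣ) : A) = v * c * (v⁻¹ : Aˣ) * (v * d * (v⁻¹ : Aˣ))
    simp only [mul_assoc, Units.inv_mul_cancel_left])
  map_zero' := Subtype.ext (by
    change (v * 0 * (v⁻¹ : Aˣ) : A) = 0
    rw [mul_zero, zero_mul])
  map_add' c d := Subtype.ext (by
    change (v * (c + d) * (v⁻¹ : Aˣ) : A) = v * c * (v⁻¹ : Aˣ) + v * d * (v⁻¹ : Aˣ)
    rw [mul_add, add_mul])

theorem coe_conjFixed {φ : P ≃* Q} {v : Aˣ} (hv : ∀ x : P, σ (φ x) * v = v * σ x)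
    (c : fixedAlgebra O σ P) : (conjFixed O hv c : A) = v * c * (v⁻¹ : Aˣ) := rfl

theorem isCornerEmbedding_conjFixed {φ : P ≃* Q} {v : Aˣ}
    (hv : ∀ x : P, σ (φ x) * v = v * σ x) : IsCornerEmbedding (conjFixed O hv) where
  injective c d h := by
    have h1 := congrArg Subtype.val h
    rw [coe_conjFixed, coe_conjFixed, Units.mul_left_inj, Units.mul_right_inj] at h1
    exact Subtype.ext h1
  exists_eq x _ _ := by
    refine ⟨⟨(v⁻¹ : Aˣ) * x * v, mul_mem_fixedAlgebra_of_intertwines (φ := φ.symm)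
      (mul_intertwines (inv_intertwines_symm hv) x.2) fun y => ?_⟩, Subtype.ext ?_⟩
    · have := hv (φ.symm y)
      rwa [φ.apply_symm_apply] at this
    · rw [coe_conjFixed]
      simp [mul_assoc]

/-- A unit that intertwines along `φ` removes the twist: `v b` and `a v⁻¹` lie in `A^Q`. -/
theorem TwistedEquiv.idemEquiv_conjFixed {φ : P ≃* Q} {v : Aˣ}
    (hv : ∀ x : P, σ (φ x) * v = v * σ x) {i : fixedAlgebra O σ P} {j : fixedAlgebra O σ Q}
    (h : TwistedEquiv σ φ (i : A) j) : IdemEquiv (conjFixed O hv i) j := by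
  obtain ⟨a, b, ha, hb, h1, h2⟩ := h
  refine ⟨⟨v * b, mul_mem_fixedAlgebra_of_intertwines hv hb⟩,
    ⟨a * (v⁻¹ : Aˣ), mul_mem_fixedAlgebra_of_intertwines ha (inv_intertwines hv)⟩,
    Subtype.ext ?_, Subtype.ext ?_⟩
  · change v * b * (a * (v⁻¹ : Aˣ)) = (conjFixed O hv i : A)
    rw [coe_conjFixed, ← h1]
    simp only [mul_assoc]
  · change a * (v⁻¹ : Aˣ) * (v * b) = (j : A)
    rw [← h2, mul_assoc, Units.inv_mul_cancel_left]

theorem twistedEquiv_conjFixed {φ : P ≃* Q} {v : Aˣ}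
    (hv : ∀ x : P, σ (φ x) * v = v * σ x) {i : fixedAlgebra O σ P} (hi : IsIdempotentElem i) :
    TwistedEquiv σ φ (i : A) (conjFixed O hv i) := by
  have hi' : (i : A) * i = i := isIdempotentElem_coe hi
  refine ⟨v * i, i * (v⁻¹ : Aˣ), mul_intertwines hv i.2, intertwines_mul (inv_intertwines hv) i.2,
    ?_, ?_⟩
  · rw [mul_assoc, Units.inv_mul_cancel_left, hi']
  · rw [coe_conjFixed, mul_assoc, ← mul_assoc (i : A), hi', mul_assoc]

variable [IsLocalRing O]

theorem isLocalPoint_pointOf {i : fixedAlgebra O σ P} (hi : IsPrimitiveIdem i)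
    (hi' : (i : A) ∉ brauerKernel O σ (twistedDiag P.subtype)) :
    IsLocalPoint O σ P (pointOf i) := ⟨isPoint_pointOf hi, i, mem_pointOf i, hi'⟩

variable [Finite S]

theorem TwistedEquiv.mem_brauerKernel {φ : P ≃* Q} {i j : A} (h : TwistedEquiv σ φ i j)
    (hi : IsIdempotentElem i) (hj : j ∈ brauerKernel O σ (twistedDiag Q.subtype)) :
    i ∈ brauerKernel O σ (twistedDiag P.subtype) := by
  obtain ⟨a, b, ha, hb, h1, h2⟩ := h
  have h3 : b * j * a = i := by
    rw [← h2, ← hi.eq, ← h1]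
    simp only [mul_assoc]
  rw [← h3]
  refine conj_mem_brauerKernel φ.symm (fun y => ?_) (fun y => ?_) hj
  · have := hb (φ.symm y)
    rwa [φ.apply_symm_apply] at this
  · have := ha (φ.symm y)
    rwa [φ.apply_symm_apply] at this

theorem mul_mem_brauerKernel {a b z : A} (ha : a ∈ fixedAlgebra O σ P)
    (hb : b ∈ fixedAlgebra O σ P) (hz : z ∈ brauerKernel O σ (twistedDiag P.subtype)) :
    a * z * b ∈ brauerKernel O σ (twistedDiag P.subtype) :=
  conj_mem_brauerKernel (MulEquiv.refl P) (fun x => mem_fixedAlgebra.mp ha x x.2)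
    (fun x => mem_fixedAlgebra.mp hb x x.2) hz

theorem IdemEquiv.mem_brauerKernel {i j : fixedAlgebra O σ P} (h : IdemEquiv i j)
    (hi : IsIdempotentElem i) (hj : (j : A) ∈ brauerKernel O σ (twistedDiag P.subtype)) :
    (i : A) ∈ brauerKernel O σ (twistedDiag P.subtype) := by
  obtain ⟨a, b, h1, h2⟩ := h
  have h3 : (i : A) = a * j * b := by
    refine congrArg Subtype.val (?_ : i = a * j * b)
    rw [← h2, ← hi.eq, ← h1]
    simp only [mul_assoc]
  rw [h3]
  exact mul_mem_brauerKernel a.2 b.2 hj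

/-- The intertwiner `a` witnesses `A(φ) ≠ 0`: if it were in the Brauer kernel, so would `b a = i`
be. -/
theorem TwistedEquiv.isFixedPointFusion {φ : P ≃* Q} {i j : A} (h : TwistedEquiv σ φ i j)
    (hi : i ∉ brauerKernel O σ (twistedDiag P.subtype)) :
    IsFixedPointFusion O σ φ.toMonoidHom := by
  obtain ⟨a, b, ha, hb, h1, h2⟩ := h
  refine (isFixedPointFusion_equiv_iff φ).mpr ⟨a, ha, fun h => hi ?_⟩
  rw [← h1]
  refine mul_left_mem_brauerKernel (χ := P.subtype) (fun x => ?_) h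
  exact hb x

theorem IsLocalPoint.notMem_brauerKernel {γ : Set (fixedAlgebra O σ P)}
    (hγ : IsLocalPoint O σ P γ) [IsSemiperfectRing (fixedAlgebra O σ P)] {i : fixedAlgebra O σ P}
    (hi : i ∈ γ) : (i : A) ∉ brauerKernel O σ (twistedDiag P.subtype) := by
  obtain ⟨h1, k, hk, hkn⟩ := hγ
  have h2 := (h1.mem_iff hk).mp hi
  exact fun h => hkn (h2.2.mem_brauerKernel (h1.isPrimitiveIdem hk).1 h)

end TwistedEquivalence

/-! ### Restriction of fusion to subgroups. -/

section RestrictFusion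

variable {S : Type*} [Group S]

/-- The restriction of a group isomorphism to a subgroup. -/
theorem exists_restrict {P Q : Subgroup S} (φ : P ≃* Q) (R : Subgroup P) :
    ∃ (T : Subgroup S) (ψ : R.map P.subtype ≃* T), ∀ x : R.map P.subtype,
      ∃ x' : P, (x' : S) = x ∧ ((ψ x : T) : S) = φ x' := by
  let α := R.equivMapOfInjective P.subtype P.subtype_injective
  let β := R.equivMapOfInjective (Q.subtype.comp φ.toMonoidHom)
    (Q.subtype_injective.comp φ.injective)
  refine ⟨_, α.symm.trans β, fun x => ⟨(α.symm x : R), ?_, rfl⟩⟩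
  exact congrArg Subtype.val (α.apply_symm_apply x)

variable {O A : Type*} [CommRing O] [Ring A] [Algebra O A] {σ : S →* A}

theorem fixedAlgebra_comp_subtype (P : Subgroup S) (R : Subgroup P) :
    fixedAlgebra O (σ.comp P.subtype) R = fixedAlgebra O σ (R.map P.subtype) := by
  ext a
  rw [mem_fixedAlgebra, mem_fixedAlgebra]
  constructor
  · rintro h _ ⟨x, hx, rfl⟩
    exact h x hx
  · intro h x hx
    exact h x ⟨x, hx, rfl⟩

variable [IsLocalRing O] [Finite S]

theorem repBrauerKernel_comp_subtype (P : Subgroup S) (R : Subgroup P) :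
    repBrauerKernel ((conjRep O (σ.comp P.subtype)).comp R.subtype) =
      brauerKernel O σ (twistedDiag (R.map P.subtype).subtype) := by
  rw [brauerKernel_diag_eq]
  let α := R.equivMapOfInjective P.subtype P.subtype_injective
  ext a
  constructor
  · intro ha
    exact map_mem_repBrauerKernel (τ := (conjRep O (σ.comp P.subtype)).comp R.subtype)
      (τ' := (conjRep O σ).comp (R.map P.subtype).subtype) α LinearMap.id (fun h m => rfl) ha
  · intro ha
    refine map_mem_repBrauerKernel (τ := (conjRep O σ).comp (R.map P.subtype).subtype)
      (τ' := (conjRep O (σ.comp P.subtype)).comp R.subtype) α.symm LinearMap.id (fun h m => ?_) ha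
    obtain ⟨r, rfl⟩ := α.surjective h
    rw [α.symm_apply_apply]
    rfl

/-- A basis element fixed by the twisted diagonal of `φ` is fixed by the smaller one of the
restriction. -/
theorem IsInvariantBasis.isFixedPointFusion_restrict [Module.Finite O A] (p : ℕ) [Fact p.Prime]
    [CharP (IsLocalRing.ResidueField O) p] (hp : IsPGroup p S) {Y : Set A}
    (hY : IsInvariantBasis O σ Y) {P Q R T : Subgroup S} {φ : P ≃* Q} {ψ : R ≃* T}
    (hψ : ∀ x : R, ∃ x' : P, (x' : S) = x ∧ ((ψ x : T) : S) = φ x')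
    (h : IsFixedPointFusion O σ φ.toMonoidHom) : IsFixedPointFusion O σ ψ.toMonoidHom := by
  refine ⟨ψ.injective, InteriorAlg.nontrivial_brauerQuotient_iff.mpr ?_⟩
  obtain ⟨y, hy, hyf⟩ :=
    (hY.nontrivial_brauerQuotient_iff p hp _).mp
      (InteriorAlg.nontrivial_brauerQuotient_iff.mp h.2)
  refine (hY.nontrivial_brauerQuotient_iff p hp _).mpr ⟨y, hy, ?_⟩
  rw [mem_fixedSubmodule_twistedDiag] at hyf ⊢
  intro x
  obtain ⟨x', hx1, hx2⟩ := hψ x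
  have h1 := hyf x'
  rw [hx1] at h1
  change σ ((ψ x : T) : S) * y = y * σ x
  rw [hx2]
  exact h1

end RestrictFusion

/-! ### Unit fusions and intrinsic balance. -/

section Fusion

variable {O S A : Type*} [CommRing O] [Group S] [Ring A] [Algebra O A] {σ : S →* A}
  {P Q : Subgroup S}

/-- As `φ` is onto `Q`, the conjugate `u i u⁻¹` is a nonzero idempotent of `A^Q` below the primitive
`j`, so it equals `j`. The intertwiners are `u i` and `i u⁻¹`; the unit `u` itself need not
intertwine. -/
theorem IsUnitFusion.exists_twistedEquiv {φ : P ≃* Q} {γ : Set (fixedAlgebra O σ P)}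
    {δ : Set (fixedAlgebra O σ Q)} (hγ : IsPoint γ) (hδ : IsPoint δ)
    (h : IsUnitFusion γ δ φ.toMonoidHom) :
    ∃ i ∈ γ, ∃ j ∈ δ, TwistedEquiv σ φ (i : A) j := by
  obtain ⟨-, i, hi, j, hj, u, h1, h2, h3⟩ := h
  have hip := hγ.isPrimitiveIdem hi
  have hjp := hδ.isPrimitiveIdem hj
  have hii : (i : A) * i = i := isIdempotentElem_coe hip.1
  have hjj : (j : A) * j = j := isIdempotentElem_coe hjp.1
  have h4 : (u * i * (u⁻¹ : Aˣ) : A) ∈ fixedAlgebra O σ Q := by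
    refine mem_fixedAlgebra.mpr fun y hy => mem_fixedAlgebra.mp h1 y ?_
    obtain ⟨x, hx⟩ := φ.surjective ⟨y, hy⟩
    exact ⟨x, congrArg Subtype.val hx⟩
  have hu : (u * i * (u⁻¹ : Aˣ) : A) * (u * i * (u⁻¹ : Aˣ)) = u * i * (u⁻¹ : Aˣ) := by
    rw [mul_assoc, mul_assoc, mul_assoc, Units.inv_mul_cancel_left, ← mul_assoc (i : A), hii]
  have hju : (j : A) * (u * i * (u⁻¹ : Aˣ)) = u * i * (u⁻¹ : Aˣ) := by
    rw [h2, ← mul_assoc, ← mul_assoc, hjj]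
  have huj : (u * i * (u⁻¹ : Aˣ) : A) * j = u * i * (u⁻¹ : Aˣ) := by
    rw [h2, mul_assoc, hjj]
  generalize hk : (u * i * (u⁻¹ : Aˣ) : A) = k at h1 h4 hu hju huj
  let k' : fixedAlgebra O σ Q := ⟨k, h4⟩
  have hku : k' * k' = k' := Subtype.ext hu
  have hjk : j * k' = k' := Subtype.ext hju
  have hkj : k' * j = k' := Subtype.ext huj
  have hjk' : j = k' := by
    have := hjp.2.2 k' (j - k') hku
      (by change (j - k') * (j - k') = j - k'
          rw [mul_sub, sub_mul, sub_mul, hjp.1.eq, hjk, hkj, hku, sub_self, sub_zero])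
      (by rw [mul_sub, hkj, hku, sub_self]) (by rw [sub_mul, hjk, hku, sub_self])
      (add_sub_cancel k' j).symm
    rcases this with h0 | h0
    · exfalso
      refine hip.2.1 (Subtype.ext ?_)
      have h5 : k = 0 := congrArg Subtype.val h0
      rw [h5, Units.mul_inv_eq_iff_eq_mul, zero_mul, Units.mul_right_eq_zero] at hk
      exact hk
    · exact sub_eq_zero.mp h0
  have h6 : ∀ x : P, σ (φ x) * (u * i) = u * i * σ x := fun x => by
    have h7 : (u * (σ x * i) * (u⁻¹ : Aˣ) : A) = σ (φ x) * (u * i * (u⁻¹ : Aˣ)) := h3 x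
    rw [Units.mul_inv_eq_iff_eq_mul, mem_fixedAlgebra.mp i.2 x x.2] at h7
    rw [mul_assoc (u : A), h7]
    simp [mul_assoc]
  refine ⟨i, hi, j, hj, u * i, i * (u⁻¹ : Aˣ), h6, fun x => ?_, ?_, ?_⟩
  · have h7 := mem_fixedAlgebra.mp h4 (φ x) (φ x).2
    rw [← hk, ← mul_assoc, h6] at h7
    rw [← mul_assoc, mem_fixedAlgebra.mp i.2 x x.2, ← Units.mul_right_inj u]
    simp only [← mul_assoc] at h7 ⊢
    exact h7
  · rw [mul_assoc, Units.inv_mul_cancel_left, hii]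
  · rw [mul_assoc, ← mul_assoc (i : A), hii, ← mul_assoc, hk, hjk']

theorem isUnitFusion_conjFixed {φ : P ≃* Q} {v : Aˣ} (hv : ∀ x : P, σ (φ x) * v = v * σ x)
    {γ : Set (fixedAlgebra O σ P)} {i : fixedAlgebra O σ P} (hi : i ∈ γ)
    (hii : IsIdempotentElem i) {δ : Set (fixedAlgebra O σ Q)} (hj : conjFixed O hv i ∈ δ) :
    IsUnitFusion γ δ φ.toMonoidHom := by
  have hc : ((conjFixed O hv i : fixedAlgebra O σ Q) : A) = v * i * (v⁻¹ : Aˣ) := rfl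
  have hjj : ((conjFixed O hv i : fixedAlgebra O σ Q) : A) * conjFixed O hv i = conjFixed O hv i :=
    isIdempotentElem_coe (map_isIdempotentElem hii)
  refine ⟨φ.injective, i, hi, conjFixed O hv i, hj, v, ?_, ?_, fun x => ?_⟩
  · rw [← hc]
    refine mem_fixedAlgebra.mpr ?_
    rintro _ ⟨x, rfl⟩
    exact mem_fixedAlgebra.mp (conjFixed O hv i).2 _ (φ x).2
  · rw [← hc, hjj, hjj]
  · rw [← mul_assoc, ← hv, mul_assoc, mul_assoc, mul_assoc]
    rfl

theorem conjFixed_symm_conjFixed {φ : P ≃* Q} {v : Aˣ} (hv : ∀ x : P, σ (φ x) * v = v * σ x)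
    (i : fixedAlgebra O σ P) :
    conjFixed O (φ := φ.symm) (v := v⁻¹) (inv_intertwines_symm hv) (conjFixed O hv i) = i := by
  refine Subtype.ext ?_
  rw [coe_conjFixed, coe_conjFixed]
  simp [mul_assoc]

variable [IsLocalRing O] [IsNoetherianRing O] [IsAdicComplete (IsLocalRing.maximalIdeal O) O]
  [Module.Finite O A] [Finite S]

/-- Conjugation by a fusion unit provides the target point in the first condition. For the second,
an isofusion of local points forces `A(φ) ≠ 0`, and conjugation by a unit for `φ` takes one point to
the other and `1` to `1`. -/
theorem HasFusionUnits.isIntrinsicallyBalanced (h : HasFusionUnits O σ) :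
    IsIntrinsicallyBalanced O σ := by
  constructor
  · intro P Q φ hφ γ hγ
    obtain ⟨v, hv⟩ := h P Q φ hφ
    have := isSemiperfectRing_subalgebra (fixedAlgebra O σ P)
    obtain ⟨i, hi⟩ := hγ.1.nonempty
    have hip := hγ.1.isPrimitiveIdem hi
    refine ⟨pointOf (conjFixed O hv i), isLocalPoint_pointOf
      ((isCornerEmbedding_conjFixed hv).isPrimitiveIdem_map hip) fun hmem =>
        hγ.notMem_brauerKernel hi ((twistedEquiv_conjFixed hv hip.1).mem_brauerKernel
          (isIdempotentElem_coe hip.1) hmem),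
      isUnitFusion_conjFixed hv hi hip.1 (mem_pointOf _),
      isUnitFusion_conjFixed (φ := φ.symm) (v := v⁻¹) (inv_intertwines_symm hv) (mem_pointOf _)
        (map_isIdempotentElem hip.1) ?_⟩
    rw [conjFixed_symm_conjFixed]
    exact hi
  · rintro P Q γ δ hγ hδ ⟨φ, hφ, -⟩
    have := isSemiperfectRing_subalgebra (fixedAlgebra O σ P)
    have := isSemiperfectRing_subalgebra (fixedAlgebra O σ Q)
    obtain ⟨i, hi, j, hj, hij⟩ := hφ.exists_twistedEquiv hγ.1 hδ.1
    have hip := hγ.1.isPrimitiveIdem hi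
    obtain ⟨v, hv⟩ := h P Q φ (hij.isFixedPointFusion (hγ.notMem_brauerKernel hi))
    have hcp := (isCornerEmbedding_conjFixed (O := O) hv).isPrimitiveIdem_map hip
    have h1 : conjFixed O hv (1 : fixedAlgebra O σ P) = 1 := by
      refine Subtype.ext ?_
      rw [coe_conjFixed]
      simp
    rw [hγ.1.eq_pointOf hi, hδ.1.eq_pointOf hj,
      ← pointOf_eq_of_idemEquiv hcp (hδ.1.isPrimitiveIdem hj) (hij.idemEquiv_conjFixed hv),
      ← (isCornerEmbedding_conjFixed (O := O) hv).pointMultiplicity_map hip IsIdempotentElem.one, h1]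

/-- Isomorphisms of the fixed-point fusion presystem of an intrinsically balanced algebra can be
inverted. -/
theorem IsIntrinsicallyBalanced.isFixedPointFusion_symm (h : IsIntrinsicallyBalanced O σ)
    {P Q : Subgroup S} {φ : P ≃* Q} (hφ : IsFixedPointFusion O σ φ.toMonoidHom) :
    IsFixedPointFusion O σ φ.symm.toMonoidHom := by
  have := isSemiperfectRing_subalgebra (fixedAlgebra O σ P)
  have := isSemiperfectRing_subalgebra (fixedAlgebra O σ Q)
  obtain ⟨a, ha, ha'⟩ := (isFixedPointFusion_equiv_iff φ).mp hφ
  obtain ⟨I, hI⟩ := IsSemiperfectRing.exists_decomposition (1 : fixedAlgebra O σ P)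
    IsIdempotentElem.one
  -- If all members of a decomposition of `1` were in the Brauer kernel at `P`, then `1` would be,
  -- and so `a = a 1` would be in the twisted kernel. Thus `P` has a local point, and the isofusion
  -- out of it can be read backwards.
  obtain ⟨i, hi, hin⟩ : ∃ i ∈ I, (i : A) ∉ brauerKernel O σ (twistedDiag P.subtype) := by
    by_contra! hcon
    refine ha' ?_
    have h1 : (1 : A) ∈ brauerKernel O σ (twistedDiag P.subtype) := by
      have h2 := congrArg Subtype.val hI.2.2
      rw [AddSubmonoidClass.coe_finsetSum] at h2
      have h3 : ∑ i ∈ I, (i : A) = 1 := h2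
      rw [← h3]
      exact Submodule.sum_mem _ hcon
    have h2 := mul_left_mem_brauerKernel (χ := Q.subtype.comp φ.toMonoidHom) ha h1
    rwa [mul_one] at h2
  obtain ⟨δ, hδ, hiso, -⟩ := h.1 P Q φ hφ _ (isLocalPoint_pointOf (hI.1 i hi) hin)
  obtain ⟨i0, -, j0, hj0, hij⟩ := hiso.exists_twistedEquiv (isPoint_pointOf (hI.1 i hi)) hδ.1
  exact hij.symm.isFixedPointFusion (hδ.notMem_brauerKernel hj0)

end Fusion

/-! ### Balance in the ambient algebra and fusion units of the corner. -/

section CornerBalance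

variable {O S A : Type*} [CommRing O] [Group S] [Ring A] [Algebra O A] {σ : S →* A} {l : A}
  (hl : IsIdempotentElem l) (hS : l ∈ fixedAlgebra O σ ⊤)

/-- The fixed points of the corner form a corner of the fixed points. -/
def cornerFixed (P : Subgroup S) :
    fixedAlgebra O (cornerHom σ hl hS) P →ₙ+* fixedAlgebra O σ P where
  toFun x := ⟨x.1.1, (mem_fixedAlgebra_corner_iff hl hS).mp x.2⟩
  map_mul' _ _ := rfl
  map_zero' := rfl
  map_add' _ _ := rfl

theorem cornerFixed_one (P : Subgroup S) : cornerFixed hl hS P 1 = restrictFixed hS P := rfl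

include hl in
theorem isIdempotentElem_restrictFixed (P : Subgroup S) :
    IsIdempotentElem (restrictFixed hS P) := Subtype.ext hl

theorem isCornerEmbedding_cornerFixed (P : Subgroup S) :
    IsCornerEmbedding (cornerFixed hl hS P) where
  injective x y h := by
    have h1 : (x : hl.Corner).1 = (y : hl.Corner).1 :=
      congrArg (fun z : fixedAlgebra O σ P => (z : A)) h
    exact Subtype.ext (Subtype.ext h1)
  exists_eq x h1 h2 :=
    ⟨⟨toCorner hl (congrArg Subtype.val h1) (congrArg Subtype.val h2),
      (mem_fixedAlgebra_corner_iff hl hS).mpr x.2⟩, rfl⟩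

theorem TwistedEquiv.of_corner {P Q : Subgroup S} {φ : P ≃* Q} {x y : hl.Corner}
    (h : TwistedEquiv (cornerHom σ hl hS) φ x y) : TwistedEquiv σ φ x.1 y.1 := by
  obtain ⟨a, b, ha, hb, rfl, rfl⟩ := h
  refine ⟨a.1, b.1, fun x => ?_, fun x => ?_, rfl, rfl⟩
  · have := congrArg Subtype.val (ha x)
    rwa [coe_cornerHom_mul, coe_mul_cornerHom] at this
  · have := congrArg Subtype.val (hb x)
    rwa [coe_cornerHom_mul, coe_mul_cornerHom] at this

/-- An equivalence of `l` with a conjugate yields a unit of the corner. -/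
theorem exists_corner_unit {P Q : Subgroup S} {φ : P ≃* Q} {v : Aˣ}
    (hv : ∀ x : P, σ (φ x) * v = v * σ x) {a b : A}
    (hb : b ∈ fixedAlgebra O σ P) (h1 : a * b = l) (h2 : b * a = (v⁻¹ : Aˣ) * (l * v))
    (h3 : l * a = a) (h4 : a * ((v⁻¹ : Aˣ) * (l * v)) = a)
    (h5 : (v⁻¹ : Aˣ) * (l * v) * b = b) (h6 : b * l = b) :
    ∃ u : (hl.Corner)ˣ, ∀ x : P, cornerHom σ hl hS (φ x) * u = u * cornerHom σ hl hS x := by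
  have k1 : l * (v * b) = v * b := by
    conv_rhs => rw [← h5]
    simp [mul_assoc]
  have k2 : v * b * l = v * b := by rw [mul_assoc, h6]
  have k3 : l * (a * (v⁻¹ : Aˣ)) = a * (v⁻¹ : Aˣ) := by rw [← mul_assoc, h3]
  have k4 : a * (v⁻¹ : Aˣ) * l = a * (v⁻¹ : Aˣ) := by
    conv_rhs => rw [← h4]
    simp [mul_assoc]
  refine ⟨⟨toCorner hl k1 k2, toCorner hl k3 k4, Subtype.ext ?_, Subtype.ext ?_⟩, fun x =>
    Subtype.ext ?_⟩
  · change v * b * (a * (v⁻¹ : Aˣ)) = l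
    rw [mul_assoc, ← mul_assoc b, h2]
    simp [mul_assoc]
  · change a * (v⁻¹ : Aˣ) * (v * b) = l
    rw [mul_assoc, Units.inv_mul_cancel_left, h1]
  · rw [coe_cornerHom_mul, coe_mul_cornerHom]
    exact mul_intertwines hv hb x

variable [IsLocalRing O]

/-- The multiplicities in `l` of local points are invariant under conjugation by units of `A` that
induce isomorphisms of the fixed-point fusion presystem of the corner. -/
def IsUnitBalanced {O S A : Type*} [CommRing O] [Group S] [Ring A] [Algebra O A] [IsLocalRing O]
    {σ : S →* A} {l : A} (hl : IsIdempotentElem l) (hS : l ∈ fixedAlgebra O σ ⊤) : Prop :=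
  ∀ (P Q : Subgroup S) (φ : P ≃* Q), IsFixedPointFusion O (cornerHom σ hl hS) φ.toMonoidHom →
    ∀ (v : Aˣ) (hv : ∀ x : P, σ (φ x) * v = v * σ x) (i : fixedAlgebra O σ P),
      IsPrimitiveIdem i → (i : A) ∉ brauerKernel O σ (twistedDiag P.subtype) →
      pointMultiplicity (pointOf i) (restrictFixed hS P) =
        pointMultiplicity (pointOf (conjFixed O hv i)) (restrictFixed hS Q)

variable [IsNoetherianRing O] [IsAdicComplete (IsLocalRing.maximalIdeal O) O] [Module.Finite O A]

variable {hl hS}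

/-- A fusion unit of the corner is a twisted equivalence of `l` with itself. Hence `v l v⁻¹` and `l`
are equivalent in `A^Q`, while conjugation by `v` preserves multiplicities. -/
theorem HasFusionUnits.isUnitBalanced (h : HasFusionUnits O (cornerHom σ hl hS)) :
    IsUnitBalanced hl hS := by
  intro P Q φ hφ v hv i hi _
  have := isSemiperfectRing_subalgebra (fixedAlgebra O σ P)
  have := isSemiperfectRing_subalgebra (fixedAlgebra O σ Q)
  obtain ⟨u, hu⟩ := h P Q φ hφ
  have h1 : TwistedEquiv (cornerHom σ hl hS) φ 1 1 :=
    ⟨u, (u⁻¹ : (hl.Corner)ˣ), hu, inv_intertwines hu, u.inv_mul, u.mul_inv⟩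
  have h2 : IdemEquiv (conjFixed O hv (restrictFixed hS P)) (restrictFixed hS Q) :=
    TwistedEquiv.idemEquiv_conjFixed (i := restrictFixed hS P) (j := restrictFixed hS Q) hv
      (h1.of_corner hl hS)
  have hemb := isCornerEmbedding_conjFixed (O := O) hv
  rw [← hemb.pointMultiplicity_map hi (isIdempotentElem_restrictFixed hl hS P)]
  exact pointMultiplicity_congr (isPoint_pointOf (hemb.isPrimitiveIdem_map hi))
    (map_isIdempotentElem (isIdempotentElem_restrictFixed hl hS P))
    (isIdempotentElem_restrictFixed hl hS Q) h2

variable [Finite S]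

/-- With `v` a unit of the ambient algebra inducing `φ`, the idempotents `l` and `f = v⁻¹ l v` have
equal local multiplicities for all subgroups of `P`. An equivalence between them in `A^P`, composed
with `v`, is a unit of the corner that still intertwines along `φ`. -/
theorem IsUnitBalanced.hasFusionUnits (p : ℕ) [Fact p.Prime]
    [CharP (IsLocalRing.ResidueField O) p] (hp : IsPGroup p S) (hσ : HasUnitalInvariantBasis O σ)
    (h : IsUnitBalanced hl hS) : HasFusionUnits O (cornerHom σ hl hS) := by
  have hA := hσ.hasFusionUnits p hp
  obtain ⟨Y, hY, -⟩ := hσ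
  obtain ⟨Y', hY'⟩ := exists_isInvariantBasis_corner hl hS p hp hY
  have := finite_corner (O := O) hl
  intro P Q φ hφ
  obtain ⟨v, hv⟩ := hA P Q φ (isFixedPointFusion_of_corner hl hS hφ)
  set f : A := (v⁻¹ : Aˣ) * (l * v) with hf
  have hff : IsIdempotentElem f := by
    change (v⁻¹ : Aˣ) * (l * v) * ((v⁻¹ : Aˣ) * (l * v)) = (v⁻¹ : Aˣ) * (l * v)
    rw [mul_assoc, mul_assoc, Units.mul_inv_cancel_left, ← mul_assoc l, hl.eq]
  -- `P` takes the role of the whole group. For each subgroup `R` the balance condition is applied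
  -- to the restriction of `φ`, which is again a fusion of the corner, with the same unit `v`.
  have hsame : ∀ R : Subgroup P, SameMultiplicities (fixedAlgebra O (σ.comp P.subtype) R)
      (repBrauerKernel ((conjRep O (σ.comp P.subtype)).comp R.subtype)) l f := by
    intro R
    rw [fixedAlgebra_comp_subtype, repBrauerKernel_comp_subtype]
    obtain ⟨T, ψ, hψ⟩ := exists_restrict φ R
    have hvψ : ∀ x : R.map P.subtype, σ (ψ x) * v = v * σ x := fun x => by
      obtain ⟨x', hx1, hx2⟩ := hψ x
      rw [hx2, ← hx1, hv]
    have hfR : f ∈ fixedAlgebra O σ (R.map P.subtype) := by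
      refine mul_mem_fixedAlgebra_of_intertwines' (φ := ψ) (fun x => ?_) (inv_intertwines hvψ)
      rw [← mul_assoc, comm_of_mem_fixedAlgebra_top hS, mul_assoc, hvψ, mul_assoc]
    have hconj : conjFixed O hvψ ⟨f, hfR⟩ = restrictFixed hS T := by
      refine Subtype.ext ?_
      rw [coe_conjFixed]
      change v * ((v⁻¹ : Aˣ) * (l * v)) * (v⁻¹ : Aˣ) = l
      simp
    refine ⟨(restrictFixed hS _).2, hfR, fun x hx hxK => ?_⟩
    have := isSemiperfectRing_subalgebra (fixedAlgebra O σ (R.map P.subtype))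
    have := isSemiperfectRing_subalgebra (fixedAlgebra O σ T)
    rw [← (isCornerEmbedding_conjFixed (O := O) hvψ).pointMultiplicity_map hx
      (isIdempotentElem_mk hff hfR), hconj]
    exact h _ T ψ (hY'.isFixedPointFusion_restrict p hp hψ hφ) v hvψ x hx hxK
  obtain ⟨hl1, hf1, -⟩ := hsame ⊤
  obtain ⟨a, b, h1, h2, h3, h4, h5, h6⟩ := (idemEquiv_of_sameMultiplicities p (hp.to_subgroup P)
    (e := ⟨l, hl1⟩) (f := ⟨f, hf1⟩) (isIdempotentElem_mk hl hl1) (isIdempotentElem_mk hff hf1)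
    hsame).exists_normalized (isIdempotentElem_mk hl hl1) (isIdempotentElem_mk hff hf1)
  have hmem : ∀ c : fixedAlgebra O (σ.comp P.subtype) ⊤, (c : A) ∈ fixedAlgebra O σ P := fun c =>
    mem_fixedAlgebra.mpr fun x hx => mem_fixedAlgebra.mp c.2 ⟨x, hx⟩ trivial
  have val : ∀ {x y : fixedAlgebra O (σ.comp P.subtype) ⊤}, x = y → (x : A) = y :=
    fun h => congrArg _ h
  exact exists_corner_unit hl hS hv (hmem b) (val h1) (val h2) (val h3) (val h4) (val h5)
    (val h6)

/-- The units `v` and `v⁻¹` represent a twisted unit and its twisted inverse, so the transport of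
points is realized by conjugation with `v`. -/
theorem IsUnitBalanced.isBalanced (hA : HasFusionUnits O σ) (h : IsUnitBalanced hl hS) :
    IsBalanced σ hl hS := by
  intro P Q φ hφ γ hγ
  have := isSemiperfectRing_subalgebra (fixedAlgebra O σ P)
  obtain ⟨v, hv⟩ := hA P Q φ (isFixedPointFusion_of_corner hl hS hφ)
  obtain ⟨i, hi⟩ := hγ.1.nonempty
  have hip := hγ.1.isPrimitiveIdem hi
  have hin := hγ.notMem_brauerKernel hi
  refine ⟨pointOf (conjFixed O hv i), isLocalPoint_pointOf
    ((isCornerEmbedding_conjFixed hv).isPrimitiveIdem_map hip) fun hmem =>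
      hin ((twistedEquiv_conjFixed hv hip.1).mem_brauerKernel
        (isIdempotentElem_coe hip.1) hmem), ⟨v, (v⁻¹ : Aˣ), ⟨?_, ?_, ?_⟩, i, hi,
      conjFixed O hv i, mem_pointOf _, 1, one_mem _, 1, one_mem _, ?_, ?_, ?_⟩, ?_⟩
  · exact mem_fixedSubmodule_twistedDiag.mpr hv
  · exact mem_fixedSubmodule_twistedDiag.mpr (inv_intertwines_symm hv)
  · rw [Units.inv_mul, sub_self]
    exact zero_mem _
  · rw [mul_one, sub_self]
    exact zero_mem _
  · rw [mul_one, sub_self]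
    exact zero_mem _
  · rw [coe_conjFixed, one_mul, mul_one, sub_self]
    exact zero_mem _
  · rw [hγ.1.eq_pointOf hi]
    exact h P Q φ hφ v hv i hip hin

/-- The transport of local points along twisted units is given by any intertwining unit. -/
theorem TwistedTransport.exists_idemEquiv {P Q : Subgroup S} {φ : P ≃* Q} {v : Aˣ}
    (hv : ∀ x : P, σ (φ x) * v = v * σ x) {γ : Set (fixedAlgebra O σ P)}
    {δ : Set (fixedAlgebra O σ Q)} (hγ : IsPoint γ) (hδ : IsLocalPoint O σ Q δ)
    (h : TwistedTransport O σ φ γ δ) : ∃ i ∈ γ, ∃ j ∈ δ, IdemEquiv j (conjFixed O hv i) := by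
  have := isSemiperfectRing_subalgebra (fixedAlgebra O σ Q)
  obtain ⟨a, b, ⟨ha, hb, -⟩, i, hi, j, hj, c, hc, d, hd, -, -, hker⟩ := h
  rw [mem_fixedSubmodule_twistedDiag] at ha hb
  have hb' : ∀ x : P, σ x * b = b * σ (φ x) := fun x => by
    have : σ (φ.symm (φ x)) * b = b * σ (φ x) := hb (φ x)
    rwa [φ.symm_apply_apply] at this
  have hjp := hδ.1.isPrimitiveIdem hj
  have hjl : IsLocalIdem j := IsSemiperfectRing.isLocalIdem j hjp
  let x : fixedAlgebra O σ Q :=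
    ⟨c * (a * (v⁻¹ : Aˣ)), mul_mem hc (mul_mem_fixedAlgebra_of_intertwines ha (inv_intertwines hv))⟩
  let y : fixedAlgebra O σ Q :=
    ⟨v * b * d, mul_mem (mul_mem_fixedAlgebra_of_intertwines hv hb') hd⟩
  refine ⟨i, hi, j, hj, IsPrimitiveIdem.idemEquiv_of_isCornerUnit (a := x) (b := y) hjp.1 hjp.2.1
    ((isCornerEmbedding_conjFixed hv).isPrimitiveIdem_map (hγ.isPrimitiveIdem hi)) ?_⟩
  set w := x * conjFixed O hv i * y with hw
  have hwc : (w : A) = c * (a * i * b) * d := by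
    change c * (a * (v⁻¹ : Aˣ)) * (v * i * (v⁻¹ : Aˣ)) * (v * b * d) = _
    simp [mul_assoc]
  -- `w` is congruent to `j` modulo the Brauer kernel. Were `j (1 - w) j` invertible at `j`, then
  -- `j` would lie in that kernel; so by locality `j w j` is invertible, and `j` is equivalent to
  -- the conjugate of `i`.
  refine (hjl.2.2 w).resolve_right fun ⟨z, hz, _⟩ => hδ.notMem_brauerKernel hj ?_
  have h1 : ((j * (1 - w) * j : fixedAlgebra O σ Q) : A) =
      j * (-(c * (a * i * b) * d - j)) * j := by
    have h2 : j * (1 - w) * j = j * (-(w - j)) * j := by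
      rw [neg_sub, mul_sub, mul_sub, mul_one, sub_mul, sub_mul, hjp.1.eq, hjp.1.eq]
    rw [h2]
    change (j : A) * (-((w : A) - j)) * j = _
    rw [hwc]
  have h3 := mul_mem_brauerKernel (mul_mem z.2 j.2) j.2 (neg_mem hker)
  have h4 : (j : A) = z * j * (-(c * (a * i * b) * d - j)) * j := by
    have h5 : ((z * (j * (1 - w) * j) : fixedAlgebra O σ Q) : A) = j := congrArg Subtype.val hz
    rw [← h5]
    change (z : A) * ((j * (1 - w) * j : fixedAlgebra O σ Q) : A) = _
    rw [h1, h5]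
    simp only [mul_assoc]
  rw [h4]
  exact h3

theorem IsBalanced.isUnitBalanced (h : IsBalanced σ hl hS) : IsUnitBalanced hl hS := by
  intro P Q φ hφ v hv i hi hin
  have := isSemiperfectRing_subalgebra (fixedAlgebra O σ P)
  have := isSemiperfectRing_subalgebra (fixedAlgebra O σ Q)
  obtain ⟨δ, hδ, htr, hm⟩ := h P Q φ hφ _ (isLocalPoint_pointOf hi hin)
  obtain ⟨i0, hi0, j, hj, hij⟩ := htr.exists_idemEquiv hv (isPoint_pointOf hi) hδ
  have hemb := isCornerEmbedding_conjFixed (O := O) hv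
  have h1 := ((isPoint_pointOf hi).mem_iff (mem_pointOf i)).mp hi0
  have h2 := hemb.isPrimitiveIdem_map hi
  have h3 := hemb.isPrimitiveIdem_map h1.1
  rw [hm, pointOf_eq_of_idemEquiv h2 h3 (h1.2.map _),
    ← pointOf_eq_of_idemEquiv (hδ.1.isPrimitiveIdem hj) h3 hij, ← hδ.1.eq_pointOf hj]

/-- Nonzero multiplicity in `l` means that the point of `i` comes from a local point of the corner.
Intrinsic balance carries the latter along `φ` to a point of equal multiplicity, and in the ambient
algebra this point is the conjugate by `v`. -/
theorem IsIntrinsicallyBalanced.pointMultiplicity_eq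
    (h : IsIntrinsicallyBalanced O (cornerHom σ hl hS)) {P Q : Subgroup S} {φ : P ≃* Q}
    (hφ : IsFixedPointFusion O (cornerHom σ hl hS) φ.toMonoidHom) {v : Aˣ}
    (hv : ∀ x : P, σ (φ x) * v = v * σ x) {i : fixedAlgebra O σ P} (hi : IsPrimitiveIdem i)
    (hin : (i : A) ∉ brauerKernel O σ (twistedDiag P.subtype))
    (hm : pointMultiplicity (pointOf i) (restrictFixed hS P) ≠ 0) :
    pointMultiplicity (pointOf i) (restrictFixed hS P) =
      pointMultiplicity (pointOf (conjFixed O hv i)) (restrictFixed hS Q) := by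
  have := finite_corner (O := O) hl
  have := isSemiperfectRing_subalgebra (fixedAlgebra O σ P)
  have := isSemiperfectRing_subalgebra (fixedAlgebra O σ Q)
  have := isSemiperfectRing_subalgebra (fixedAlgebra O (cornerHom σ hl hS) P)
  have := isSemiperfectRing_subalgebra (fixedAlgebra O (cornerHom σ hl hS) Q)
  have hP := isCornerEmbedding_cornerFixed hl hS P
  have hQ := isCornerEmbedding_cornerFixed hl hS Q
  have hemb := isCornerEmbedding_conjFixed (O := O) hv
  obtain ⟨k, hk, hik, hlk, hkl⟩ := exists_idemEquiv_of_pointMultiplicity_ne_zero hi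
    (isIdempotentElem_restrictFixed hl hS P) hm
  obtain ⟨k, rfl⟩ := hP.exists_eq k hlk hkl
  have hkp := hP.isPrimitiveIdem_of_map hk
  have hkn : (k : hl.Corner) ∉ brauerKernel O (cornerHom σ hl hS) (twistedDiag P.subtype) :=
    fun hmem => hin (hik.mem_brauerKernel hi.1 ((mem_brauerKernel_corner_iff hl hS).mp hmem))
  have hloc := isLocalPoint_pointOf hkp hkn
  obtain ⟨δ, hδ, hiso⟩ := h.1 P Q φ hφ _ hloc
  have h1 := h.2 P Q _ δ hloc hδ ⟨φ, hiso⟩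
  obtain ⟨i0, hi0, j0, hj0, hij⟩ := hiso.1.exists_twistedEquiv hloc.1 hδ.1
  have h2 := (hloc.1.mem_iff (mem_pointOf k)).mp hi0
  have hj0p := hδ.1.isPrimitiveIdem hj0
  have h3 : IdemEquiv (conjFixed O hv (cornerFixed hl hS P i0)) (cornerFixed hl hS Q j0) :=
    (hij.of_corner hl hS).idemEquiv_conjFixed (i := cornerFixed hl hS P i0)
      (j := cornerFixed hl hS Q j0) hv
  have h4 : IdemEquiv i (cornerFixed hl hS P i0) :=
    hik.trans (h2.2.map _) hi.1 hk.1 (hP.isPrimitiveIdem_map h2.1).1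
  have h5 := hemb.isPrimitiveIdem_map hi
  have h6 := hemb.isPrimitiveIdem_map (hP.isPrimitiveIdem_map h2.1)
  have h7 := hQ.isPrimitiveIdem_map hj0p
  rw [hδ.1.eq_pointOf hj0, ← hP.pointMultiplicity_map hkp IsIdempotentElem.one,
    ← hQ.pointMultiplicity_map hj0p IsIdempotentElem.one, cornerFixed_one, cornerFixed_one] at h1
  rw [pointOf_eq_of_idemEquiv hi hk hik, h1, pointOf_eq_of_idemEquiv h5 h7
    ((h4.map _).trans h3 h5.1 h6.1 h7.1)]

/-- Points of multiplicity zero in `l` are invisible in the corner. If the conjugate point had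
nonzero multiplicity, the previous case applied to `φ⁻¹` and `v⁻¹` would give a contradiction. -/
theorem IsIntrinsicallyBalanced.isUnitBalanced
    (h : IsIntrinsicallyBalanced O (cornerHom σ hl hS)) : IsUnitBalanced hl hS := by
  have := finite_corner (O := O) hl
  intro P Q φ hφ v hv i hi hin
  by_cases hm : pointMultiplicity (pointOf i) (restrictFixed hS P) = 0
  · by_contra hne
    rw [hm] at hne
    have h1 := h.pointMultiplicity_eq (φ := φ.symm) (v := v⁻¹) (h.isFixedPointFusion_symm hφ)
      (inv_intertwines_symm hv) ((isCornerEmbedding_conjFixed hv).isPrimitiveIdem_map hi)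
      (fun hmem => hin ((twistedEquiv_conjFixed hv hi.1).mem_brauerKernel
        (isIdempotentElem_coe hi.1) hmem)) (Ne.symm hne)
    rw [conjFixed_symm_conjFixed, hm] at h1
    exact hne h1.symm
  · exact h.pointMultiplicity_eq hφ hv hi hin hm

end CornerBalance

end InteriorAlg

/-! ### The main theorem: each condition is equivalent to the existence of fusion units in the
corner. -/

theorem mainTheorem7 (p : ℕ) [Fact p.Prime]
    {O : Type*} [CommRing O] [IsDomain O] [IsLocalRing O] [IsNoetherianRing O]
    [IsAdicComplete (IsLocalRing.maximalIdeal O) O]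
    [IsAlgClosed (IsLocalRing.ResidueField O)] [CharP (IsLocalRing.ResidueField O) p]
    {S : Type*} [Group S] [Finite S] (hp : IsPGroup p S)
    {A : Type*} [Ring A] [Algebra O A] [Module.Free O A] [Module.Finite O A]
    (σ : S →* A) (hdiv : InteriorAlg.IsDivisible O σ)
    (hunital : InteriorAlg.HasUnitalInvariantBasis O σ)
    (l : A) (hl : IsIdempotentElem l) (hS : l ∈ InteriorAlg.fixedAlgebra O σ ⊤) :
    (InteriorAlg.HasUnitalInvariantBasis O (InteriorAlg.cornerHom σ hl hS) ↔
      InteriorAlg.IsBalanced σ hl hS) ∧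
    (InteriorAlg.IsBalanced σ hl hS ↔
      InteriorAlg.IsIntrinsicallyBalanced O (InteriorAlg.cornerHom σ hl hS)) := by
  have := InteriorAlg.finite_corner (O := O) hl
  have hA := hunital.hasFusionUnits p hp
  have h1 : InteriorAlg.HasUnitalInvariantBasis O (InteriorAlg.cornerHom σ hl hS) ↔
      InteriorAlg.HasFusionUnits O (InteriorAlg.cornerHom σ hl hS) :=
    ⟨fun h => h.hasFusionUnits p hp, fun h =>
      h.hasUnitalInvariantBasis_corner hl hS p hp hdiv.bifree⟩
  have h2 : InteriorAlg.IsBalanced σ hl hS ↔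
      InteriorAlg.HasFusionUnits O (InteriorAlg.cornerHom σ hl hS) :=
    ⟨fun h => h.isUnitBalanced.hasFusionUnits p hp hunital,
      fun h => h.isUnitBalanced.isBalanced hA⟩
  have h3 : InteriorAlg.IsIntrinsicallyBalanced O (InteriorAlg.cornerHom σ hl hS) ↔
      InteriorAlg.HasFusionUnits O (InteriorAlg.cornerHom σ hl hS) :=
    ⟨fun h => h.isUnitBalanced.hasFusionUnits p hp hunital, fun h => h.isIntrinsicallyBalanced⟩
  exact ⟨h1.trans h2.symm, h2.trans h3.symm⟩
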